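/- Let $n\ge 0$ and $k\ge 1$ be integers, let $p\in[1,+\infty]$ and $q\in[1,+\infty)$. There exists a constant $C=C(n,k,p,q)$ such that for every smooth compact $n$-dimensional Riemannian manifold $(M,g)$ without boundary, every smooth tensor field $T$ on $M$ (of any type $(a,b)$) and every integer $0\le j\le k$, $$ \Vert \nabla^j T\Vert_{r_j}\;\le\; C\,\Vert T\Vert_p^{1-\frac jk}\,\Vert \nabla^k T\Vert_q^{\frac jk}, \qquad\text{where}\qquad \frac1{r_j}=\frac{1-\frac jk}{p}+\frac{\frac jk}{q} $$ (with $1/\infty=0$, $1/0=\infty$ and $0^0=1$). Here $\nabla$ is the Levi-Civita connection of $g$, $|\cdot|$ is the pointwise norm induced by $g$ on tensors, and $\Vert S\Vert_r$ is the norm of $|S|$ in $L^r(M,\mu_g)$ with respect to the Riemannian volume measure $\mu_g$. The constant $C$ depends neither on $(M,g)$, nor on the type of $T$, nor on $j$ or $T$. -/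

import Mathlib

open scoped Manifold ContDiff ENNReal NNReal
open MeasureTheory

set_option maxSynthPendingDepth 3

noncomputable section

namespace RiemTensor

/-! ### Tensors on a vector space -/

/-- The model space `ℝⁿ`. -/
abbrev Model (n : ℕ) : Type := EuclideanSpace ℝ (Fin n)

/-- The standard basis vector `e_i` of `ℝⁿ`. -/
def stdVec {n : ℕ} (i : Fin n) : Model n := EuclideanSpace.single i 1

/-- The `i`-th coordinate covector `dx^i` of `ℝⁿ`. -/
def stdCovec {n : ℕ} (i : Fin n) : Model n →L[ℝ] ℝ := EuclideanSpace.proj i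

/-- Tensors on `V` that are contravariant of order `a` and covariant of order `b`, as multilinear
functions of `b` vectors and `a` covectors: `S v α` is the value of `S` on the vectors `v` and the
covectors `α`. -/
abbrev TensorSpace (V : Type*) [AddCommGroup V] [Module ℝ V] [TopologicalSpace V]
    [IsTopologicalAddGroup V] [ContinuousSMul ℝ V] (a b : ℕ) : Type _ :=
  V [×b]→L[ℝ] ((V →L[ℝ] ℝ) [×a]→L[ℝ] ℝ)

section Transport

variable {V W : Type*}
  [AddCommGroup V] [Module ℝ V] [TopologicalSpace V] [IsTopologicalAddGroup V]
  [ContinuousSMul ℝ V]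
  [AddCommGroup W] [Module ℝ W] [TopologicalSpace W] [IsTopologicalAddGroup W]
  [ContinuousSMul ℝ W] {a b : ℕ}

/-- The tensor on `V` obtained from a tensor `S` on `W` by means of a linear isomorphism
`L : V → W` with inverse `L' : W → V`. -/
def transport (L : V →L[ℝ] W) (L' : W →L[ℝ] V) (S : TensorSpace W a b) : TensorSpace V a b :=
  (ContinuousMultilinearMap.compContinuousLinearMapL
      (fun _ : Fin a => ContinuousLinearMap.precomp ℝ L')).compContinuousMultilinearMap
    (S.compContinuousLinearMap (fun _ => L))

theorem transport_apply (L : V →L[ℝ] W) (L' : W →L[ℝ] V) (S : TensorSpace W a b)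
    (v : Fin b → V) (α : Fin a → (V →L[ℝ] ℝ)) :
    transport L L' S v α = S (fun j => L (v j)) (fun i => (α i).comp L') := by
  rfl

end Transport

/-- The derivation of the tensor algebra of `ℝⁿ` given by a family of endomorphisms `Γ u`,
depending linearly on a vector `u`; see `connectionTerm_apply`. -/
def connectionTerm {n a b : ℕ} (Γ : Model n →L[ℝ] Model n →L[ℝ] Model n)
    (S : TensorSpace (Model n) a b) : Model n →L[ℝ] TensorSpace (Model n) a b :=
  (ContinuousLinearMap.compContinuousMultilinearMapL ℝ (fun _ : Fin b => Model n)
        ((Model n →L[ℝ] ℝ) [×a]→L[ℝ] ℝ) ((Model n →L[ℝ] ℝ) [×a]→L[ℝ] ℝ)).flip S ∘L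
      ((ContinuousMultilinearMap.compContinuousLinearMapContinuousMultilinear ℝ
          (fun _ : Fin a => Model n →L[ℝ] ℝ) (fun _ : Fin a => Model n →L[ℝ] ℝ) ℝ).linearDeriv
        (fun _ => ContinuousLinearMap.id ℝ (Model n →L[ℝ] ℝ))) ∘L
      ContinuousLinearMap.pi
        (fun _ => (ContinuousLinearMap.compL ℝ (Model n) (Model n) ℝ).flip ∘L Γ)
    - (S.fderivCompContinuousLinearMap (fun _ => ContinuousLinearMap.id ℝ (Model n))) ∘L
        ContinuousLinearMap.pi (fun _ => Γ)

theorem connectionTerm_apply {n a b : ℕ} (Γ : Model n →L[ℝ] Model n →L[ℝ] Model n)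
    (S : TensorSpace (Model n) a b) (u : Model n) (v : Fin b → Model n)
    (α : Fin a → (Model n →L[ℝ] ℝ)) :
    connectionTerm Γ S u v α =
      (∑ i, S v (Function.update α i ((α i).comp (Γ u))))
        - ∑ j, S (Function.update v j (Γ u (v j))) α := by
  rw [connectionTerm, sub_apply, sub_apply, sub_apply]
  congr 1
  · simp only [ContinuousLinearMap.comp_apply, ContinuousLinearMap.flip_apply,
      ContinuousMultilinearMap.linearDeriv_apply, map_sum, sum_apply]
    refine Finset.sum_congr rfl fun i _ => ?_
    change (S v) (fun m => Function.update (fun _ => ContinuousLinearMap.id ℝ (Model n →L[ℝ] ℝ)) i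
      ((ContinuousLinearMap.compL ℝ (Model n) (Model n) ℝ).flip (Γ u)) m (α m)) = _
    congr 1
    funext m
    rcases eq_or_ne m i with rfl | h
    · simp
    · simp [h]
  · simp only [ContinuousLinearMap.comp_apply,
      ContinuousMultilinearMap.fderivCompContinuousLinearMap_apply, sum_apply]
    refine Finset.sum_congr rfl fun j _ => ?_
    congr 2
    funext m
    rcases eq_or_ne m j with rfl | h
    · simp
    · simp [h]

/-! ### Riemannian manifolds -/

section Manifold

variable {n : ℕ} {M : Type*} [TopologicalSpace M] [ChartedSpace (Model n) M]

/-- The differential at `x` of the chart around `c`. -/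
def chartD (c x : M) : TangentSpace (𝓡 n) x →L[ℝ] Model n :=
  mfderiv (𝓡 n) 𝓘(ℝ, Model n) (extChartAt (𝓡 n) c) x

/-- The inverse of the differential at `x` of the chart around `c`. -/
def chartDInv (c x : M) : Model n →L[ℝ] TangentSpace (𝓡 n) x :=
  (chartD c x).inverse

variable (n M) in
/-- (Not necessarily smooth) tensor fields of type `(a, b)` on `M`. -/
abbrev TensorField (a b : ℕ) : Type _ := ∀ x : M, TensorSpace (TangentSpace (𝓡 n) x) a b

/-- The tensor field `T` in the chart around `c`, as a function of the coordinates `y`. -/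
def localTensor {a b : ℕ} (T : TensorField n M a b) (c : M) (y : Model n) :
    TensorSpace (Model n) a b :=
  let x := (extChartAt (𝓡 n) c).symm y
  transport (chartDInv c x) (chartD c x) (T x)

/-- A tensor field is smooth if it is smooth in every chart. -/
def IsSmooth {a b : ℕ} (T : TensorField n M a b) : Prop :=
  ∀ c : M, ContDiffOn ℝ ∞ (localTensor T c) (extChartAt (𝓡 n) c).target

variable [IsManifold (𝓡 n) ∞ M]

variable (n M) in
/-- Smooth Riemannian metrics on `M`. -/
abbrev Metric : Type _ :=
  Bundle.ContMDiffRiemannianMetric (𝓡 n) ∞ (Model n) (fun x : M => TangentSpace (𝓡 n) x)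

/-- The metric in the chart around `c`, as a bilinear form depending on the coordinates `y`. -/
def localMetric (g : Metric n M) (c : M) (y : Model n) : Model n →L[ℝ] Model n →L[ℝ] ℝ :=
  let x := (extChartAt (𝓡 n) c).symm y
  (ContinuousLinearMap.precomp ℝ (chartDInv c x)) ∘L (g.inner x) ∘L (chartDInv c x)

/-- The matrix `g_{ij}` of the metric in the chart around `c`. -/
def gram (g : Metric n M) (c : M) (y : Model n) : Matrix (Fin n) (Fin n) ℝ :=
  Matrix.of fun i j => localMetric g c y (stdVec i) (stdVec j)

/-- For fixed `l`, the bilinear form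
`(u, v) ↦ ∂_u g(v, e_l) + ∂_v g(u, e_l) - ∂_{e_l} g(u, v)` in the chart around `c`. -/
def christoffelLower (g : Metric n M) (c : M) (y : Model n) (l : Fin n) :
    Model n →L[ℝ] Model n →L[ℝ] ℝ :=
  let Dg : Model n →L[ℝ] Model n →L[ℝ] Model n →L[ℝ] ℝ := fderiv ℝ (localMetric g c) y
  let A : Model n →L[ℝ] Model n →L[ℝ] ℝ :=
    (ContinuousLinearMap.compL ℝ (Model n) (Model n →L[ℝ] ℝ) ℝ
      (ContinuousLinearMap.apply ℝ ℝ (stdVec l))) ∘L Dg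
  A + A.flip - Dg (stdVec l)

theorem christoffelLower_apply (g : Metric n M) (c : M) (y : Model n) (l : Fin n)
    (u v : Model n) :
    christoffelLower g c y l u v =
      fderiv ℝ (localMetric g c) y u v (stdVec l) + fderiv ℝ (localMetric g c) y v u (stdVec l)
        - fderiv ℝ (localMetric g c) y (stdVec l) u v := by
  rfl

/-- The Christoffel symbols
`Γ(u, v) = ∑_k ∑_l ½ g^{kl} (∂_u g(v, e_l) + ∂_v g(u, e_l) - ∂_{e_l} g(u, v)) e_k`
of the Levi-Civita connection in the chart around `c`. -/
def christoffel (g : Metric n M) (c : M) (y : Model n) :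
    Model n →L[ℝ] Model n →L[ℝ] Model n :=
  ∑ k, ∑ l, ((1 / 2 : ℝ) * (gram g c y)⁻¹ k l) •
    ((ContinuousLinearMap.compL ℝ (Model n) ℝ (Model n)
      (ContinuousLinearMap.toSpanSingleton ℝ (stdVec k))) ∘L christoffelLower g c y l)

theorem christoffel_apply (g : Metric n M) (c : M) (y u v : Model n) :
    christoffel g c y u v =
      ∑ k, ∑ l, ((1 / 2 : ℝ) * (gram g c y)⁻¹ k l * christoffelLower g c y l u v) • stdVec k := by
  simp only [christoffel, sum_apply, smul_apply, ContinuousLinearMap.comp_apply,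
    ContinuousLinearMap.compL_apply, ContinuousLinearMap.toSpanSingleton_apply, smul_smul]

/-- The covariant derivative of `T` in the chart around `c`: with the new vector in the first
slot, `(∇T)(u, v; α)` is
`(∂_u T)(v; α) + ∑_i T(v; …, α_i ∘ Γ(u, ·), …) - ∑_j T(…, Γ(u, v_j), …; α)`. -/
def localNabla {a b : ℕ} (g : Metric n M) (T : TensorField n M a b) (c : M) (y : Model n) :
    TensorSpace (Model n) a (b + 1) :=
  (fderiv ℝ (localTensor T c) y
    + connectionTerm (christoffel g c y) (localTensor T c y)).uncurryLeft

theorem localNabla_apply {a b : ℕ} (g : Metric n M) (T : TensorField n M a b) (c : M)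
    (y u : Model n) (v : Fin b → Model n) (α : Fin a → (Model n →L[ℝ] ℝ)) :
    localNabla g T c y (Fin.cons u v) α =
      fderiv ℝ (localTensor T c) y u v α
        + ((∑ i, localTensor T c y v (Function.update α i ((α i).comp (christoffel g c y u))))
          - ∑ j, localTensor T c y (Function.update v j (christoffel g c y u (v j))) α) := by
  rw [← connectionTerm_apply]
  rfl

/-- The covariant derivative `∇T`, computed at `x` in the chart around `x`. -/
def nabla {a b : ℕ} (g : Metric n M) (T : TensorField n M a b) : TensorField n M a (b + 1) :=
  fun x => transport (chartD x x) (chartDInv x x) (localNabla g T x (extChartAt (𝓡 n) x x))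

/-- The iterated covariant derivative `∇^j T`. -/
def iterNabla {a b : ℕ} (g : Metric n M) (T : TensorField n M a b) :
    (j : ℕ) → TensorField n M a (b + j)
  | 0 => T
  | j + 1 => nabla g (iterNabla g T j)

/-- The pointwise norm `|T|_g`, with
`|T|_g² = ∑ g^{j₁j₁'} ⋯ g^{j_b j_b'} g_{i₁i₁'} ⋯ g_{i_a i_a'}
  T^{i₁…i_a}_{j₁…j_b} T^{i₁'…i_a'}_{j₁'…j_b'}`, computed at `x` in the chart around `x`. -/
def tensorNorm {a b : ℕ} (g : Metric n M) (T : TensorField n M a b) (x : M) : ℝ :=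
  let y := extChartAt (𝓡 n) x x
  let S := localTensor T x y
  √(∑ J : Fin b → Fin n, ∑ J' : Fin b → Fin n, ∑ I : Fin a → Fin n, ∑ I' : Fin a → Fin n,
    (∏ s, (gram g x y)⁻¹ (J s) (J' s)) * (∏ s, gram g x y (I s) (I' s)) *
      S (fun s => stdVec (J s)) (fun s => stdCovec (I s)) *
      S (fun s => stdVec (J' s)) (fun s => stdCovec (I' s)))

variable [MeasurableSpace M]

/-- The measure `√(det g_{ij}) dx` on the domain of the chart around `c`, extended by zero. -/
def chartVolume (g : Metric n M) (c : M) : Measure M :=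
  (((volume : Measure (Model n)).restrict (extChartAt (𝓡 n) c).target).withDensity
    (fun y => ENNReal.ofReal √(gram g c y).det)).map (extChartAt (𝓡 n) c).symm

/-- The Riemannian volume measure: the least measure which is at least `√(det g_{ij}) dx` in every
chart. As these measures agree where charts overlap, on a second countable manifold it restricts to
`√(det g_{ij}) dx` on the domain of each chart. -/
def riemVolume (g : Metric n M) : Measure M := ⨆ c : M, chartVolume g c

/-- The norm `‖T‖_p` of a tensor field in `L^p(M, μ_g)`, `p ∈ [1, ∞]`. -/
def lpNorm {a b : ℕ} (g : Metric n M) (p : ℝ≥0∞) (T : TensorField n M a b) : ℝ≥0∞ :=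
  eLpNorm (tensorNorm g T) p (riemVolume g)

end Manifold

end RiemTensor

end

/-! Everything rests on the three-term inequality `‖∇T‖_r² ≤ C ‖T‖_p ‖∇²T‖_q` with `1/p + 1/q = 2/r`
(`exists_lpNorm_nabla_sq_le`). As `1/r_j` is affine in `j`, applying it to each `∇^i T` makes `j ↦
‖∇^j T‖_{r_j}` logarithmically convex up to a constant, and discrete convexity
(`le_rpow_mul_rpow_of_sq_le`) gives the theorem. The constant must ignore the type of the tensor,
because `∇^i T` has type `(a, b + i)`.

The natural proof of the three-term inequality integrates the divergence of `|∇T|^(r-2) d|T|²` to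
zero. For `r < 2` that weight is singular where `∇T` vanishes, so it is replaced by `A^(r/2-1)` with
`A = κ (δ + |T|²)^s + |∇T|²`, which is positive and smooth. The divergence of `A^(r/2-1) d|T|²`
contains `2 A^(r/2-1) |∇T|²`, that is, `2 A^(r/2)` up to a term carrying `κ`. The remaining terms
are controlled by Cauchy–Schwarz and absorbed into `A^(r/2)` by Young's inequality
(`rpow_le_divergence`). After integration, `∫ |∇T|^r` is bounded by a term with `|T|` and a term
with `∇²T`. For `p < ∞` one takes `s = p/r` and the `κ` that balances the two
(`integral_nabla_rpow_le_mul`); for `p = ∞` one takes `s = 0` and lets `κ → 0`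
(`integral_nabla_rpow_le_of_ae_le`).

No covariant derivatives are commuted, so curvature never enters; the geometry contributes only the
dimension, through `|ΔT| ≤ n |∇²T|`.

Since all objects are defined in charts, the calculus has to be justified there: `∇` does not depend
on the chart (`localD_coordChange`), the metric is parallel (`hasDerivAt_ipT`), the divergence has
its coordinate formula (`sum_fderiv_eq_localDiv`), the chart measures agree on overlaps
(`chartVolume_eq`), and a partition of unity yields the divergence theorem
(`integral_divg_eq_zero`). -/

noncomputable section

namespace RiemTensor

/-! ### Orthonormal frames and the inner product of tensors on `ℝⁿ`. -/

section LinearAlgebra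

variable {n a b : ℕ}

/-- Finite dimension makes linear and bilinear maps on tensor spaces continuous for free;
`transportL`, `cov` and `contDiffOn_of_bilinear` depend on this. -/
instance finiteDimensional_tensorSpace (V : Type*) [NormedAddCommGroup V] [NormedSpace ℝ V]
    [FiniteDimensional ℝ V] (a b : ℕ) : FiniteDimensional ℝ (TensorSpace V a b) := by
  have h1 : FiniteDimensional ℝ ((V →L[ℝ] ℝ) [×a]→L[ℝ] ℝ) :=
    Module.Finite.of_injective
      (ContinuousMultilinearMap.toMultilinearMapLinear (R' := ℝ) (A := ℝ))
      ContinuousMultilinearMap.toMultilinearMap_injective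
  exact Module.Finite.of_injective
      (ContinuousMultilinearMap.toMultilinearMapLinear (R' := ℝ) (A := ℝ))
      ContinuousMultilinearMap.toMultilinearMap_injective

@[simp] theorem stdVec_apply (i j : Fin n) : stdVec i j = if j = i then (1 : ℝ) else 0 := by
  simp [stdVec]

@[simp] theorem stdCovec_apply (i : Fin n) (v : Model n) : stdCovec i v = v i := rfl

theorem sum_stdVec (v : Model n) : ∑ i, v i • stdVec i = v := by
  ext j
  simp

theorem sum_stdCovec (α : Model n →L[ℝ] ℝ) : ∑ i, α (stdVec i) • stdCovec i = α := by
  ext v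
  conv_rhs => rw [← sum_stdVec v]
  simp [mul_comm]

/-- The matrix of a bilinear form on `ℝⁿ`. -/
def bgram (B : Model n →L[ℝ] Model n →L[ℝ] ℝ) : Matrix (Fin n) (Fin n) ℝ :=
  Matrix.of fun i j => B (stdVec i) (stdVec j)

/-- The inner product of tensors on `ℝⁿ` induced by a bilinear form. -/
def ipT (B : Model n →L[ℝ] Model n →L[ℝ] ℝ) (S S' : TensorSpace (Model n) a b) : ℝ :=
  ∑ J : Fin b → Fin n, ∑ J' : Fin b → Fin n, ∑ I : Fin a → Fin n, ∑ I' : Fin a → Fin n,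
    (∏ s, (bgram B)⁻¹ (J s) (J' s)) * (∏ s, bgram B (I s) (I' s)) *
      S (fun s => stdVec (J s)) (fun s => stdCovec (I s)) *
      S' (fun s => stdVec (J' s)) (fun s => stdCovec (I' s))

/-- The trace of a bilinear form with respect to another one. -/
def trB (B : Model n →L[ℝ] Model n →L[ℝ] ℝ) (β : Fin n → Fin n → ℝ) : ℝ :=
  ∑ i, ∑ j, (bgram B)⁻¹ i j * β i j

/-- `L` maps an orthonormal basis of `ℝⁿ` to an orthonormal basis for `B`, with inverse `L'`. -/
structure IsFrame (B : Model n →L[ℝ] Model n →L[ℝ] ℝ) (L L' : Model n →L[ℝ] Model n) : Prop where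
  left_inv : ∀ v, L' (L v) = v
  right_inv : ∀ v, L (L' v) = v
  orth : ∀ u v, B (L u) (L v) = inner ℝ u v

/-- The frame is the inverse square root of the Gram matrix: if `Q` is symmetric with `Q * Q = bgram
B`, then `B u v` is the Euclidean product of `Q u` and `Q v`, so `L = Q⁻¹` and `L' = Q`. -/
theorem exists_isFrame {B : Model n →L[ℝ] Model n →L[ℝ] ℝ} (hs : ∀ u v, B u v = B v u)
    (hp : ∀ v, v ≠ 0 → 0 < B v v) :
    ∃ L L', IsFrame B L L' := by
  have hB : ∀ u v : Model n, B u v = ∑ i, ∑ j, u i * v j * bgram B i j := by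
    intro u v
    conv_lhs => rw [← sum_stdVec u, ← sum_stdVec v]
    simp only [map_sum, map_smul, _root_.sum_apply, _root_.smul_apply, smul_eq_mul,
      bgram, Matrix.of_apply]
    simp only [Finset.mul_sum]
    rw [Finset.sum_comm]
    refine Finset.sum_congr rfl fun i _ => Finset.sum_congr rfl fun j _ => by ring
  have hG : (bgram B).PosDef := by
    refine Matrix.posDef_iff_dotProduct_mulVec.mpr ⟨?_, fun x hx => ?_⟩
    · ext i j
      simp [bgram, hs (stdVec j)]
    · have h1 := hp (WithLp.toLp 2 x) (by simpa using hx)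
      rw [hB] at h1
      have h2 : dotProduct (star x) ((bgram B).mulVec x) = ∑ i, ∑ j, x i * x j * bgram B i j := by
        simp only [dotProduct, Matrix.mulVec, Finset.mul_sum, star_trivial]
        refine Finset.sum_congr rfl fun i _ => Finset.sum_congr rfl fun j _ => ?_
        ring
      rw [h2]
      exact h1
  obtain ⟨Q, hQ1, hQ2⟩ : ∃ Q : Matrix (Fin n) (Fin n) ℝ, Q.IsHermitian ∧ Q * Q = bgram B := by
    open scoped MatrixOrder in
    have h0 : 0 ≤ bgram B := hG.posSemidef.nonneg
    refine ⟨CFC.sqrt (bgram B), ?_, CFC.sqrt_mul_sqrt_self _ h0⟩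
    exact (Matrix.nonneg_iff_posSemidef.1 (CFC.sqrt_nonneg (bgram B))).1
  have hdet : IsUnit Q.det := by
    have := hG.det_pos
    rw [← hQ2, Matrix.det_mul] at this
    exact isUnit_iff_ne_zero.2 fun h => by simp [h] at this
  have hE : ∀ (X : Matrix (Fin n) (Fin n) ℝ) (v : Model n) (i : Fin n),
      Matrix.toEuclideanCLM (𝕜 := ℝ) X v i = ∑ j, X i j * v j := fun X v i => by
    simp [Matrix.ofLp_toEuclideanCLM, Matrix.mulVec, dotProduct]
  have key : ∀ u v : Model n, B u v = inner ℝ (Matrix.toEuclideanCLM (𝕜 := ℝ) Q u)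
      (Matrix.toEuclideanCLM (𝕜 := ℝ) Q v) := by
    intro u v
    rw [hB, ← hQ2]
    simp only [PiLp.inner_apply, hE, Matrix.mul_apply]
    simp only [RCLike.inner_apply, conj_trivial, Finset.mul_sum, Finset.sum_mul]
    rw [Finset.sum_congr rfl fun _ _ => Finset.sum_comm, Finset.sum_comm]
    refine Finset.sum_congr rfl fun k _ => ?_
    refine Finset.sum_congr rfl fun i _ => Finset.sum_congr rfl fun j _ => ?_
    have h' : Q i k = Q k i := by simpa using hQ1.apply k i
    rw [h']
    ring
  have e1 : ∀ v : Model n, Matrix.toEuclideanCLM (𝕜 := ℝ) Q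
      (Matrix.toEuclideanCLM (𝕜 := ℝ) Q⁻¹ v) = v := fun v => by
    rw [← mul_apply_eq_comp, ← map_mul, Matrix.mul_nonsing_inv _ hdet]
    simp
  have e2 : ∀ v : Model n, Matrix.toEuclideanCLM (𝕜 := ℝ) Q⁻¹
      (Matrix.toEuclideanCLM (𝕜 := ℝ) Q v) = v := fun v => by
    rw [← mul_apply_eq_comp, ← map_mul, Matrix.nonsing_inv_mul _ hdet]
    simp
  exact ⟨Matrix.toEuclideanCLM (𝕜 := ℝ) Q⁻¹, Matrix.toEuclideanCLM (𝕜 := ℝ) Q, e1, e2,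
    fun u v => by rw [key, e1, e1]⟩

namespace IsFrame

variable {B : Model n →L[ℝ] Model n →L[ℝ] ℝ} {L L' : Model n →L[ℝ] Model n}

theorem bgram_eq (h : IsFrame B L L') (i j : Fin n) :
    bgram B i j = ∑ k, L' (stdVec i) k * L' (stdVec j) k := by
  have := h.orth (L' (stdVec i)) (L' (stdVec j))
  rw [h.right_inv, h.right_inv] at this
  simp only [bgram, Matrix.of_apply, this, PiLp.inner_apply]
  exact Finset.sum_congr rfl fun k _ => by simp [mul_comm]

theorem sum_mul_right (h : IsFrame B L L') (i j : Fin n) :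
    ∑ k, L (stdVec k) i * L' (stdVec j) k = if i = j then 1 else 0 := by
  have := congrArg (fun v : Model n => v i) (h.right_inv (stdVec j))
  simp only [stdVec_apply] at this
  rw [← this]
  conv_rhs => rw [← sum_stdVec (L' (stdVec j))]
  simp [mul_comm]

theorem sum_mul_left (h : IsFrame B L L') (i j : Fin n) :
    ∑ k, L' (stdVec k) i * L (stdVec j) k = if i = j then 1 else 0 := by
  have := congrArg (fun v : Model n => v i) (h.left_inv (stdVec j))
  simp only [stdVec_apply] at this
  rw [← this]
  conv_rhs => rw [← sum_stdVec (L (stdVec j))]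
  simp [mul_comm]

theorem bgram_inv (h : IsFrame B L L') :
    (bgram B)⁻¹ = Matrix.of fun i j => ∑ k, L (stdVec k) i * L (stdVec k) j := by
  refine Matrix.inv_eq_right_inv ?_
  let P : Matrix (Fin n) (Fin n) ℝ := Matrix.of fun i j => L (stdVec j) i
  let Q : Matrix (Fin n) (Fin n) ℝ := Matrix.of fun i j => L' (stdVec j) i
  have hPQ : P * Q = 1 := by
    ext i j
    simp [P, Q, Matrix.mul_apply, h.sum_mul_right, Matrix.one_apply]
  have hQP : Q * P = 1 := by
    ext i j
    simp [P, Q, Matrix.mul_apply, h.sum_mul_left, Matrix.one_apply]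
  have h1 : bgram B = Q.transpose * Q := by
    ext i j
    simp [Q, Matrix.mul_apply, h.bgram_eq]
  have h2 : (Matrix.of fun i j => ∑ k, L (stdVec k) i * L (stdVec k) j) = P * P.transpose := by
    ext i j
    simp [P, Matrix.mul_apply]
  rw [h1, h2]
  calc Q.transpose * Q * (P * P.transpose) = Q.transpose * (Q * P) * P.transpose := by
        simp only [Matrix.mul_assoc]
    _ = 1 := by rw [hQP, Matrix.mul_one, ← Matrix.transpose_mul, hPQ, Matrix.transpose_one]

theorem trB_eq (h : IsFrame B L L') (β : Model n →L[ℝ] Model n →L[ℝ] ℝ) :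
    trB B (fun i j => β (stdVec i) (stdVec j)) = ∑ k, β (L (stdVec k)) (L (stdVec k)) := by
  have : ∀ k, β (L (stdVec k)) (L (stdVec k)) =
      ∑ i, ∑ j, L (stdVec k) i * L (stdVec k) j * β (stdVec i) (stdVec j) := by
    intro k
    conv_lhs => rw [← sum_stdVec (L (stdVec k))]
    simp only [map_sum, map_smul, _root_.sum_apply, _root_.smul_apply, smul_eq_mul,
      Finset.mul_sum]
    rw [Finset.sum_comm]
    refine Finset.sum_congr rfl fun i _ => Finset.sum_congr rfl fun j _ => by ring
  simp only [this, trB, h.bgram_inv, Matrix.of_apply, Finset.sum_mul]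
  rw [Finset.sum_congr rfl fun _ _ => Finset.sum_comm, Finset.sum_comm]

theorem transport_eq_sum (L L' : Model n →L[ℝ] Model n) (S : TensorSpace (Model n) a b)
    (J : Fin b → Fin n) (I : Fin a → Fin n) :
    transport L L' S (fun s => stdVec (J s)) (fun s => stdCovec (I s)) =
      ∑ K : Fin b → Fin n, ∑ H : Fin a → Fin n,
        (∏ s, L (stdVec (J s)) (K s)) * (∏ s, L' (stdVec (H s)) (I s)) *
          S (fun s => stdVec (K s)) (fun s => stdCovec (H s)) := by
  rw [transport_apply]
  have h1 : (fun j => L (stdVec (J j))) = fun j => ∑ k, L (stdVec (J j)) k • stdVec k := by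
    funext j
    rw [sum_stdVec]
  have h2 : (fun i => (stdCovec (I i)).comp L') =
      fun i => ∑ k, L' (stdVec k) (I i) • stdCovec k := by
    funext i
    conv_lhs => rw [← sum_stdCovec ((stdCovec (I i)).comp L')]
    rfl
  rw [h1, h2, ContinuousMultilinearMap.map_sum, Finset.sum_comm]
  refine Finset.sum_congr rfl fun H _ => ?_
  rw [ContinuousMultilinearMap.map_sum, _root_.sum_apply]
  refine Finset.sum_congr rfl fun K _ => ?_
  rw [ContinuousMultilinearMap.map_smul_univ, ContinuousMultilinearMap.map_smul_univ]
  simp only [_root_.smul_apply, smul_eq_mul]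
  ring

/-- Pure Fubini for six finite sums: once everything is a sum over a product type, the two sides
differ by a permutation of the factors. -/
theorem sum_mul_sum_reorder {α β γ δ : Type*} [Fintype α] [Fintype β] [Fintype γ] [Fintype δ]
    (A : α → β → ℝ) (C : γ → δ → ℝ) (s s' : β → γ → ℝ) :
    (∑ K, ∑ K', ∑ H, ∑ H', (∑ J, A J K * A J K') * (∑ I, C H I * C H' I) * s K H * s' K' H') =
      ∑ J, ∑ I, (∑ K, ∑ H, A J K * C H I * s K H) * (∑ K, ∑ H, A J K * C H I * s' K H) := by
  simp only [Finset.sum_mul, Finset.mul_sum]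
  simp only [← Fintype.sum_prod_type']
  refine Fintype.sum_equiv
    { toFun := fun x => (x.2.2.2.2.2, x.2.2.2.2.1, x.2.1, x.2.2.2.1, x.1, x.2.2.1)
      invFun := fun y => (y.2.2.2.2.1, y.2.2.1, y.2.2.2.2.2, y.2.2.2.1, y.2.1, y.1)
      left_inv := fun _ => rfl
      right_inv := fun _ => rfl } _ _ fun x => ?_
  simp only [Equiv.coe_fn_mk]
  ring

/-- In a frame, `g⁻¹ = L Lᵀ` and `g = L'ᵀ L'`; expanding the products over slots turns the
contraction into the Euclidean product of frame components. Positivity, symmetry and Cauchy–Schwarz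
are immediate from this form. -/
theorem ipT_eq (h : IsFrame B L L') (S S' : TensorSpace (Model n) a b) :
    ipT B S S' = ∑ J : Fin b → Fin n, ∑ I : Fin a → Fin n,
      transport L L' S (fun s => stdVec (J s)) (fun s => stdCovec (I s)) *
      transport L L' S' (fun s => stdVec (J s)) (fun s => stdCovec (I s)) := by
  have e1 : ∀ K K' : Fin b → Fin n, ∏ s, (bgram B)⁻¹ (K s) (K' s) =
      ∑ J : Fin b → Fin n, (∏ s, L (stdVec (J s)) (K s)) * ∏ s, L (stdVec (J s)) (K' s) := by
    intro K K'
    simp only [h.bgram_inv, Matrix.of_apply, Finset.prod_univ_sum, Fintype.piFinset_univ,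
      Finset.prod_mul_distrib]
  have e2 : ∀ K K' : Fin a → Fin n, ∏ s, (bgram B) (K s) (K' s) =
      ∑ I : Fin a → Fin n, (∏ s, L' (stdVec (K s)) (I s)) * ∏ s, L' (stdVec (K' s)) (I s) := by
    intro K K'
    simp only [h.bgram_eq, Finset.prod_univ_sum, Fintype.piFinset_univ,
      Finset.prod_mul_distrib]
  simp only [transport_eq_sum, ipT, e1, e2]
  exact sum_mul_sum_reorder _ _ _ _

theorem ipT_self_nonneg (h : IsFrame B L L') (S : TensorSpace (Model n) a b) :
    0 ≤ ipT B S S := by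
  rw [h.ipT_eq]
  exact Finset.sum_nonneg fun J _ => Finset.sum_nonneg fun I _ => mul_self_nonneg _

theorem ipT_comm (h : IsFrame B L L') (S S' : TensorSpace (Model n) a b) :
    ipT B S S' = ipT B S' S := by
  rw [h.ipT_eq, h.ipT_eq]
  simp only [mul_comm]

theorem ipT_sq_le (h : IsFrame B L L') (S S' : TensorSpace (Model n) a b) :
    ipT B S S' ^ 2 ≤ ipT B S S * ipT B S' S' := by
  simp only [h.ipT_eq, ← Fintype.sum_prod_type', ← pow_two]
  exact Finset.sum_mul_sq_le_sq_mul_sq _ _ _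

theorem abs_ipT_le (h : IsFrame B L L') (S S' : TensorSpace (Model n) a b) :
    |ipT B S S'| ≤ √(ipT B S S) * √(ipT B S' S') := by
  rw [← Real.sqrt_mul (h.ipT_self_nonneg S), ← Real.sqrt_sq_eq_abs]
  exact Real.sqrt_le_sqrt (h.ipT_sq_le S S')

/-- This will read `|∇T|² = ∑_k |∇_{e_k} T|²` for an orthonormal frame `e_k`: the index of the new
first slot is split off by `Fin.consEquiv`. -/
theorem ipT_uncurryLeft (h : IsFrame B L L')
    (X Y : Model n →L[ℝ] TensorSpace (Model n) a b) :
    ipT B (X.uncurryLeft : TensorSpace (Model n) a (b + 1)) Y.uncurryLeft =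
      ∑ k, ipT B (X (L (stdVec k))) (Y (L (stdVec k))) := by
  simp only [h.ipT_eq]
  rw [← Fintype.sum_equiv (Fin.consEquiv fun _ : Fin (b + 1) => Fin n) (fun x => _) _
    (fun x => rfl), Fintype.sum_prod_type]
  rfl

theorem comp (h : IsFrame B L L') {B' : Model n →L[ℝ] Model n →L[ℝ] ℝ}
    {N N' : Model n →L[ℝ] Model n} (hN : ∀ v, N' (N v) = v) (hN' : ∀ v, N (N' v) = v)
    (hB : ∀ u v, B' u v = B (N u) (N v)) : IsFrame B' (N' ∘L L) (L' ∘L N) where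
  left_inv v := by simp [hN', h.left_inv]
  right_inv v := by simp [hN, h.right_inv]
  orth u v := by simp [hB, hN', h.orth]

theorem transport_comp (L L' N N' : Model n →L[ℝ] Model n) (S : TensorSpace (Model n) a b) :
    transport L L' (transport N N' S) = transport (N ∘L L) (L' ∘L N') S := by
  rfl

/-- The inner product of tensors is invariant under linear isomorphisms. -/
theorem ipT_transport (h : IsFrame B L L') {B' : Model n →L[ℝ] Model n →L[ℝ] ℝ}
    {N N' : Model n →L[ℝ] Model n} (hN : ∀ v, N' (N v) = v) (hN' : ∀ v, N (N' v) = v)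
    (hB : ∀ u v, B' u v = B (N u) (N v)) (S S' : TensorSpace (Model n) a b) :
    ipT B' (transport N N' S) (transport N N' S') = ipT B S S' := by
  rw [h.ipT_eq, (h.comp hN hN' hB).ipT_eq]
  have : ∀ R : TensorSpace (Model n) a b,
      transport (N' ∘L L) (L' ∘L N) (transport N N' R) = transport L L' R := by
    intro R
    rw [transport_comp]
    congr 1 <;> ext1 v <;> simp [hN']
  simp only [this]

end IsFrame

end LinearAlgebra

/-! ### Derivatives of metrics, tensors and determinants along curves. -/

section Curves

variable {n a b : ℕ}

theorem contDiff_det : ContDiff ℝ ∞ fun M : Fin n → Fin n → ℝ => (Matrix.of M).det := by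
  simp only [Matrix.det_apply, Matrix.of_apply]
  refine ContDiff.sum fun σ _ => ContDiff.const_smul _ (contDiff_prod fun i _ => ?_)
  fun_prop

theorem contDiffAt_matrix_inv {M : Fin n → Fin n → ℝ} (hM : (Matrix.of M).det ≠ 0)
    (i j : Fin n) :
    ContDiffAt ℝ ∞ (fun M : Fin n → Fin n → ℝ => (Matrix.of M)⁻¹ i j) M := by
  have h1 : ContDiff ℝ ∞ fun M : Fin n → Fin n → ℝ => (Matrix.of M).adjugate i j := by
    have h2 : ∀ M : Fin n → Fin n → ℝ, (Matrix.of M).adjugate i j =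
        (Matrix.of fun k l => if k = j then Pi.single (M := fun _ => ℝ) i 1 l else M k l).det := by
      intro M
      rw [Matrix.adjugate_apply]
      congr 1
      ext k l
      by_cases h : k = j <;> simp [Matrix.updateRow_apply, h]
    simp only [h2]
    refine contDiff_det.comp (contDiff_pi.2 fun k => contDiff_pi.2 fun l => ?_)
    by_cases h : k = j
    · simp only [h, if_true]
      exact contDiff_const
    · simp only [h, if_false]
      fun_prop
  simp only [Matrix.inv_def, Matrix.smul_apply, smul_eq_mul, Ring.inverse_eq_inv']
  exact (contDiff_det.contDiffAt.inv hM).mul h1.contDiffAt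

/-- The derivative of `det` at the identity is the trace. By the chain rule only the velocity `M'`
matters, so the curve may be replaced by a straight line, on which `det (1 + t M')` is `1 + t tr M'`
plus `t²` times a polynomial. -/
theorem hasDerivAt_det_of_eq_one {M : ℝ → Fin n → Fin n → ℝ} {M' : Fin n → Fin n → ℝ}
    (h0 : Matrix.of (M 0) = 1) (hM : HasDerivAt M M' 0) :
    HasDerivAt (fun t => (Matrix.of (M t)).det) (∑ i, M' i i) 0 := by
  have hd : HasFDerivAt (fun M : Fin n → Fin n → ℝ => (Matrix.of M).det)
      (fderiv ℝ (fun M : Fin n → Fin n → ℝ => (Matrix.of M).det) (M 0)) (M 0) :=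
    (contDiff_det.differentiable (by simp) _).hasFDerivAt
  have e1 : HasDerivAt (fun t => (Matrix.of (M t)).det) _ 0 := hd.comp_hasDerivAt 0 hM
  have e2 : HasDerivAt (fun t : ℝ => (Matrix.of (M 0 + t • M')).det)
      (fderiv ℝ (fun M : Fin n → Fin n → ℝ => (Matrix.of M).det) (M 0) M') 0 := by
    have h3 : HasDerivAt (fun t : ℝ => M 0 + t • M') M' 0 := by
      simpa using ((hasDerivAt_id (0 : ℝ)).smul_const M').const_add (M 0)
    have h4 : HasFDerivAt (fun M : Fin n → Fin n → ℝ => (Matrix.of M).det)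
      (fderiv ℝ (fun M : Fin n → Fin n → ℝ => (Matrix.of M).det) (M 0))
      (M 0 + (0 : ℝ) • M') := by simpa using hd
    exact h4.comp_hasDerivAt 0 h3
  have e3 : HasDerivAt (fun t : ℝ => (Matrix.of (M 0 + t • M')).det) (∑ i, M' i i) 0 := by
    have h5 : ∀ t : ℝ, (Matrix.of (M 0 + t • M')).det = 1 + (∑ i, M' i i) * t +
        (Matrix.det (1 + (Polynomial.X : Polynomial ℝ) • (Matrix.of M').map
          Polynomial.C)).divX.divX.eval t * t ^ 2 := by
      intro t
      have : Matrix.of (M 0 + t • M') = 1 + t • Matrix.of M' := by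
        rw [← h0]
        rfl
      rw [this, Matrix.det_one_add_smul]
      rfl
    simp only [h5]
    set P := (Matrix.det (1 + (Polynomial.X : Polynomial ℝ) • (Matrix.of M').map
          Polynomial.C)).divX.divX
    have h6 := (((hasDerivAt_id (0 : ℝ)).const_mul (∑ i, M' i i)).const_add 1).add
      ((P.hasDerivAt 0).mul ((hasDerivAt_id (0 : ℝ)).pow 2))
    exact h6.congr_deriv (by simp)
  rw [← e2.unique e3]
  exact e1

/-- The value of the derivation of the tensor algebra given by an endomorphism. -/
def endoVal (E : Model n →L[ℝ] Model n) (S : TensorSpace (Model n) a b)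
    (v : Fin b → Model n) (α : Fin a → (Model n →L[ℝ] ℝ)) : ℝ :=
  (∑ i, S v (Function.update α i ((α i).comp E))) - ∑ j, S (Function.update v j (E (v j))) α

theorem endoVal_neg (E : Model n →L[ℝ] Model n) (S : TensorSpace (Model n) a b)
    (v : Fin b → Model n) (α : Fin a → (Model n →L[ℝ] ℝ)) :
    endoVal (-E) S v α = - endoVal E S v α := by
  have h1 : ∀ i, S v (Function.update α i ((α i).comp (-E))) =
      - S v (Function.update α i ((α i).comp E)) := fun i => by
    rw [ContinuousLinearMap.comp_neg]
    exact ((S v).toContinuousLinearMap α i).map_neg _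
  have h2 : ∀ j, S (Function.update v j ((-E) (v j))) α =
      - S (Function.update v j (E (v j))) α := fun j => by
    have := (S.toContinuousLinearMap v j).map_neg (E (v j))
    exact congrArg (fun T => T α) this
  simp only [endoVal, h1, h2, Finset.sum_neg_distrib]
  ring

/-- Product rule at a time when both maps are the identity: vector slots move with velocity `E` and
covector slots with `-E`, which together give minus the derivation `endoVal E`. -/
theorem hasDerivAt_transport {L L' : ℝ → Model n →L[ℝ] Model n} {E : Model n →L[ℝ] Model n}
    {S : ℝ → TensorSpace (Model n) a b} {S' : TensorSpace (Model n) a b}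
    (h0 : L 0 = ContinuousLinearMap.id ℝ _) (h0' : L' 0 = ContinuousLinearMap.id ℝ _)
    (hL : HasDerivAt L E 0) (hL' : HasDerivAt L' (-E) 0) (hS : HasDerivAt S S' 0)
    (v : Fin b → Model n) (α : Fin a → (Model n →L[ℝ] ℝ)) :
    HasDerivAt (fun t => transport (L t) (L' t) (S t) v α)
      (S' v α - endoVal E (S 0) v α) 0 := by
  have hv : ∀ j, HasDerivAt (fun t => L t (v j)) (E (v j)) 0 := fun j => by
    simpa using hL.clm_apply (hasDerivAt_const (0 : ℝ) (v j))
  have hα : ∀ i, HasDerivAt (fun t => (α i).comp (L' t)) (-((α i).comp E)) 0 := fun i => by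
    simpa using (hasDerivAt_const (0 : ℝ) (α i)).clm_comp hL'
  have h1 := hS.hasFDerivAt.continuousMultilinearMap_apply (fun j => (hv j).hasFDerivAt)
  have h2 := h1.continuousMultilinearMap_apply (fun i => (hα i).hasFDerivAt)
  have h3 := h2.hasDerivAt
  simp only [transport_apply]
  refine h3.congr_deriv ?_
  simp [h0, h0', endoVal, ContinuousMultilinearMap.toContinuousLinearMap]
  ring

theorem hasDerivAt_bgram {G : ℝ → Model n →L[ℝ] Model n →L[ℝ] ℝ}
    {G' : Model n →L[ℝ] Model n →L[ℝ] ℝ} (hG : HasDerivAt G G' 0) :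
    HasDerivAt (fun t i j => bgram (G t) i j) (fun i j => bgram G' i j) 0 := by
  refine hasDerivAt_pi.2 fun i => hasDerivAt_pi.2 fun j => ?_
  have h1 := hG.clm_apply (hasDerivAt_const (0 : ℝ) (stdVec i))
  have h2 := h1.clm_apply (hasDerivAt_const (0 : ℝ) (stdVec j))
  exact h2.congr_deriv (by simp [bgram])

theorem IsFrame.det_ne_zero {B : Model n →L[ℝ] Model n →L[ℝ] ℝ} {L L' : Model n →L[ℝ] Model n}
    (h : IsFrame B L L') : (bgram B).det ≠ 0 := by
  let P : Matrix (Fin n) (Fin n) ℝ := Matrix.of fun i j => L (stdVec j) i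
  let Q : Matrix (Fin n) (Fin n) ℝ := Matrix.of fun i j => L' (stdVec j) i
  have hPQ : P * Q = 1 := by
    ext i j
    simp [P, Q, Matrix.mul_apply, h.sum_mul_right, Matrix.one_apply]
  have h1 : bgram B = Q.transpose * Q := by
    ext i j
    simp [Q, Matrix.mul_apply, h.bgram_eq]
  have h2 : Q.det ≠ 0 := fun h0 => by
    have := congrArg Matrix.det hPQ
    simp [h0] at this
  rw [h1, Matrix.det_mul, Matrix.det_transpose]
  exact mul_ne_zero h2 h2

theorem IsFrame.det_pos {B : Model n →L[ℝ] Model n →L[ℝ] ℝ} {L L' : Model n →L[ℝ] Model n}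
    (h : IsFrame B L L') : 0 < (bgram B).det := by
  refine lt_of_le_of_ne ?_ h.det_ne_zero.symm
  have h1 : bgram B = (Matrix.of fun i j => L' (stdVec j) i).transpose *
      (Matrix.of fun i j => L' (stdVec j) i) := by
    ext i j
    simp [Matrix.mul_apply, h.bgram_eq]
  rw [h1, Matrix.det_mul, Matrix.det_transpose]
  exact mul_self_nonneg _

/-- A one-parameter group of linear maps. -/
theorem exists_flow (E : Model n →L[ℝ] Model n) :
    ∃ K K' : ℝ → Model n →L[ℝ] Model n, K 0 = ContinuousLinearMap.id ℝ _ ∧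
      K' 0 = ContinuousLinearMap.id ℝ _ ∧ HasDerivAt K E 0 ∧ HasDerivAt K' (-E) 0 ∧
      (∀ t v, K' t (K t v) = v) ∧ ∀ t v, K t (K' t v) = v := by
  let _ : NormedAlgebra ℚ (Model n →L[ℝ] Model n) := NormedAlgebra.restrictScalars ℚ ℝ _
  have hc : ∀ t : ℝ, Commute (t • E) (t • -E) := fun t => by
    simp [commute_iff_eq]
  refine ⟨fun t => NormedSpace.exp (t • E), fun t => NormedSpace.exp (t • -E), ?_, ?_, ?_, ?_,
    ?_, ?_⟩
  · simp; rfl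
  · simp; rfl
  · simpa using hasDerivAt_exp_smul_const (𝕂 := ℝ) E 0
  · simpa using hasDerivAt_exp_smul_const (𝕂 := ℝ) (-E) 0
  · intro t v
    rw [← mul_apply_eq_comp, ← NormedSpace.exp_add_of_commute (hc t).symm]
    simp
  · intro t v
    rw [← mul_apply_eq_comp, ← NormedSpace.exp_add_of_commute (hc t)]
    simp


theorem HasDerivAt.bgram_of_zero {G : ℝ → Model n →L[ℝ] Model n →L[ℝ] ℝ}
    (hG : HasDerivAt G 0 0) {L L' : Model n →L[ℝ] Model n} (h : IsFrame (G 0) L L') :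
    (∀ i j, HasDerivAt (fun t => (bgram (G t))⁻¹ i j) 0 0) ∧
      HasDerivAt (fun t => (bgram (G t)).det) 0 0 := by
  have h1 := hasDerivAt_bgram hG
  have h2 : (fun i j => bgram (0 : Model n →L[ℝ] Model n →L[ℝ] ℝ) i j : Fin n → Fin n → ℝ) = 0 := by
    ext i j
    simp [bgram]
  rw [h2] at h1
  constructor
  · intro i j
    have h3 := ((contDiffAt_matrix_inv (M := fun i j => bgram (G 0) i j) h.det_ne_zero i j).differentiableAt
      (by simp)).hasFDerivAt
    have := h3.comp_hasDerivAt (0 : ℝ) h1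
    rw [map_zero] at this
    exact this
  · have h3 := (contDiff_det.differentiable (by simp) fun i j => bgram (G 0) i j).hasFDerivAt
    have := h3.comp_hasDerivAt (0 : ℝ) h1
    rw [map_zero] at this
    exact this

/-- A bilinear form pulled back by an endomorphism. -/
def pullB (B : Model n →L[ℝ] Model n →L[ℝ] ℝ) (K : Model n →L[ℝ] Model n) :
    Model n →L[ℝ] Model n →L[ℝ] ℝ :=
  (ContinuousLinearMap.precomp ℝ K) ∘L B ∘L K

/-- Hypothesis `hE` is metric compatibility with `E` in the role of `Γ(u, ·)`. Moving vectors with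
velocity `-E` cancels the derivative of the metric, so the pulled back metric is constant to first
order. -/
theorem hasDerivAt_pullB {G : ℝ → Model n →L[ℝ] Model n →L[ℝ] ℝ}
    {G' : Model n →L[ℝ] Model n →L[ℝ] ℝ} (hG : HasDerivAt G G' 0)
    {K : ℝ → Model n →L[ℝ] Model n} {E : Model n →L[ℝ] Model n}
    (h0 : K 0 = ContinuousLinearMap.id ℝ _) (hK : HasDerivAt K (-E) 0)
    (hE : ∀ u v, G' u v = G 0 (E u) v + G 0 u (E v)) :
    HasDerivAt (fun t => pullB (G t) (K t)) 0 0 := by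
  have h1 : HasDerivAt (fun t => ContinuousLinearMap.precomp ℝ (K t) (F := Model n))
      (ContinuousLinearMap.precomp ℝ (-E)) 0 :=
    (((ContinuousLinearMap.compL ℝ (Model n) (Model n) ℝ).flip).hasFDerivAt).comp_hasDerivAt
      (0 : ℝ) hK
  have h2 := h1.clm_comp (hG.clm_comp hK)
  refine h2.congr_deriv ?_
  ext u v
  simp [h0, hE]

/-- The metric is parallel: derivative of an inner product of tensors along a curve. -/
theorem hasDerivAt_ipT {G : ℝ → Model n →L[ℝ] Model n →L[ℝ] ℝ}
    {G' : Model n →L[ℝ] Model n →L[ℝ] ℝ} {S R : ℝ → TensorSpace (Model n) a b}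
    {S' R' X Y : TensorSpace (Model n) a b} {E : Model n →L[ℝ] Model n}
    (hfr : ∀ᶠ t in nhds (0 : ℝ), ∃ L L', IsFrame (G t) L L') (hG : HasDerivAt G G' 0)
    (hE : ∀ u v, G' u v = G 0 (E u) v + G 0 u (E v))
    (hS : HasDerivAt S S' 0) (hR : HasDerivAt R R' 0)
    (hX : ∀ v α, X v α = S' v α + endoVal E (S 0) v α)
    (hY : ∀ v α, Y v α = R' v α + endoVal E (R 0) v α) :
    HasDerivAt (fun t => ipT (G t) (S t) (R t)) (ipT (G 0) X (R 0) + ipT (G 0) (S 0) Y) 0 := by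
  -- Here `K` has velocity `-E` and `K'` has velocity `E`. Inner products do not change under `K`,
  -- and the pulled back metric has zero derivative. Hence only the tensors contribute, and
  -- `hasDerivAt_transport` with `-E` supplies the `endoVal` terms of `X` and `Y`.
  obtain ⟨K', K, h0', h0, hK', hK, hKK', hK'K⟩ := exists_flow E
  obtain ⟨L, L', hL⟩ := hfr.self_of_nhds
  have hH := hasDerivAt_pullB hG h0 hK hE
  have hG0 : pullB (G 0) (K 0) = G 0 := by
    ext u v
    simp [pullB, h0]
  have hfun : (fun t => ipT (G t) (S t) (R t)) =ᶠ[nhds 0] fun t =>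
      ipT (pullB (G t) (K t)) (transport (K t) (K' t) (S t)) (transport (K t) (K' t) (R t)) := by
    filter_upwards [hfr] with t ⟨L, L', h⟩
    exact (h.ipT_transport (hK'K t) (hKK' t) (fun _ _ => rfl) _ _).symm
  refine HasDerivAt.congr_of_eventuallyEq ?_ hfun
  have hinv := (HasDerivAt.bgram_of_zero hH (hG0.symm ▸ hL)).1
  have hg : ∀ i j, HasDerivAt (fun t => bgram (pullB (G t) (K t)) i j) 0 0 := fun i j => by
    have := hasDerivAt_pi.1 (hasDerivAt_pi.1 (hasDerivAt_bgram hH) i) j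
    exact this.congr_deriv (by simp [bgram])
  have hE' : ∀ (T : TensorSpace (Model n) a b) v α, endoVal (-E) T v α = - endoVal E T v α :=
    endoVal_neg E
  have hSc := fun v α => hasDerivAt_transport h0 h0' hK (by simpa using hK') hS v α
  have hRc := fun v α => hasDerivAt_transport h0 h0' hK (by simpa using hK') hR v α
  have key := HasDerivAt.fun_sum (u := Finset.univ) fun (J : Fin b → Fin n) _ =>
    HasDerivAt.fun_sum (u := Finset.univ) fun (J' : Fin b → Fin n) _ =>
    HasDerivAt.fun_sum (u := Finset.univ) fun (I : Fin a → Fin n) _ =>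
    HasDerivAt.fun_sum (u := Finset.univ) fun (I' : Fin a → Fin n) _ =>
      (((HasDerivAt.fun_finsetProd (u := Finset.univ) fun s _ => hinv (J s) (J' s)).mul
        (HasDerivAt.fun_finsetProd (u := Finset.univ) fun s _ => hg (I s) (I' s))).mul
        (hSc (fun s => stdVec (J s)) (fun s => stdCovec (I s)))).mul
        (hRc (fun s => stdVec (J' s)) (fun s => stdCovec (I' s)))
  refine key.congr_deriv ?_
  simp only [Pi.mul_apply, ipT, hX, hY, hE', hG0, ← Finset.sum_add_distrib]
  refine Finset.sum_congr rfl fun J _ => Finset.sum_congr rfl fun J' _ =>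
    Finset.sum_congr rfl fun I _ => Finset.sum_congr rfl fun I' _ => ?_
  simp [h0, h0', transport_apply]

/-- Write `det G` as the determinant of the pulled back metric times `(det K')²`. The former is
stationary at `0`, and the latter has derivative `2 tr E`. -/
theorem hasDerivAt_det_bgram {G : ℝ → Model n →L[ℝ] Model n →L[ℝ] ℝ}
    {G' : Model n →L[ℝ] Model n →L[ℝ] ℝ} {E L L' : Model n →L[ℝ] Model n}
    (hfr : IsFrame (G 0) L L') (hG : HasDerivAt G G' 0)
    (hE : ∀ u v, G' u v = G 0 (E u) v + G 0 u (E v)) :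
    HasDerivAt (fun t => (bgram (G t)).det)
      (2 * (bgram (G 0)).det * ∑ i, E (stdVec i) i) 0 := by
  obtain ⟨K', K, h0', h0, hK', hK, hKK', hK'K⟩ := exists_flow E
  have hH := hasDerivAt_pullB hG h0 hK hE
  have hG0 : pullB (G 0) (K 0) = G 0 := by
    ext u v
    simp [pullB, h0]
  have hd := (HasDerivAt.bgram_of_zero hH (hG0.symm ▸ hfr)).2
  have hm : HasDerivAt (fun t i j => K' t (stdVec j) i) (fun i j => E (stdVec j) i) 0 := by
    refine hasDerivAt_pi.2 fun i => hasDerivAt_pi.2 fun j => ?_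
    have h1 := hK'.clm_apply (hasDerivAt_const (0 : ℝ) (stdVec j))
    have h2 := ((stdCovec i).hasFDerivAt).comp_hasDerivAt (0 : ℝ) h1
    exact h2.congr_deriv (by simp)
  have hm' := hasDerivAt_det_of_eq_one (by ext i j; simp [h0', Matrix.one_apply]) hm
  have hfun : (fun t => (bgram (G t)).det) = fun t => (bgram (pullB (G t) (K t))).det *
      (Matrix.of fun i j => K' t (stdVec j) i).det ^ 2 := by
    funext t
    have : bgram (G t) = (Matrix.of fun i j => K' t (stdVec j) i).transpose *
        bgram (pullB (G t) (K t)) * (Matrix.of fun i j => K' t (stdVec j) i) := by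
      ext i j
      have h1 : G t (stdVec i) (stdVec j) =
          pullB (G t) (K t) (K' t (stdVec i)) (K' t (stdVec j)) := by
        simp [pullB, hKK']
      simp only [bgram, Matrix.of_apply, h1, Matrix.mul_apply, Matrix.transpose_apply]
      conv_lhs => rw [← sum_stdVec (K' t (stdVec i)), ← sum_stdVec (K' t (stdVec j))]
      simp only [map_sum, map_smul, _root_.sum_apply, _root_.smul_apply, smul_eq_mul,
        Finset.sum_mul]
      refine Finset.sum_congr rfl fun k _ => ?_
      rw [Finset.mul_sum]
      refine Finset.sum_congr rfl fun l _ => ?_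
      ring
    conv_lhs => rw [this]
    rw [Matrix.det_mul, Matrix.det_mul, Matrix.det_transpose]
    ring
  rw [hfun]
  refine (hd.mul (hm'.pow 2)).congr_deriv ?_
  have h1 : (Matrix.of fun i j => K' 0 (stdVec j) i) = 1 := by
    ext i j
    simp [h0', Matrix.one_apply]
  simp [hG0, h1]
  ring

/-- Differentiate `G * G⁻¹ = 1` and insert `G' = Pᵀ G + G P`, where `P` is the matrix of `E`. -/
theorem hasDerivAt_bgram_inv {G : ℝ → Model n →L[ℝ] Model n →L[ℝ] ℝ}
    {G' : Model n →L[ℝ] Model n →L[ℝ] ℝ} {E : Model n →L[ℝ] Model n}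
    (hfr : ∀ᶠ t in nhds (0 : ℝ), ∃ L L', IsFrame (G t) L L') (hG : HasDerivAt G G' 0)
    (hE : ∀ u v, G' u v = G 0 (E u) v + G 0 u (E v)) (i j : Fin n) :
    HasDerivAt (fun t => (bgram (G t))⁻¹ i j)
      (- ∑ k, (E (stdVec k) i * (bgram (G 0))⁻¹ k j + (bgram (G 0))⁻¹ i k * E (stdVec k) j)) 0 := by
  obtain ⟨L, L', hL⟩ := hfr.self_of_nhds
  have hM := hasDerivAt_bgram hG
  have hN : ∀ i j, ∃ d, HasDerivAt (fun t => (bgram (G t))⁻¹ i j) d 0 := fun i j => by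
    have h3 := ((contDiffAt_matrix_inv (M := fun i j => bgram (G 0) i j) hL.det_ne_zero
      i j).differentiableAt (by simp)).hasFDerivAt
    have h4 := h3.comp_hasDerivAt (0 : ℝ) hM
    exact ⟨_, h4⟩
  choose D hD using hN
  refine (hD i j).congr_deriv ?_
  set M := bgram (G 0)
  let P : Matrix (Fin n) (Fin n) ℝ := Matrix.of fun i j => E (stdVec j) i
  have hu : IsUnit M.det := isUnit_iff_ne_zero.2 hL.det_ne_zero
  have h1 : bgram G' * M⁻¹ + M * Matrix.of D = 0 := by
    ext i j
    have e1 := HasDerivAt.fun_sum (u := Finset.univ) fun k _ =>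
      (hasDerivAt_pi.1 (hasDerivAt_pi.1 hM i) k).mul (hD k j)
    have e2 : (fun t => ∑ k, ((fun t => bgram (G t) i k) * fun t => (bgram (G t))⁻¹ k j) t)
        =ᶠ[nhds 0] fun _ => (1 : Matrix (Fin n) (Fin n) ℝ) i j := by
      filter_upwards [hfr] with t ⟨L, L', h⟩
      rw [← Matrix.mul_nonsing_inv _ (isUnit_iff_ne_zero.2 h.det_ne_zero), Matrix.mul_apply]
      rfl
    have e3 := e1.unique ((hasDerivAt_const (0 : ℝ) _).congr_of_eventuallyEq e2)
    rw [Finset.sum_add_distrib] at e3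
    simpa [Matrix.mul_apply] using e3
  have h2 : bgram G' = P.transpose * M + M * P := by
    ext i j
    simp only [bgram, Matrix.of_apply, hE, Matrix.add_apply, Matrix.mul_apply,
      Matrix.transpose_apply, P, M]
    conv_lhs => rw [← sum_stdVec (E (stdVec i)), ← sum_stdVec (E (stdVec j))]
    simp [mul_comm]
  have h3 : Matrix.of D = - (P * M⁻¹ + M⁻¹ * P.transpose) := by
    have h4 : M * Matrix.of D = - (bgram G' * M⁻¹) := by
      rw [eq_neg_iff_add_eq_zero, add_comm]
      exact h1
    calc Matrix.of D = M⁻¹ * (M * Matrix.of D) := by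
          rw [← Matrix.mul_assoc, Matrix.nonsing_inv_mul _ hu, Matrix.one_mul]
      _ = - (M⁻¹ * P.transpose * (M * M⁻¹) + (M⁻¹ * M) * P * M⁻¹) := by
          rw [h4, h2]
          noncomm_ring
      _ = _ := by
          rw [Matrix.mul_nonsing_inv _ hu, Matrix.nonsing_inv_mul _ hu, Matrix.mul_one,
            Matrix.one_mul, add_comm]
  have := congrArg (fun X : Matrix (Fin n) (Fin n) ℝ => X i j) h3
  simpa [Matrix.mul_apply, P, Finset.sum_add_distrib] using this

end Curves

/-! ### Coordinate changes and the metric in charts. -/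

section Charts

variable {n a b : ℕ} {M : Type*} [TopologicalSpace M] [ChartedSpace (Model n) M]

theorem isOpen_target (c : M) : IsOpen (extChartAt (𝓡 n) c).target :=
  isOpen_extChartAt_target c

theorem isOpen_source (c : M) : IsOpen (extChartAt (𝓡 n) c).source :=
  isOpen_extChartAt_source c

/-- The change of coordinates from the chart around `c` to the chart around `c'`. -/
def coordChange (c c' : M) (y : Model n) : Model n :=
  extChartAt (𝓡 n) c' ((extChartAt (𝓡 n) c).symm y)

/-- The domain of the change of coordinates. -/
def overlap (c c' : M) : Set (Model n) :=
  {y | y ∈ (extChartAt (𝓡 n) c).target ∧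
    (extChartAt (𝓡 n) c).symm y ∈ (extChartAt (𝓡 n) c').source}

theorem isOpen_overlap (c c' : M) : IsOpen (overlap c c' : Set (Model n)) :=
  (continuousOn_extChartAt_symm c).isOpen_inter_preimage (isOpen_target c) (isOpen_source c')

theorem coordChange_mem {c c' : M} {y : Model n} (hy : y ∈ overlap c c') :
    coordChange c c' y ∈ overlap c' c := by
  refine ⟨(extChartAt (𝓡 n) c').map_source hy.2, ?_⟩
  rw [coordChange, (extChartAt (𝓡 n) c').left_inv hy.2]
  exact (extChartAt (𝓡 n) c).map_target hy.1

theorem symm_coordChange {c c' : M} {y : Model n} (hy : y ∈ overlap c c') :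
    (extChartAt (𝓡 n) c').symm (coordChange c c' y) = (extChartAt (𝓡 n) c).symm y :=
  (extChartAt (𝓡 n) c').left_inv hy.2

variable [IsManifold (𝓡 n) ∞ M]

theorem isInvertible_chartD {c x : M} (hx : x ∈ (extChartAt (𝓡 n) c).source) :
    (chartD (n := n) c x).IsInvertible := by
  have : IsManifold (𝓡 n) 1 M := IsManifold.of_le (n := ∞) (by simp)
  exact isInvertible_mfderiv_extChartAt (I := 𝓡 n) hx

theorem chartDInv_chartD {c x : M} (hx : x ∈ (extChartAt (𝓡 n) c).source)
    (v : TangentSpace (𝓡 n) x) : chartDInv c x (chartD c x v) = v := by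
  obtain ⟨e, he⟩ := isInvertible_chartD hx
  rw [chartDInv, ← he, ContinuousLinearMap.inverse_equiv]
  exact e.symm_apply_apply v

theorem chartD_chartDInv {c x : M} (hx : x ∈ (extChartAt (𝓡 n) c).source)
    (v : Model n) : chartD c x (chartDInv c x v) = v := by
  obtain ⟨e, he⟩ := isInvertible_chartD hx
  rw [chartDInv, ← he, ContinuousLinearMap.inverse_equiv]
  exact e.apply_symm_apply v

theorem contDiffAt_coordChange {c c' : M} {y : Model n} (hy : y ∈ overlap c c') :
    ContDiffAt ℝ ∞ (coordChange c c') y := by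
  have h := contDiffWithinAt_ext_coord_change (I := 𝓡 n) (n := ∞) c' c (y := y)
    (by simpa [overlap] using hy)
  rw [modelWithCornersSelf_coe, Set.range_id, contDiffWithinAt_univ] at h
  exact h

theorem fderiv_coordChange {c c' : M} {y : Model n} (hy : y ∈ overlap c c') :
    fderiv ℝ (coordChange c c') y = chartD c' ((extChartAt (𝓡 n) c).symm y) ∘L
      chartDInv c ((extChartAt (𝓡 n) c).symm y) := by
  have : IsManifold (𝓡 n) 1 M := IsManifold.of_le (n := ∞) (by simp)
  set x := (extChartAt (𝓡 n) c).symm y with hx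
  have hxs : x ∈ (extChartAt (𝓡 n) c).source := (extChartAt (𝓡 n) c).map_target hy.1
  have h1 : (coordChange c c' ∘ extChartAt (𝓡 n) c) =ᶠ[nhds x] extChartAt (𝓡 n) c' := by
    filter_upwards [(isOpen_source c).mem_nhds hxs] with z hz
    rw [Function.comp_apply, coordChange, (extChartAt (𝓡 n) c).left_inv hz]
  have hyx : extChartAt (𝓡 n) c x = y := (extChartAt (𝓡 n) c).right_inv hy.1
  have h2 : mfderiv (𝓡 n) 𝓘(ℝ, Model n) (coordChange c c' ∘ extChartAt (𝓡 n) c) x =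
      chartD c' x := h1.mfderiv_eq
  rw [mfderiv_comp x (I' := 𝓘(ℝ, Model n))] at h2
  · rw [hyx, mfderiv_eq_fderiv] at h2
    ext1 v
    rw [ContinuousLinearMap.comp_apply, ← h2]
    exact congrArg (fderiv ℝ (coordChange c c') y) (chartD_chartDInv hxs v).symm
  · rw [hyx]
    exact ((contDiffAt_coordChange hy).differentiableAt (by simp)).mdifferentiableAt
  · exact mdifferentiableAt_extChartAt (by simpa using hxs)

theorem fderiv_coordChange_left {c c' : M} {y : Model n} (hy : y ∈ overlap c c') (v : Model n) :
    fderiv ℝ (coordChange c' c) (coordChange c c' y) (fderiv ℝ (coordChange c c') y v) = v := by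
  rw [fderiv_coordChange hy, fderiv_coordChange (coordChange_mem hy), symm_coordChange hy]
  simp only [ContinuousLinearMap.comp_apply]
  rw [chartDInv_chartD hy.2, chartD_chartDInv ((extChartAt (𝓡 n) c).map_target hy.1)]

theorem fderiv_coordChange_right {c c' : M} {y : Model n} (hy : y ∈ overlap c c') (v : Model n) :
    fderiv ℝ (coordChange c c') y (fderiv ℝ (coordChange c' c) (coordChange c c' y) v) = v := by
  rw [fderiv_coordChange hy, fderiv_coordChange (coordChange_mem hy), symm_coordChange hy]
  simp only [ContinuousLinearMap.comp_apply]
  rw [chartDInv_chartD ((extChartAt (𝓡 n) c).map_target hy.1), chartD_chartDInv hy.2]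

theorem localTensor_coordChange (T : TensorField n M a b) {c c' : M} {y : Model n}
    (hy : y ∈ overlap c c') :
    localTensor T c y = transport (fderiv ℝ (coordChange c c') y)
      (fderiv ℝ (coordChange c' c) (coordChange c c' y))
      (localTensor T c' (coordChange c c' y)) := by
  rw [fderiv_coordChange hy, fderiv_coordChange (coordChange_mem hy), symm_coordChange hy,
    localTensor, localTensor, symm_coordChange hy]
  ext v α
  simp only [transport_apply]
  congr 1
  · congr 1
    funext j
    simp only [ContinuousLinearMap.comp_apply]
    rw [chartDInv_chartD hy.2]
  · funext i
    ext v
    simp only [ContinuousLinearMap.comp_apply]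
    rw [chartDInv_chartD hy.2]

variable (g : Metric n M)

theorem localMetric_apply (c : M) (y u v : Model n) :
    localMetric g c y u v = g.inner ((extChartAt (𝓡 n) c).symm y)
      (chartDInv c ((extChartAt (𝓡 n) c).symm y) u)
      (chartDInv c ((extChartAt (𝓡 n) c).symm y) v) := rfl

theorem localMetric_symm (c : M) (y u v : Model n) :
    localMetric g c y u v = localMetric g c y v u := g.symm _ _ _

theorem localMetric_pos {c : M} {y : Model n} (hy : y ∈ (extChartAt (𝓡 n) c).target)
    (v : Model n) (hv : v ≠ 0) : 0 < localMetric g c y v v := by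
  refine g.pos _ _ fun h => hv ?_
  have h : chartDInv c ((extChartAt (𝓡 n) c).symm y) v = 0 := h
  rw [← chartD_chartDInv ((extChartAt (𝓡 n) c).map_target hy) v, h, map_zero]

theorem exists_isFrame_localMetric {c : M} {y : Model n}
    (hy : y ∈ (extChartAt (𝓡 n) c).target) : ∃ L L', IsFrame (localMetric g c y) L L' :=
  exists_isFrame (localMetric_symm g c y) (localMetric_pos g hy)

theorem localMetric_coordChange {c c' : M} {y : Model n} (hy : y ∈ overlap c c') (u v : Model n) :
    localMetric g c y u v = localMetric g c' (coordChange c c' y)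
      (fderiv ℝ (coordChange c c') y u) (fderiv ℝ (coordChange c c') y v) := by
  -- The base points agree only through an equation and occur in the types of the tangent vectors;
  -- stating the claim for an arbitrary `x' = x` permits substitution.
  have key : ∀ x x' : M, x ∈ (extChartAt (𝓡 n) c').source → x' = x →
      ∀ u v : TangentSpace (𝓡 n) x, g.inner x u v =
        g.inner x' (chartDInv c' x' (chartD c' x u)) (chartDInv c' x' (chartD c' x v)) := by
    rintro x _ hx rfl u v
    rw [chartDInv_chartD hx, chartDInv_chartD hx]
  rw [localMetric_apply, localMetric_apply, fderiv_coordChange hy]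
  exact key _ _ hy.2 (symm_coordChange hy) _ _

/-- Coordinate vector fields are smooth because the trivialization of the tangent bundle at `c`
sends them to the constant `u`. The smooth metric evaluated on two of them gives the smooth entries
used in `contDiffOn_localMetric`. -/
theorem contMDiffOn_chartDInv (c : M) (u : Model n) :
    ContMDiffOn (𝓡 n) ((𝓡 n).prod 𝓘(ℝ, Model n)) ∞
      (fun x => (Bundle.TotalSpace.mk' (Model n) x (chartDInv c x u) : TangentBundle (𝓡 n) M))
      (extChartAt (𝓡 n) c).source := by
  have : IsManifold (𝓡 n) 1 M := IsManifold.of_le (n := ∞) (by simp)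
  have hb : (trivializationAt (Model n) (TangentSpace (𝓡 n) : M → Type _) c).baseSet =
      (extChartAt (𝓡 n) c).source := by
    simp
  rw [← hb, (trivializationAt (Model n) (TangentSpace (𝓡 n) : M → Type _)
    c).contMDiffOn_section_baseSet_iff]
  refine (contMDiffOn_const (c := u)).congr fun x hx => ?_
  have hx' : x ∈ (chartAt (Model n) c).source := by simpa using hx
  have h1 := TangentBundle.continuousLinearMapAt_trivializationAt (I := 𝓡 n) (𝕜 := ℝ) hx'
  have h2 := congrArg (fun f => f (chartDInv c x u)) h1
  rw [hb] at hx
  have h3 := chartD_chartDInv hx u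
  refine Eq.trans ?_ (h2.trans h3)
  exact (Bundle.Trivialization.continuousLinearMapAt_apply_of_mem (R := ℝ)
    (trivializationAt (Model n) (TangentSpace (𝓡 n) : M → Type _) c)
    (by simpa using hx') _).symm

theorem contDiffOn_localMetric (c : M) :
    ContDiffOn ℝ ∞ (localMetric g c) (extChartAt (𝓡 n) c).target := by
  have h1 : ∀ u v : Model n, ContDiffOn ℝ ∞ (fun y => localMetric g c y u v)
      (extChartAt (𝓡 n) c).target := by
    intro u v
    have h2 := ContMDiffOn.clm_bundle_apply₂ (E₃ := Bundle.Trivial M ℝ) (F₃ := ℝ)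
      g.contMDiff.contMDiffOn
      (contMDiffOn_chartDInv c u) (contMDiffOn_chartDInv c v)
    have h4 : ContMDiffOn (𝓡 n) 𝓘(ℝ) ∞ (fun x => g.inner x (chartDInv c x u) (chartDInv c x v))
        (extChartAt (𝓡 n) c).source := fun x hx =>
      (Bundle.contMDiffWithinAt_totalSpace.1 (h2 x hx)).2
    have h5 := h4.comp (contMDiffOn_extChartAt_symm (I := 𝓡 n) (n := ∞) c)
      fun y hy => (extChartAt (𝓡 n) c).map_target hy
    exact contMDiffOn_iff_contDiffOn.1 h5
  have h3 : localMetric g c = fun y => ∑ i, ∑ j, localMetric g c y (stdVec i) (stdVec j) •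
      ((ContinuousLinearMap.smulRightL ℝ (Model n) (Model n →L[ℝ] ℝ) (stdCovec i)) (stdCovec j)) := by
    funext y
    ext u v
    conv_lhs => rw [← sum_stdVec u, ← sum_stdVec v]
    simp only [map_sum, map_smul, _root_.sum_apply, _root_.smul_apply, smul_eq_mul,
      Finset.mul_sum]
    rw [Finset.sum_comm]
    simp [mul_comm, mul_left_comm, mul_assoc]
  rw [h3]
  exact ContDiffOn.sum fun i _ => ContDiffOn.sum fun j _ => (h1 _ _).smul contDiffOn_const

end Charts

/-! ### Christoffel symbols: Koszul formula, compatibility, transformation law. -/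

section Christoffel

variable {n a b : ℕ} {M : Type*} [TopologicalSpace M] [ChartedSpace (Model n) M]
  [IsManifold (𝓡 n) ∞ M] (g : Metric n M)

theorem differentiableAt_localMetric {c : M} {y : Model n}
    (hy : y ∈ (extChartAt (𝓡 n) c).target) : DifferentiableAt ℝ (localMetric g c) y :=
  ((contDiffOn_localMetric g c).contDiffAt ((isOpen_target c).mem_nhds hy)).differentiableAt
    (by simp)

theorem hasDerivAt_line (y u : Model n) : HasDerivAt (fun t : ℝ => y + t • u) u 0 := by
  simpa using ((hasDerivAt_id (0 : ℝ)).smul_const u).const_add y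

theorem hasDerivAt_comp_line {W : Type*} [NormedAddCommGroup W] [NormedSpace ℝ W]
    {f : Model n → W} {y : Model n} (hf : DifferentiableAt ℝ f y) (u : Model n) :
    HasDerivAt (fun t : ℝ => f (y + t • u)) (fderiv ℝ f y u) 0 := by
  have h : HasFDerivAt f (fderiv ℝ f y) (y + (0 : ℝ) • u) := by simpa using hf.hasFDerivAt
  exact h.comp_hasDerivAt (0 : ℝ) (hasDerivAt_line y u)

theorem eventually_line {P : Model n → Prop} {y : Model n} (h : ∀ᶠ z in nhds y, P z)
    (u : Model n) : ∀ᶠ t in nhds (0 : ℝ), P (y + t • u) := by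
  have h1 : Filter.Tendsto (fun t : ℝ => y + t • u) (nhds 0) (nhds y) := by
    have := (hasDerivAt_line y u).continuousAt
    simpa [ContinuousAt] using this
  exact h1.eventually h

theorem fderiv_localMetric_symm {c : M} {y : Model n}
    (hy : y ∈ (extChartAt (𝓡 n) c).target) (u v w : Model n) :
    fderiv ℝ (localMetric g c) y u v w = fderiv ℝ (localMetric g c) y u w v := by
  have h := hasDerivAt_comp_line (differentiableAt_localMetric g hy) u
  have h1 := (h.clm_apply (hasDerivAt_const (0 : ℝ) v)).clm_apply (hasDerivAt_const (0 : ℝ) w)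
  have h2 := (h.clm_apply (hasDerivAt_const (0 : ℝ) w)).clm_apply (hasDerivAt_const (0 : ℝ) v)
  simp only [localMetric_symm g c _ w v] at h2
  simpa using h1.unique h2

/-- Lowering the index cancels `g^{kl}` and leaves the Koszul formula for coordinate fields, whose
brackets vanish. Symmetry of `Γ`, metric compatibility and the transformation law then follow by
pairing with arbitrary vectors. -/
theorem localMetric_christoffel {c : M} {y : Model n}
    (hy : y ∈ (extChartAt (𝓡 n) c).target) (u v w : Model n) :
    localMetric g c y (christoffel g c y u v) w =
      (1 / 2 : ℝ) * (fderiv ℝ (localMetric g c) y u v w + fderiv ℝ (localMetric g c) y v u w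
        - fderiv ℝ (localMetric g c) y w u v) := by
  obtain ⟨L, L', hL⟩ := exists_isFrame_localMetric g hy
  have hu : IsUnit (gram g c y).det := isUnit_iff_ne_zero.2 hL.det_ne_zero
  have h1 : ∀ m, localMetric g c y (christoffel g c y u v) (stdVec m) =
      (1 / 2 : ℝ) * christoffelLower g c y m u v := by
    intro m
    have h2 : ∀ l, ∑ k, (gram g c y)⁻¹ k l * gram g c y k m = if l = m then 1 else 0 := by
      intro l
      have h3 := congrArg (fun X : Matrix (Fin n) (Fin n) ℝ => X m l)
        (Matrix.mul_nonsing_inv _ hu)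
      simp only [Matrix.mul_apply, Matrix.one_apply] at h3
      have h4 : (if l = m then (1 : ℝ) else 0) = if m = l then 1 else 0 := by
        simp only [eq_comm]
      rw [h4, ← h3]
      refine Finset.sum_congr rfl fun k _ => ?_
      rw [mul_comm]
      congr 1
      exact localMetric_symm g c y _ _
    rw [christoffel_apply]
    simp only [map_sum, map_smul, _root_.sum_apply, _root_.smul_apply, smul_eq_mul]
    rw [Finset.sum_comm]
    calc _ = ∑ l, (1 / 2 : ℝ) * christoffelLower g c y l u v *
          ∑ k, (gram g c y)⁻¹ k l * gram g c y k m := by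
          refine Finset.sum_congr rfl fun l _ => ?_
          rw [Finset.mul_sum]
          refine Finset.sum_congr rfl fun k _ => ?_
          simp only [gram, Matrix.of_apply]
          ring
      _ = _ := by simp [h2]
  have h4 : localMetric g c y (christoffel g c y u v) w =
      ∑ m, w m * localMetric g c y (christoffel g c y u v) (stdVec m) := by
    conv_lhs => rw [← sum_stdVec w]
    simp
  have h5 : ∀ f : Model n →L[ℝ] ℝ, f w = ∑ m, w m * f (stdVec m) := fun f => by
    conv_lhs => rw [← sum_stdVec w]
    simp
  have h6 : fderiv ℝ (localMetric g c) y w u v =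
      ∑ m, w m * fderiv ℝ (localMetric g c) y (stdVec m) u v := by
    conv_lhs => rw [← sum_stdVec w]
    simp
  rw [h4, h5 (fderiv ℝ (localMetric g c) y u v), h5 (fderiv ℝ (localMetric g c) y v u), h6]
  simp only [h1, christoffelLower_apply, ← Finset.sum_add_distrib, ← Finset.sum_sub_distrib,
    Finset.mul_sum]
  refine Finset.sum_congr rfl fun m _ => by ring

theorem eq_of_localMetric_eq {c : M} {y : Model n} (hy : y ∈ (extChartAt (𝓡 n) c).target)
    {u v : Model n} (h : ∀ w, localMetric g c y u w = localMetric g c y v w) : u = v := by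
  by_contra hne
  have h1 := localMetric_pos g hy (u - v) (sub_ne_zero.2 hne)
  have h2 : localMetric g c y (u - v) (u - v) = 0 := by
    have := h (u - v)
    rw [← sub_eq_zero, ← _root_.sub_apply, ← map_sub] at this
    exact this
  exact h1.ne' h2

theorem christoffel_symm {c : M} {y : Model n} (hy : y ∈ (extChartAt (𝓡 n) c).target)
    (u v : Model n) : christoffel g c y u v = christoffel g c y v u := by
  refine eq_of_localMetric_eq g hy fun w => ?_
  rw [localMetric_christoffel g hy, localMetric_christoffel g hy,
    fderiv_localMetric_symm g hy w u v]
  ring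

/-- The Levi-Civita connection is compatible with the metric. -/
theorem fderiv_localMetric {c : M} {y : Model n} (hy : y ∈ (extChartAt (𝓡 n) c).target)
    (w u v : Model n) : fderiv ℝ (localMetric g c) y w u v =
      localMetric g c y (christoffel g c y w u) v
        + localMetric g c y u (christoffel g c y w v) := by
  rw [localMetric_symm g c y u, localMetric_christoffel g hy, localMetric_christoffel g hy,
    fderiv_localMetric_symm g hy w v u, fderiv_localMetric_symm g hy u w v,
    fderiv_localMetric_symm g hy v w u]
  ring

theorem contDiffOn_bgram_inv (c : M) (i j : Fin n) :
    ContDiffOn ℝ ∞ (fun y => (bgram (localMetric g c y))⁻¹ i j) (extChartAt (𝓡 n) c).target := by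
  intro y hy
  obtain ⟨L, L', hL⟩ := exists_isFrame_localMetric g hy
  have h1 : ContDiffWithinAt ℝ ∞ (fun y i j => bgram (localMetric g c y) i j)
      (extChartAt (𝓡 n) c).target y := by
    refine contDiffWithinAt_pi.2 fun k => contDiffWithinAt_pi.2 fun l => ?_
    exact ((contDiffOn_localMetric g c y hy).clm_apply contDiffWithinAt_const).clm_apply
      contDiffWithinAt_const
  exact (contDiffAt_matrix_inv (M := fun i j => bgram (localMetric g c y) i j)
    hL.det_ne_zero i j).comp_contDiffWithinAt y h1

theorem contDiffOn_bgram_det (c : M) :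
    ContDiffOn ℝ ∞ (fun y => (bgram (localMetric g c y)).det) (extChartAt (𝓡 n) c).target := by
  have h1 : ContDiffOn ℝ ∞ (fun y i j => bgram (localMetric g c y) i j)
      (extChartAt (𝓡 n) c).target := by
    refine contDiffOn_pi.2 fun k => contDiffOn_pi.2 fun l => ?_
    exact ((contDiffOn_localMetric g c).clm_apply contDiffOn_const).clm_apply contDiffOn_const
  exact contDiff_det.comp_contDiffOn h1

theorem contDiffOn_christoffel (c : M) :
    ContDiffOn ℝ ∞ (christoffel g c) (extChartAt (𝓡 n) c).target := by
  refine contDiffOn_clm_apply.2 fun u => contDiffOn_clm_apply.2 fun v => ?_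
  simp only [christoffel_apply, christoffelLower_apply]
  have hD : ContDiffOn ℝ ∞ (fderiv ℝ (localMetric g c)) (extChartAt (𝓡 n) c).target :=
    (contDiffOn_localMetric g c).fderiv_of_isOpen (isOpen_target c) (by simp)
  have hD' : ∀ u v w : Model n, ContDiffOn ℝ ∞ (fun y => fderiv ℝ (localMetric g c) y u v w)
      (extChartAt (𝓡 n) c).target := fun u v w =>
    ((hD.clm_apply contDiffOn_const).clm_apply contDiffOn_const).clm_apply contDiffOn_const
  refine ContDiffOn.sum fun k _ => ContDiffOn.sum fun l _ => ?_
  exact ((contDiffOn_const.mul (contDiffOn_bgram_inv g c k l)).mul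
    (((hD' _ _ _).add (hD' _ _ _)).sub (hD' _ _ _))).smul contDiffOn_const

theorem fderiv_localMetric_coordChange {c c' : M} {y : Model n} (hy : y ∈ overlap c c')
    (u v w : Model n) :
    fderiv ℝ (localMetric g c) y u v w =
      fderiv ℝ (localMetric g c') (coordChange c c' y) (fderiv ℝ (coordChange c c') y u)
        (fderiv ℝ (coordChange c c') y v) (fderiv ℝ (coordChange c c') y w)
      + localMetric g c' (coordChange c c' y) (fderiv ℝ (fderiv ℝ (coordChange c c')) y u v)
        (fderiv ℝ (coordChange c c') y w)
      + localMetric g c' (coordChange c c' y) (fderiv ℝ (coordChange c c') y v)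
        (fderiv ℝ (fderiv ℝ (coordChange c c')) y u w) := by
  have h := hasDerivAt_comp_line (differentiableAt_localMetric g hy.1) u
  have h1 := (h.clm_apply (hasDerivAt_const (0 : ℝ) v)).clm_apply (hasDerivAt_const (0 : ℝ) w)
  have hτ := contDiffAt_coordChange hy
  have hG : DifferentiableAt ℝ (fun z => localMetric g c' (coordChange c c' z)) y :=
    (differentiableAt_localMetric g (coordChange_mem hy).1).comp y
      (hτ.differentiableAt (by simp))
  have h2 := hasDerivAt_comp_line hG u
  have hDτ : DifferentiableAt ℝ (fderiv ℝ (coordChange c c')) y :=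
    (hτ.fderiv_right (m := ∞) (by simp)).differentiableAt (by simp)
  have h3 := fun v => (hasDerivAt_comp_line hDτ u).clm_apply (hasDerivAt_const (0 : ℝ) v)
  have h4 := (h2.clm_apply (h3 v)).clm_apply (h3 w)
  have h5 : (fun t : ℝ => localMetric g c (y + t • u) v w) =ᶠ[nhds 0] fun t =>
      localMetric g c' (coordChange c c' (y + t • u)) (fderiv ℝ (coordChange c c') (y + t • u) v)
        (fderiv ℝ (coordChange c c') (y + t • u) w) := by
    filter_upwards [eventually_line ((isOpen_overlap c c').mem_nhds hy) u] with t ht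
    exact localMetric_coordChange g ht v w
  have h6 := h1.unique (h4.congr_of_eventuallyEq h5)
  have h7 : fderiv ℝ (fun z => localMetric g c' (coordChange c c' z)) y u =
      fderiv ℝ (localMetric g c') (coordChange c c' y) (fderiv ℝ (coordChange c c') y u) := by
    have := fderiv_comp y (differentiableAt_localMetric g (coordChange_mem hy).1)
      (hτ.differentiableAt (by simp))
    exact congrArg (fun f => f u) this
  simpa [h7] using h6

/-- The transformation law of the Christoffel symbols. -/
theorem christoffel_coordChange {c c' : M} {y : Model n} (hy : y ∈ overlap c c')
    (u v : Model n) :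
    fderiv ℝ (coordChange c c') y (christoffel g c y u v) =
      christoffel g c' (coordChange c c' y) (fderiv ℝ (coordChange c c') y u)
        (fderiv ℝ (coordChange c c') y v)
      + fderiv ℝ (fderiv ℝ (coordChange c c')) y u v := by
  -- By symmetry of the second derivative of the coordinate change, four of the six second order
  -- terms in the Koszul combination cancel, and the other two are both the pairing of `D²(u, v)`
  -- with the image of `w`.
  have hsymm : ∀ u v, fderiv ℝ (fderiv ℝ (coordChange c c')) y u v =
      fderiv ℝ (fderiv ℝ (coordChange c c')) y v u :=
    (contDiffAt_coordChange hy).isSymmSndFDerivAt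
      (by simpa using WithTop.coe_le_coe.2 (le_top : (2 : ℕ∞) ≤ ⊤))
  have hy' := (coordChange_mem hy).1
  refine eq_of_localMetric_eq g hy' fun w' => ?_
  obtain ⟨w, rfl⟩ : ∃ w, fderiv ℝ (coordChange c c') y w = w' :=
    ⟨_, fderiv_coordChange_right hy w'⟩
  rw [← localMetric_coordChange g hy, localMetric_christoffel g hy.1, map_add,
    _root_.add_apply, localMetric_christoffel g hy']
  simp only [fderiv_localMetric_coordChange g hy]
  rw [hsymm v u, hsymm w u, hsymm w v, localMetric_symm g c' _ _
    (fderiv ℝ (fderiv ℝ (coordChange c c')) y u w), localMetric_symm g c' _ _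
    (fderiv ℝ (fderiv ℝ (coordChange c c')) y v w)]
  ring

end Christoffel

/-! ### Tensoriality and smoothness of the covariant derivative. -/

section Nabla

variable {n a b : ℕ}

/-- The action of linear maps on tensors, as a continuous linear map. -/
def transportL (L L' : Model n →L[ℝ] Model n) :
    TensorSpace (Model n) a b →L[ℝ] TensorSpace (Model n) a b :=
  LinearMap.toContinuousLinearMap
    { toFun := transport L L'
      map_add' := fun S S' => by ext v α; simp [transport_apply]
      map_smul' := fun r S => by ext v α; simp [transport_apply] }

/-- A bilinear map on finite-dimensional spaces is continuous, so smoothness of `connectionTerm`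
reduces to checking algebraic identities. -/
theorem contDiffOn_of_bilinear {X E F G : Type*} [NormedAddCommGroup X] [NormedSpace ℝ X]
    [NormedAddCommGroup E] [NormedSpace ℝ E] [FiniteDimensional ℝ E]
    [NormedAddCommGroup F] [NormedSpace ℝ F] [FiniteDimensional ℝ F]
    [NormedAddCommGroup G] [NormedSpace ℝ G] {f : E → F → G}
    (h1 : ∀ e e' v, f (e + e') v = f e v + f e' v) (h2 : ∀ (r : ℝ) e v, f (r • e) v = r • f e v)
    (h3 : ∀ e v v', f e (v + v') = f e v + f e v') (h4 : ∀ (r : ℝ) e v, f e (r • v) = r • f e v)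
    {x : X → E} {y : X → F} {s : Set X} (hx : ContDiffOn ℝ ∞ x s) (hy : ContDiffOn ℝ ∞ y s) :
    ContDiffOn ℝ ∞ (fun z => f (x z) (y z)) s := by
  let B := (LinearMap.mk₂ ℝ f h1 h2 h3 h4).toContinuousBilinearMap
  exact (B.contDiff.comp_contDiffOn hx).clm_apply hy

theorem ContDiffOn.connectionTerm {X : Type*} [NormedAddCommGroup X] [NormedSpace ℝ X]
    {Γ : X → Model n →L[ℝ] Model n →L[ℝ] Model n} {S : X → TensorSpace (Model n) a b} {s : Set X}
    (hΓ : ContDiffOn ℝ ∞ Γ s) (hS : ContDiffOn ℝ ∞ S s) :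
    ContDiffOn ℝ ∞ (fun z => connectionTerm (Γ z) (S z)) s := by
  refine contDiffOn_of_bilinear (f := RiemTensor.connectionTerm) ?_ ?_ ?_ ?_ hΓ hS
  · intro Γ Γ' S
    ext u v α
    simp only [connectionTerm_apply, _root_.add_apply, ContinuousLinearMap.comp_add,
      ContinuousMultilinearMap.map_update_add, Finset.sum_add_distrib]
    ring
  · intro r Γ S
    ext u v α
    simp only [connectionTerm_apply, _root_.smul_apply, ContinuousLinearMap.comp_smul,
      ContinuousMultilinearMap.map_update_smul, ← Finset.smul_sum, smul_sub]
  · intro Γ S S'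
    ext u v α
    simp only [connectionTerm_apply, _root_.add_apply, Finset.sum_add_distrib]
    ring
  · intro r Γ S
    ext u v α
    simp only [connectionTerm_apply, _root_.smul_apply, ← Finset.smul_sum, smul_sub]

theorem connectionTerm_eq_endoVal (Γ : Model n →L[ℝ] Model n →L[ℝ] Model n)
    (S : TensorSpace (Model n) a b) (u : Model n) (v : Fin b → Model n)
    (α : Fin a → (Model n →L[ℝ] ℝ)) : connectionTerm Γ S u v α = endoVal (Γ u) S v α :=
  connectionTerm_apply Γ S u v α

theorem endoVal_add (E E' : Model n →L[ℝ] Model n) (S : TensorSpace (Model n) a b)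
    (v : Fin b → Model n) (α : Fin a → (Model n →L[ℝ] ℝ)) :
    endoVal (E + E') S v α = endoVal E S v α + endoVal E' S v α := by
  simp only [endoVal, _root_.add_apply, ContinuousLinearMap.comp_add,
    ContinuousMultilinearMap.map_update_add, Finset.sum_add_distrib]
  ring

theorem endoVal_transport {N N' : Model n →L[ℝ] Model n} (hN : ∀ v, N (N' v) = v)
    (E : Model n →L[ℝ] Model n) (S : TensorSpace (Model n) a b)
    (v : Fin b → Model n) (α : Fin a → (Model n →L[ℝ] ℝ)) :
    endoVal (N' ∘L E ∘L N) (transport N N' S) v α =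
      endoVal E S (fun j => N (v j)) (fun i => (α i).comp N') := by
  simp only [endoVal, transport_apply]
  congr 1
  · refine Finset.sum_congr rfl fun i _ => ?_
    congr 1
    funext m
    rcases eq_or_ne m i with rfl | h
    · ext w
      simp [hN]
    · simp [h]
  · refine Finset.sum_congr rfl fun j _ => ?_
    congr 2
    funext m
    rcases eq_or_ne m j with rfl | h
    · simp [hN]
    · simp [h]

variable {M : Type*} [TopologicalSpace M] [ChartedSpace (Model n) M]
  [IsManifold (𝓡 n) ∞ M] (g : Metric n M)

/-- The covariant derivative in a chart, as a linear map in the direction. -/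
def localD (T : TensorField n M a b) (c : M) (y : Model n) :
    Model n →L[ℝ] TensorSpace (Model n) a b :=
  fderiv ℝ (localTensor T c) y + connectionTerm (christoffel g c y) (localTensor T c y)

theorem localNabla_eq (T : TensorField n M a b) (c : M) (y : Model n) :
    localNabla g T c y = (localD g T c y).uncurryLeft := rfl

theorem localD_apply (T : TensorField n M a b) (c : M) (y u : Model n) (v : Fin b → Model n)
    (α : Fin a → (Model n →L[ℝ] ℝ)) : localD g T c y u v α =
      fderiv ℝ (localTensor T c) y u v α
        + endoVal (christoffel g c y u) (localTensor T c y) v α := by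
  rw [← connectionTerm_eq_endoVal]
  rfl

theorem contDiffOn_localD {T : TensorField n M a b} (hT : IsSmooth T) (c : M) :
    ContDiffOn ℝ ∞ (localD g T c) (extChartAt (𝓡 n) c).target := by
  refine ((hT c).fderiv_of_isOpen (isOpen_target c) (by simp)).add ?_
  exact ContDiffOn.connectionTerm (contDiffOn_christoffel g c) (hT c)

theorem contDiffOn_localNabla {T : TensorField n M a b} (hT : IsSmooth T) (c : M) :
    ContDiffOn ℝ ∞ (localNabla g T c) (extChartAt (𝓡 n) c).target :=
  (continuousMultilinearCurryLeftEquiv ℝ (fun _ : Fin (b + 1) => Model n)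
    ((Model n →L[ℝ] ℝ) [×a]→L[ℝ] ℝ)).symm.contDiff.comp_contDiffOn (contDiffOn_localD g hT c)

omit [IsManifold (𝓡 n) ∞ M] in
theorem IsSmooth.differentiableAt {T : TensorField n M a b} (hT : IsSmooth T) {c : M}
    {y : Model n} (hy : y ∈ (extChartAt (𝓡 n) c).target) :
    DifferentiableAt ℝ (localTensor T c) y :=
  ((hT c).contDiffAt ((isOpen_target c).mem_nhds hy)).differentiableAt (by simp)

/-- Freeze the differentials `N`, `N'` of the coordinate changes at `y`. Along the line through `y`
the tensor is a transport by maps `K t`, `K' t` that start at the identity, with velocities `E` and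
`-E`, where `E` is `N'` applied to the second derivative of the coordinate change. The resulting
`-endoVal E` cancels the inhomogeneous term `E` in the transformation law of `Γ`. -/
theorem localD_coordChange {T : TensorField n M a b} (hT : IsSmooth T) {c c' : M} {y : Model n}
    (hy : y ∈ overlap c c') (u : Model n) :
    localD g T c y u = transport (fderiv ℝ (coordChange c c') y)
      (fderiv ℝ (coordChange c' c) (coordChange c c' y))
      (localD g T c' (coordChange c c' y) (fderiv ℝ (coordChange c c') y u)) := by
  set τ : Model n → Model n := coordChange c c' with hτdef
  set τ' : Model n → Model n := coordChange c' c with hτ'def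
  have hy' := coordChange_mem hy
  have hτ : ContDiffAt ℝ ∞ τ y := contDiffAt_coordChange hy
  have hτ' : ContDiffAt ℝ ∞ τ' (τ y) := contDiffAt_coordChange hy'
  have hleft : ∀ v, fderiv ℝ τ' (τ y) (fderiv ℝ τ y v) = v := fderiv_coordChange_left hy
  have hright : ∀ v, fderiv ℝ τ y (fderiv ℝ τ' (τ y) v) = v := fderiv_coordChange_right hy
  let N := fderiv ℝ τ y
  let N' := fderiv ℝ τ' (τ y)
  let E := N' ∘L (fderiv ℝ (fderiv ℝ τ) y u)
  have hDτ : HasDerivAt (fun t : ℝ => fderiv ℝ τ (y + t • u)) (fderiv ℝ (fderiv ℝ τ) y u) 0 :=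
    hasDerivAt_comp_line ((hτ.fderiv_right (m := ∞) (by simp)).differentiableAt (by simp)) u
  have hDτ' : ∃ D, HasDerivAt (fun t : ℝ => fderiv ℝ τ' (τ (y + t • u))) D 0 := by
    have h1 : DifferentiableAt ℝ (fun z => fderiv ℝ τ' (τ z)) y :=
      ((hτ'.fderiv_right (m := ∞) (by simp)).differentiableAt (by simp)).comp y
        (hτ.differentiableAt (by simp))
    exact ⟨_, hasDerivAt_comp_line h1 u⟩
  obtain ⟨D, hD⟩ := hDτ'
  let K : ℝ → Model n →L[ℝ] Model n := fun t => N' ∘L fderiv ℝ τ (y + t • u)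
  let K' : ℝ → Model n →L[ℝ] Model n := fun t => fderiv ℝ τ' (τ (y + t • u)) ∘L N
  have hK0 : K 0 = ContinuousLinearMap.id ℝ _ := by
    ext1 v
    simpa [K, N'] using hleft v
  have hK0' : K' 0 = ContinuousLinearMap.id ℝ _ := by
    ext1 v
    simpa [K', N] using hleft v
  have hK : HasDerivAt K E 0 := by
    simpa using (hasDerivAt_const (0 : ℝ) N').clm_comp hDτ
  have hov := eventually_line ((isOpen_overlap c c').mem_nhds hy) u
  have hKK : ∀ᶠ t in nhds (0 : ℝ), K' t ∘L K t = ContinuousLinearMap.id ℝ _ := by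
    filter_upwards [hov] with t ht
    ext1 v
    simp only [K, K', N, N', ContinuousLinearMap.comp_apply, hright]
    exact fderiv_coordChange_left ht v
  -- `K'` is differentiable with some unnamed derivative; differentiating `K' t ∘ K t = id`
  -- identifies it as `-E`.
  have hK' : HasDerivAt K' (-E) 0 := by
    have h1 : HasDerivAt K' (D ∘L N) 0 := by
      simpa using hD.clm_comp (hasDerivAt_const (0 : ℝ) N)
    have h2 := (h1.clm_comp hK).unique ((hasDerivAt_const (0 : ℝ) _).congr_of_eventuallyEq hKK)
    rw [hK0, hK0'] at h2
    have h3 : D ∘L N = -E := eq_neg_of_add_eq_zero_left (by simpa using h2)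
    rwa [← h3]
  have hT' : DifferentiableAt ℝ (localTensor T c') (τ y) := hT.differentiableAt hy'.1
  have hS : HasDerivAt (fun t : ℝ => transport N N' (localTensor T c' (τ (y + t • u))))
      (transport N N' (fderiv ℝ (localTensor T c') (τ y) (N u))) 0 := by
    have h1 : DifferentiableAt ℝ (fun z => localTensor T c' (τ z)) y :=
      hT'.comp y (hτ.differentiableAt (by simp))
    have h2 := hasDerivAt_comp_line h1 u
    have h3 : fderiv ℝ (fun z => localTensor T c' (τ z)) y u =
        fderiv ℝ (localTensor T c') (τ y) (N u) :=
      congrArg (fun f => f u) (fderiv_comp y hT' (hτ.differentiableAt (by simp)))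
    rw [h3] at h2
    exact (transportL N N').hasFDerivAt.comp_hasDerivAt (0 : ℝ) h2
  have hline : (fun t : ℝ => localTensor T c (y + t • u)) =ᶠ[nhds 0] fun t =>
      transport (K t) (K' t) (transport N N' (localTensor T c' (τ (y + t • u)))) := by
    filter_upwards [hov] with t ht
    rw [localTensor_coordChange T ht, IsFrame.transport_comp]
    congr 1
    · ext1 v
      simp only [K, N, N', ContinuousLinearMap.comp_apply, hright]
      rfl
    · ext1 v
      simp only [K', N, N', ContinuousLinearMap.comp_apply, hright]
      rfl
  have hΓ : christoffel g c y u = N' ∘L (christoffel g c' (τ y) (N u)) ∘L N + E := by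
    ext1 v
    have h1 := congrArg N' (christoffel_coordChange g hy u v)
    rw [map_add] at h1
    rw [← hleft (christoffel g c y u v)]
    exact h1
  have hS0 : localTensor T c y = transport N N' (localTensor T c' (τ y)) :=
    localTensor_coordChange T hy
  ext v α
  have h1 := hasDerivAt_transport hK0 hK0' hK hK' hS v α
  have h2 := hasDerivAt_comp_line (hT.differentiableAt hy.1) u
  have h3 : HasDerivAt (fun t : ℝ => localTensor T c (y + t • u) v α)
      (fderiv ℝ (localTensor T c) y u v α) 0 := by
    have e1 := (ContinuousMultilinearMap.apply ℝ _ _ v).hasFDerivAt.comp_hasDerivAt (0 : ℝ) h2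
    exact (ContinuousMultilinearMap.apply ℝ _ _ α).hasFDerivAt.comp_hasDerivAt (0 : ℝ) e1
  have h4 := h3.unique (h1.congr_of_eventuallyEq
    (hline.mono fun t ht => congrArg (fun S => S v α) ht))
  rw [localD_apply, h4, hΓ, endoVal_add]
  simp only [zero_smul, add_zero]
  rw [← hS0, hS0, endoVal_transport hright, transport_apply, transport_apply, localD_apply]
  ring

/-- `nabla` is computed at each point in that point's own chart. Chart independence compares it with
a single fixed chart, which is what makes it possible to differentiate it again. -/
theorem localTensor_nabla {T : TensorField n M a b} (hT : IsSmooth T) {c : M} {y : Model n}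
    (hy : y ∈ (extChartAt (𝓡 n) c).target) :
    localTensor (nabla g T) c y = localNabla g T c y := by
  set x := (extChartAt (𝓡 n) c).symm y with hx
  have hov : y ∈ overlap c x := ⟨hy, mem_extChartAt_source x⟩
  have hτ : coordChange c x y = extChartAt (𝓡 n) x x := rfl
  have h1 : localTensor (nabla g T) x (extChartAt (𝓡 n) x x) =
      localNabla g T x (extChartAt (𝓡 n) x x) := by
    have hxx : (extChartAt (𝓡 n) x).symm (extChartAt (𝓡 n) x x) = x := extChartAt_to_inv x
    have hs : x ∈ (extChartAt (𝓡 n) x).source := mem_extChartAt_source x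
    have key : ∀ z : M, z = x → transport (chartDInv x z) (chartD x z) (nabla g T z) =
        localNabla g T x (extChartAt (𝓡 n) x x) := by
      rintro z rfl
      ext v α
      simp only [nabla, transport_apply]
      congr 1
      · congr 1
        funext j
        exact chartD_chartDInv hs _
      · funext i
        ext1 v
        simp only [ContinuousLinearMap.comp_apply, chartD_chartDInv hs]
    exact key _ hxx
  rw [localTensor_coordChange _ hov, hτ, h1, localNabla_eq, localNabla_eq]
  ext v α
  rw [transport_apply, ContinuousLinearMap.uncurryLeft_apply,
    ContinuousLinearMap.uncurryLeft_apply, localD_coordChange g hT hov]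
  rfl

theorem IsSmooth.nabla {T : TensorField n M a b} (hT : IsSmooth T) : IsSmooth (nabla g T) :=
  fun c => (contDiffOn_localNabla g hT c).congr fun _ hy => localTensor_nabla g hT hy

theorem IsSmooth.iterNabla {T : TensorField n M a b} (hT : IsSmooth T) (j : ℕ) :
    IsSmooth (iterNabla g T j) := by
  induction j with
  | zero => exact hT
  | succ j ih => exact ih.nabla g

theorem tensorNorm_eq (T : TensorField n M a b) {c x : M}
    (hx : x ∈ (extChartAt (𝓡 n) c).source) :
    tensorNorm g T x = √(ipT (localMetric g c (extChartAt (𝓡 n) c x))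
      (localTensor T c (extChartAt (𝓡 n) c x)) (localTensor T c (extChartAt (𝓡 n) c x))) := by
  have h0 : tensorNorm g T x = √(ipT (localMetric g x (extChartAt (𝓡 n) x x))
      (localTensor T x (extChartAt (𝓡 n) x x)) (localTensor T x (extChartAt (𝓡 n) x x))) := rfl
  have hov : extChartAt (𝓡 n) c x ∈ overlap c x :=
    ⟨(extChartAt (𝓡 n) c).map_source hx, by
      rw [(extChartAt (𝓡 n) c).left_inv hx]; exact mem_extChartAt_source x⟩
  have hτ : coordChange c x (extChartAt (𝓡 n) c x) = extChartAt (𝓡 n) x x := by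
    rw [coordChange, (extChartAt (𝓡 n) c).left_inv hx]
  rw [h0, localTensor_coordChange _ hov]
  obtain ⟨L, L', hL⟩ := exists_isFrame_localMetric g (coordChange_mem hov).1
  rw [hL.ipT_transport (fderiv_coordChange_left hov) (fderiv_coordChange_right hov)
    (localMetric_coordChange g hov), hτ]

end Nabla

/-! ### Leibniz rule and the Hessian of the squared norm. -/

section Leibniz

variable {n a b : ℕ} {M : Type*} [TopologicalSpace M] [ChartedSpace (Model n) M]
  [IsManifold (𝓡 n) ∞ M] (g : Metric n M)

theorem ContDiffOn.tensor_apply {X : Type*} [NormedAddCommGroup X] [NormedSpace ℝ X]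
    {S : X → TensorSpace (Model n) a b} {s : Set X} (hS : ContDiffOn ℝ ∞ S s)
    (v : Fin b → Model n) (α : Fin a → (Model n →L[ℝ] ℝ)) :
    ContDiffOn ℝ ∞ (fun z => S z v α) s := by
  have h := (ContinuousMultilinearMap.apply ℝ _ _ v).contDiff.comp_contDiffOn hS
  exact (ContinuousMultilinearMap.apply ℝ _ _ α).contDiff.comp_contDiffOn h

theorem contDiffOn_ipT {c : M} {S R : Model n → TensorSpace (Model n) a b}
    (hS : ContDiffOn ℝ ∞ S (extChartAt (𝓡 n) c).target)
    (hR : ContDiffOn ℝ ∞ R (extChartAt (𝓡 n) c).target) :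
    ContDiffOn ℝ ∞ (fun y => ipT (localMetric g c y) (S y) (R y))
      (extChartAt (𝓡 n) c).target := by
  have hG : ∀ i j, ContDiffOn ℝ ∞ (fun y => bgram (localMetric g c y) i j)
      (extChartAt (𝓡 n) c).target := fun i j =>
    ((contDiffOn_localMetric g c).clm_apply contDiffOn_const).clm_apply contDiffOn_const
  refine ContDiffOn.sum fun J _ => ContDiffOn.sum fun J' _ => ContDiffOn.sum fun I _ =>
    ContDiffOn.sum fun I' _ => ?_
  exact (((contDiffOn_prod fun s _ => contDiffOn_bgram_inv g c (J s) (J' s)).mul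
    (contDiffOn_prod fun s _ => hG (I s) (I' s))).mul (ContDiffOn.tensor_apply hS _ _)).mul
      (ContDiffOn.tensor_apply hR _ _)

theorem hasDerivAt_ipT_localMetric {c : M} {y : Model n}
    (hy : y ∈ (extChartAt (𝓡 n) c).target) (u : Model n)
    {S R : Model n → TensorSpace (Model n) a b} {X Y : TensorSpace (Model n) a b}
    (hS : DifferentiableAt ℝ S y) (hR : DifferentiableAt ℝ R y)
    (hX : ∀ v α, X v α = fderiv ℝ S y u v α + endoVal (christoffel g c y u) (S y) v α)
    (hY : ∀ v α, Y v α = fderiv ℝ R y u v α + endoVal (christoffel g c y u) (R y) v α) :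
    HasDerivAt (fun t : ℝ => ipT (localMetric g c (y + t • u)) (S (y + t • u)) (R (y + t • u)))
      (ipT (localMetric g c y) X (R y) + ipT (localMetric g c y) (S y) Y) 0 := by
  have h := hasDerivAt_ipT (G := fun t : ℝ => localMetric g c (y + t • u))
    (S := fun t : ℝ => S (y + t • u)) (R := fun t : ℝ => R (y + t • u)) (X := X) (Y := Y)
    (E := christoffel g c y u)
    ((eventually_line ((isOpen_target c).mem_nhds hy) u).mono
      fun t ht => exists_isFrame_localMetric g ht)
    (hasDerivAt_comp_line (differentiableAt_localMetric g hy) u)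
    (by simpa using fderiv_localMetric g hy u)
    (hasDerivAt_comp_line hS u) (hasDerivAt_comp_line hR u)
    (by simpa using hX) (by simpa using hY)
  simpa using h

/-- The squared norm of a tensor field in a chart. -/
def localSq (T : TensorField n M a b) (c : M) (y : Model n) : ℝ :=
  ipT (localMetric g c y) (localTensor T c y) (localTensor T c y)

theorem contDiffOn_localSq {T : TensorField n M a b} (hT : IsSmooth T) (c : M) :
    ContDiffOn ℝ ∞ (localSq g T c) (extChartAt (𝓡 n) c).target :=
  contDiffOn_ipT g (hT c) (hT c)

omit [IsManifold (𝓡 n) ∞ M] in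
theorem ContDiffOn.differentiableAt_of_target {W : Type*} [NormedAddCommGroup W] [NormedSpace ℝ W]
    {f : Model n → W} {c : M} (hf : ContDiffOn ℝ ∞ f (extChartAt (𝓡 n) c).target) {y : Model n}
    (hy : y ∈ (extChartAt (𝓡 n) c).target) : DifferentiableAt ℝ f y :=
  (hf.contDiffAt ((isOpen_target c).mem_nhds hy)).differentiableAt (by simp)

theorem fderiv_localSq {T : TensorField n M a b} (hT : IsSmooth T) {c : M} {y : Model n}
    (hy : y ∈ (extChartAt (𝓡 n) c).target) (u : Model n) :
    fderiv ℝ (localSq g T c) y u =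
      2 * ipT (localMetric g c y) (localTensor T c y) (localD g T c y u) := by
  have h1 := hasDerivAt_comp_line
    (ContDiffOn.differentiableAt_of_target (contDiffOn_localSq g hT c) hy) u
  have h2 := hasDerivAt_ipT_localMetric g hy u (hT.differentiableAt hy) (hT.differentiableAt hy)
    (X := localD g T c y u) (Y := localD g T c y u) (localD_apply g T c y u)
    (localD_apply g T c y u)
  obtain ⟨L, L', hL⟩ := exists_isFrame_localMetric g hy
  rw [h1.unique h2, hL.ipT_comm]
  ring

/-- The second covariant derivative in a chart. -/
def localD2 (T : TensorField n M a b) (c : M) (y u v : Model n) : TensorSpace (Model n) a b :=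
  (localD g (nabla g T) c y u).curryLeft v

theorem endoVal_uncurryLeft (E : Model n →L[ℝ] Model n)
    (X : Model n →L[ℝ] TensorSpace (Model n) a b) (v : Model n) (w : Fin b → Model n)
    (α : Fin a → (Model n →L[ℝ] ℝ)) :
    endoVal E (X.uncurryLeft : TensorSpace (Model n) a (b + 1)) (Fin.cons v w) α =
      endoVal E (X v) w α - X (E v) w α := by
  simp only [endoVal, Fin.sum_univ_succ, ContinuousLinearMap.uncurryLeft_apply, Fin.cons_zero,
    Fin.update_cons_zero, Fin.cons_succ, ← Fin.cons_update, Fin.tail_cons]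
  ring

/-- For a constant coordinate vector `v`, the derivative `∇_u (∇_v T)` exceeds `(∇²T)(u, v)` by the
derivative of `T` along `∇_u v = Γ(u, v)`, because `∇` also acts on the first slot of `∇T`. -/
theorem localD2_apply {T : TensorField n M a b} (hT : IsSmooth T) {c : M} {y : Model n}
    (hy : y ∈ (extChartAt (𝓡 n) c).target) (u v : Model n) (w : Fin b → Model n)
    (α : Fin a → (Model n →L[ℝ] ℝ)) :
    localD2 g T c y u v w α + localD g T c y (christoffel g c y u v) w α =
      fderiv ℝ (fun z => localD g T c z v) y u w α
        + endoVal (christoffel g c y u) (localD g T c y v) w α := by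
  have h1 : localD2 g T c y u v w α = localD g (nabla g T) c y u (Fin.cons v w) α := rfl
  rw [h1, localD_apply, localTensor_nabla g hT hy, localNabla_eq, endoVal_uncurryLeft]
  have hd : DifferentiableAt ℝ (fun z => localD g T c z v) y :=
    (ContDiffOn.differentiableAt_of_target (contDiffOn_localD g hT c) hy).clm_apply
      (differentiableAt_const v)
  have h2 := hasDerivAt_comp_line ((hT.nabla g).differentiableAt hy) u
  have h3 := hasDerivAt_comp_line hd u
  have e1 := (ContinuousMultilinearMap.apply ℝ _ _ α).hasFDerivAt.comp_hasDerivAt (0 : ℝ)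
    ((ContinuousMultilinearMap.apply ℝ _ _
      (Fin.cons v w : Fin (b + 1) → Model n)).hasFDerivAt.comp_hasDerivAt (0 : ℝ) h2)
  have e2 := (ContinuousMultilinearMap.apply ℝ _ _ α).hasFDerivAt.comp_hasDerivAt (0 : ℝ)
    ((ContinuousMultilinearMap.apply ℝ _ _ w).hasFDerivAt.comp_hasDerivAt (0 : ℝ) h3)
  have h4 := e1.unique (e2.congr_of_eventuallyEq (by
    filter_upwards [eventually_line ((isOpen_target c).mem_nhds hy) u] with t ht
    have := localTensor_nabla g hT ht
    simp only [Function.comp_apply, ContinuousMultilinearMap.apply_apply, this]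
    rfl))
  simp only [ContinuousMultilinearMap.apply_apply] at h4
  rw [h4]
  ring

/-- The Hessian of the squared norm of a tensor field. -/
theorem hessian_localSq {T : TensorField n M a b} (hT : IsSmooth T) {c : M} {y : Model n}
    (hy : y ∈ (extChartAt (𝓡 n) c).target) (u v : Model n) :
    fderiv ℝ (fun z => fderiv ℝ (localSq g T c) z v) y u
        - fderiv ℝ (localSq g T c) y (christoffel g c y u v) =
      2 * (ipT (localMetric g c y) (localD g T c y u) (localD g T c y v)
        + ipT (localMetric g c y) (localTensor T c y) (localD2 g T c y u v)) := by
  have hd : ContDiffOn ℝ ∞ (fun z => localD g T c z v) (extChartAt (𝓡 n) c).target :=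
    (contDiffOn_localD g hT c).clm_apply contDiffOn_const
  have h1 := hasDerivAt_ipT_localMetric g hy u (hT.differentiableAt hy)
    (ContDiffOn.differentiableAt_of_target hd hy)
    (X := localD g T c y u)
    (Y := localD2 g T c y u v + localD g T c y (christoffel g c y u v)) (localD_apply g T c y u)
    (localD2_apply g hT hy u v)
  have h0 : ContDiffOn ℝ ∞ (fun z => fderiv ℝ (localSq g T c) z v) (extChartAt (𝓡 n) c).target :=
    ((contDiffOn_localSq g hT c).fderiv_of_isOpen (isOpen_target c) (by simp)).clm_apply
      contDiffOn_const
  have h2 := hasDerivAt_comp_line (ContDiffOn.differentiableAt_of_target h0 hy) u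
  have h3 := h2.unique ((h1.const_mul 2).congr_of_eventuallyEq (by
    filter_upwards [eventually_line ((isOpen_target c).mem_nhds hy) u] with t ht
    exact fderiv_localSq g hT ht v))
  have h4 : ∀ B : Model n →L[ℝ] Model n →L[ℝ] ℝ, ∀ S R R' : TensorSpace (Model n) a b,
      ipT B S (R + R') = ipT B S R + ipT B S R' := by
    intro B S R R'
    simp only [ipT, _root_.add_apply, mul_add, Finset.sum_add_distrib]
  rw [h3, fderiv_localSq g hT hy, h4]
  ring

end Leibniz

/-! ### Covector fields and their divergence. -/

section Covectors

variable {n : ℕ}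

theorem update_zero_fin_one (v : Model n) :
    Function.update (fun _ : Fin 1 => (0 : Model n)) 0 v = fun _ => v := by
  funext i
  rw [Subsingleton.elim i 0, Function.update_self]

/-- The covector given by a tensor of type `(0, 1)`. -/
def cov : TensorSpace (Model n) 0 1 →L[ℝ] Model n →L[ℝ] ℝ :=
  LinearMap.toContinuousLinearMap
    { toFun := fun θ => LinearMap.toContinuousLinearMap
        { toFun := fun v => θ (fun _ => v) 0
          map_add' := fun v w => by
            have := congrArg (fun S => S 0) (θ.map_update_add (fun _ => 0) 0 v w)
            simpa only [update_zero_fin_one, _root_.add_apply] using this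
          map_smul' := fun r v => by
            have := congrArg (fun S => S 0) (θ.map_update_smul (fun _ => 0) 0 r v)
            simpa only [update_zero_fin_one, _root_.smul_apply, RingHom.id_apply] using this }
      map_add' := fun θ θ' => by ext v; rfl
      map_smul' := fun r θ => by ext v; rfl }

theorem cov_apply (θ : TensorSpace (Model n) 0 1) (v : Model n) : cov θ v = θ (fun _ => v) 0 := rfl

theorem cov_endoVal (E : Model n →L[ℝ] Model n) (θ : TensorSpace (Model n) 0 1) (v : Model n) :
    endoVal E θ (fun _ => v) 0 = - cov θ (E v) := by
  simp only [endoVal, Finset.univ_eq_empty, Finset.sum_empty, Fin.sum_univ_one, cov_apply,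
    zero_sub, neg_inj]
  congr 2
  funext i
  simp [Subsingleton.elim i 0]

variable {M : Type*} [TopologicalSpace M] [ChartedSpace (Model n) M]
  [IsManifold (𝓡 n) ∞ M] (g : Metric n M)

theorem cov_localD {θ : TensorField n M 0 1} (hθ : IsSmooth θ) {c : M} {y : Model n}
    (hy : y ∈ (extChartAt (𝓡 n) c).target) (u v : Model n) :
    cov (localD g θ c y u) v = fderiv ℝ (fun z => cov (localTensor θ c z)) y u v
      - cov (localTensor θ c y) (christoffel g c y u v) := by
  rw [cov_apply, localD_apply, cov_endoVal, ← sub_eq_add_neg]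
  congr 1
  have h := fderiv_comp y cov.differentiableAt (hθ.differentiableAt hy)
  have h2 := congrArg (fun f => f u v) h
  simp only [ContinuousLinearMap.comp_apply, ContinuousLinearMap.fderiv] at h2
  exact h2.symm

/-- The divergence of a covector field in a chart. -/
def localDiv (θ : TensorField n M 0 1) (c : M) (y : Model n) : ℝ :=
  trB (localMetric g c y) fun i j => cov (localD g θ c y (stdVec i)) (stdVec j)

theorem localDiv_eq (θ : TensorField n M 0 1) {c : M} {y : Model n}
    {L L' : Model n →L[ℝ] Model n} (hL : IsFrame (localMetric g c y) L L') :
    localDiv g θ c y = ∑ k, cov (localD g θ c y (L (stdVec k))) (L (stdVec k)) :=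
  hL.trB_eq (cov ∘L localD g θ c y)

/-- The divergence of a covector field. -/
def divg (θ : TensorField n M 0 1) (x : M) : ℝ := localDiv g θ x (extChartAt (𝓡 n) x x)

/-- In a frame the trace is a sum over orthonormal vectors, and a coordinate change carries frames
to frames, so the trace is the same in both charts. -/
theorem divg_eq {θ : TensorField n M 0 1} (hθ : IsSmooth θ) {c x : M}
    (hx : x ∈ (extChartAt (𝓡 n) c).source) :
    divg g θ x = localDiv g θ c (extChartAt (𝓡 n) c x) := by
  have hov : extChartAt (𝓡 n) c x ∈ overlap c x :=
    ⟨(extChartAt (𝓡 n) c).map_source hx, by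
      rw [(extChartAt (𝓡 n) c).left_inv hx]; exact mem_extChartAt_source x⟩
  have hτ : coordChange c x (extChartAt (𝓡 n) c x) = extChartAt (𝓡 n) x x := by
    rw [coordChange, (extChartAt (𝓡 n) c).left_inv hx]
  obtain ⟨L, L', hL⟩ := exists_isFrame_localMetric g (coordChange_mem hov).1
  have hL2 := hL.comp (fderiv_coordChange_left hov) (fderiv_coordChange_right hov)
    (localMetric_coordChange g hov)
  rw [divg, ← hτ, localDiv_eq g θ hL, localDiv_eq g θ hL2]
  refine Finset.sum_congr rfl fun k _ => ?_
  rw [localD_coordChange g hθ hov, cov_apply, cov_apply, transport_apply]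
  simp only [ContinuousLinearMap.comp_apply, fderiv_coordChange_right hov]
  congr 1

/-- Index bookkeeping for `sum_fderiv_eq_localDiv`, with `Γ i j k` the `k`-th component of `Γ(e_i,
e_j)`. Differentiating `√det g` produces the trace of `Γ`, and differentiating `g^{ij}` produces two
contractions. Symmetry of `Γ` makes the trace cancel one contraction; the other is the connection
term of the divergence. -/
theorem sum_divergence_aux {ι : Type*} [Fintype ι] (Γ : ι → ι → ι → ℝ)
    (hΓ : ∀ i j k, Γ i j k = Γ j i k) (N : ι → ι → ℝ) (q : ι → ℝ) (D : ι → ι → ℝ) (d : ℝ) :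
    ∑ i, (d * (∑ k, Γ i k k) * ∑ j, N i j * q j +
      d * ∑ j, (- (∑ k, (Γ i k i * N k j + N i k * Γ i k j)) * q j + N i j * D i j)) =
    d * ∑ i, ∑ j, N i j * (D i j - ∑ k, Γ i j k * q k) := by
  have e1 : ∑ i, (∑ k, Γ i k k) * ∑ j, N i j * q j =
      ∑ i, ∑ j, ∑ k, Γ i k i * N k j * q j := by
    simp only [Finset.sum_mul_sum]
    rw [Finset.sum_comm]
    refine Finset.sum_congr rfl fun k _ => ?_
    rw [Finset.sum_comm]
    refine Finset.sum_congr rfl fun j _ => Finset.sum_congr rfl fun i _ => ?_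
    rw [hΓ i k k]
    ring
  have e2 : ∑ i, ∑ j, ∑ k, N i k * Γ i k j * q j =
      ∑ i, ∑ j, N i j * ∑ k, Γ i j k * q k := by
    refine Finset.sum_congr rfl fun i _ => ?_
    rw [Finset.sum_comm]
    simp only [Finset.mul_sum, mul_assoc]
  have e3 : ∀ i, d * (∑ k, Γ i k k) * ∑ j, N i j * q j +
      d * ∑ j, (- (∑ k, (Γ i k i * N k j + N i k * Γ i k j)) * q j + N i j * D i j) =
      d * ((∑ k, Γ i k k) * ∑ j, N i j * q j) - d * ∑ j, ∑ k, Γ i k i * N k j * q j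
        - d * ∑ j, ∑ k, N i k * Γ i k j * q j + d * ∑ j, N i j * D i j := by
    intro i
    have e4 : ∀ j, - (∑ k, (Γ i k i * N k j + N i k * Γ i k j)) * q j + N i j * D i j =
        - (∑ k, Γ i k i * N k j * q j) + - (∑ k, N i k * Γ i k j * q j) + N i j * D i j := by
      intro j
      rw [Finset.sum_add_distrib, ← Finset.sum_mul, ← Finset.sum_mul]
      ring
    rw [Finset.sum_congr rfl fun j _ => e4 j, Finset.sum_add_distrib, Finset.sum_add_distrib,
      Finset.sum_neg_distrib, Finset.sum_neg_distrib]
    ring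
  rw [Finset.sum_congr rfl fun i _ => e3 i, Finset.sum_add_distrib, Finset.sum_sub_distrib,
    Finset.sum_sub_distrib, ← Finset.mul_sum, ← Finset.mul_sum, ← Finset.mul_sum,
    ← Finset.mul_sum, e1, e2]
  simp only [mul_sub, Finset.sum_sub_distrib]
  ring

/-- The divergence in coordinates: `∂_i (√det g g^{ij} θ_j) = √det g div θ`. -/
theorem sum_fderiv_eq_localDiv {θ : TensorField n M 0 1} (hθ : IsSmooth θ) {c : M} {y : Model n}
    (hy : y ∈ (extChartAt (𝓡 n) c).target) :
    ∑ i, fderiv ℝ (fun z => √(bgram (localMetric g c z)).det *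
      ∑ j, (bgram (localMetric g c z))⁻¹ i j * cov (localTensor θ c z) (stdVec j)) y (stdVec i) =
    √(bgram (localMetric g c y)).det * localDiv g θ c y := by
  obtain ⟨L, L', hL⟩ := exists_isFrame_localMetric g hy
  have hG := differentiableAt_localMetric g hy
  have hθc : DifferentiableAt ℝ (fun z => cov (localTensor θ c z)) y :=
    cov.differentiableAt.comp y (hθ.differentiableAt hy)
  set N := (bgram (localMetric g c y))⁻¹ with hN
  set d := √(bgram (localMetric g c y)).det with hd
  set Γ := christoffel g c y with hΓ
  have hdpos : 0 < (bgram (localMetric g c y)).det := hL.det_pos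
  have key : ∀ i, fderiv ℝ (fun z => √(bgram (localMetric g c z)).det *
      ∑ j, (bgram (localMetric g c z))⁻¹ i j * cov (localTensor θ c z) (stdVec j)) y (stdVec i) =
      d * (∑ k, Γ (stdVec i) (stdVec k) k) * ∑ j, N i j * cov (localTensor θ c y) (stdVec j) +
      d * ∑ j, (- (∑ k, (Γ (stdVec i) (stdVec k) i * N k j + N i k * Γ (stdVec i) (stdVec k) j)) *
          cov (localTensor θ c y) (stdVec j) +
        N i j * fderiv ℝ (fun z => cov (localTensor θ c z)) y (stdVec i) (stdVec j)) := by
    intro i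
    have hGl := hasDerivAt_comp_line hG (stdVec i)
    have hG0 : localMetric g c (y + (0 : ℝ) • stdVec i) = localMetric g c y := by simp
    have hdet := hasDerivAt_det_bgram (G := fun t : ℝ => localMetric g c (y + t • stdVec i))
      (E := Γ (stdVec i)) (by simpa using hL) hGl
      (by simpa using fderiv_localMetric g hy (stdVec i))
    have hinv := hasDerivAt_bgram_inv (G := fun t : ℝ => localMetric g c (y + t • stdVec i))
      (E := Γ (stdVec i)) ((eventually_line ((isOpen_target c).mem_nhds hy) (stdVec i)).mono
      fun t ht => exists_isFrame_localMetric g ht) hGl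
      (by simpa using fderiv_localMetric g hy (stdVec i))
    have hθl := fun j => (hasDerivAt_comp_line hθc (stdVec i)).clm_apply
      (hasDerivAt_const (0 : ℝ) (stdVec j))
    have hsq := hdet.sqrt (by simpa using hdpos.ne')
    have htot := hsq.mul (HasDerivAt.fun_sum (u := Finset.univ) fun j _ =>
      (hinv i j).mul (hθl j))
    have hdiff : DifferentiableAt ℝ (fun z => √(bgram (localMetric g c z)).det *
      ∑ j, (bgram (localMetric g c z))⁻¹ i j * cov (localTensor θ c z) (stdVec j)) y := by
      refine DifferentiableAt.mul ?_ (DifferentiableAt.fun_sum fun j _ => DifferentiableAt.mul ?_ ?_)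
      · exact (ContDiffOn.differentiableAt_of_target (contDiffOn_bgram_det g c) hy).sqrt hdpos.ne'
      · exact ContDiffOn.differentiableAt_of_target (contDiffOn_bgram_inv g c i j) hy
      · exact hθc.clm_apply (differentiableAt_const _)
    have h1 := (hasDerivAt_comp_line hdiff (stdVec i)).unique htot
    rw [h1]
    have h2 : (2 * (bgram (localMetric g c y)).det * ∑ k, Γ (stdVec i) (stdVec k) k) / (2 * d) =
        d * ∑ k, Γ (stdVec i) (stdVec k) k := by
      have h3 : (bgram (localMetric g c y)).det = d * d := (Real.mul_self_sqrt hdpos.le).symm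
      have h4 : d ≠ 0 := (Real.sqrt_pos.2 hdpos).ne'
      rw [h3]
      field_simp
    simp only [zero_smul, add_zero, Pi.mul_apply, map_zero]
    rw [← hN, ← hd, h2]
  simp only [key]
  have hdiv : localDiv g θ c y = ∑ i, ∑ j, N i j *
      (fderiv ℝ (fun z => cov (localTensor θ c z)) y (stdVec i) (stdVec j)
        - cov (localTensor θ c y) (Γ (stdVec i) (stdVec j))) := by
    simp only [localDiv, trB, cov_localD g hθ hy]
    rfl
  rw [hdiv]
  have hθΓ : ∀ i j, cov (localTensor θ c y) (Γ (stdVec i) (stdVec j)) =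
      ∑ k, Γ (stdVec i) (stdVec j) k * cov (localTensor θ c y) (stdVec k) := fun i j => by
    conv_lhs => rw [← sum_stdVec (Γ (stdVec i) (stdVec j))]
    simp
  simp only [hθΓ]
  exact sum_divergence_aux (fun i j k => Γ (stdVec i) (stdVec j) k)
    (fun i j k => congrArg (fun v : Model n => v k) (christoffel_symm g hy _ _)) N
    (fun j => cov (localTensor θ c y) (stdVec j)) _ d

end Covectors

/-! ### Functions as tensor fields and the divergence of `F df`. -/

section ScalarFields

variable {n a b : ℕ} {M : Type*} [TopologicalSpace M] [ChartedSpace (Model n) M]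

/-- A function on `M` is smooth if it is smooth in every chart. -/
def IsSmoothFun (n : ℕ) {M : Type*} [TopologicalSpace M] [ChartedSpace (Model n) M]
    (f : M → ℝ) : Prop :=
  ∀ c : M, ContDiffOn ℝ ∞ (fun y => f ((extChartAt (𝓡 n) c).symm y)) (extChartAt (𝓡 n) c).target

/-- A real number as a tensor of type `(0, 0)`. -/
def scalarTensor (V : Type*) [AddCommGroup V] [Module ℝ V] [TopologicalSpace V]
    [IsTopologicalAddGroup V] [ContinuousSMul ℝ V] (r : ℝ) : TensorSpace V 0 0 :=
  ContinuousMultilinearMap.constOfIsEmpty ℝ _ (ContinuousMultilinearMap.constOfIsEmpty ℝ _ r)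

theorem contDiff_scalarTensor : ContDiff ℝ ∞ (scalarTensor (Model n)) := by
  let S : ℝ →L[ℝ] TensorSpace (Model n) 0 0 := LinearMap.toContinuousLinearMap
    { toFun := scalarTensor (Model n)
      map_add' := fun r s => by ext; rfl
      map_smul' := fun r s => by ext; rfl }
  exact S.contDiff

/-- The number given by a tensor of type `(0, 0)`. -/
def scalarTensorValue : TensorSpace (Model n) 0 0 →L[ℝ] ℝ :=
  (ContinuousMultilinearMap.apply ℝ (fun _ : Fin 0 => Model n →L[ℝ] ℝ) ℝ 0) ∘L
    (ContinuousMultilinearMap.apply ℝ (fun _ : Fin 0 => Model n)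
      ((Model n →L[ℝ] ℝ) [×0]→L[ℝ] ℝ) 0)

/-- A function as a tensor field of type `(0, 0)`. -/
def scalarField (n : ℕ) {M : Type*} [TopologicalSpace M] [ChartedSpace (Model n) M] (f : M → ℝ) :
    TensorField n M 0 0 := fun x => scalarTensor (TangentSpace (𝓡 n) x) (f x)

theorem IsSmoothFun.scalarField {f : M → ℝ} (hf : IsSmoothFun n f) :
    IsSmooth (scalarField n f) := fun c => contDiff_scalarTensor.comp_contDiffOn (hf c)

variable [IsManifold (𝓡 n) ∞ M] (g : Metric n M)

/-- The covector field `F df`. -/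
def mulDiff (F f : M → ℝ) : TensorField n M 0 1 := fun x => F x • nabla g (scalarField n f) x

theorem localTensor_mulDiff (F f : M → ℝ) (c : M) (y : Model n) :
    localTensor (mulDiff g F f) c y =
      F ((extChartAt (𝓡 n) c).symm y) • localTensor (nabla g (scalarField n f)) c y := rfl

theorem IsSmoothFun.mulDiff {F f : M → ℝ} (hF : IsSmoothFun n F) (hf : IsSmoothFun n f) :
    IsSmooth (mulDiff g F f) :=
  fun c => by
    have h := (hF c).smul (contDiffOn_localNabla g hf.scalarField c)
    refine h.congr fun y hy => ?_
    rw [localTensor_mulDiff, localTensor_nabla g hf.scalarField hy]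
    rfl

theorem cov_localTensor_mulDiff {F f : M → ℝ} (hf : IsSmoothFun n f)
    {c : M} {y : Model n} (hy : y ∈ (extChartAt (𝓡 n) c).target) :
    cov (localTensor (mulDiff g F f) c y) = F ((extChartAt (𝓡 n) c).symm y) •
      fderiv ℝ (fun z => f ((extChartAt (𝓡 n) c).symm z)) y := by
  rw [localTensor_mulDiff]
  refine Eq.trans (cov.map_smul _ _) ?_
  congr 1
  rw [localTensor_nabla g hf.scalarField hy]
  ext v
  have h1 : cov (localNabla g (scalarField n f) c y) v =
      localD g (scalarField n f) c y v 0 0 := by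
    rw [cov_apply, localNabla_eq]
    exact congrArg (fun z => localD g (RiemTensor.scalarField n f) c y v z 0)
      (Subsingleton.elim (Fin.tail fun _ => v) 0)
  rw [h1, localD_apply]
  have h2 := hasDerivAt_comp_line (hf.scalarField.differentiableAt hy) v
  have hfd : DifferentiableAt ℝ (fun z => f ((extChartAt (𝓡 n) c).symm z)) y :=
    ContDiffOn.differentiableAt_of_target (hf c) hy
  have h3 := hasDerivAt_comp_line hfd v
  have h4 := HasFDerivAt.comp_hasDerivAt (0 : ℝ)
    (ContinuousLinearMap.hasFDerivAt (scalarTensorValue (n := n))) h2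
  have h6 : fderiv ℝ (localTensor (RiemTensor.scalarField n f) c) y v 0 0 =
      fderiv ℝ (fun z => f ((extChartAt (𝓡 n) c).symm z)) y v := h4.unique h3
  rw [h6]
  simp [endoVal]

/-- This is `div (F df) = ⟨dF, df⟩ + F Δf`. The vectors `L (stdVec k)` are constant in the chart and
orthonormal only at `x`, so the Hessian carries a Christoffel correction. -/
theorem divg_mulDiff {F f : M → ℝ} (hF : IsSmoothFun n F) (hf : IsSmoothFun n f)
    {c x : M} (hx : x ∈ (extChartAt (𝓡 n) c).source) {L L' : Model n →L[ℝ] Model n}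
    (hL : IsFrame (localMetric g c (extChartAt (𝓡 n) c x)) L L') :
    let y := extChartAt (𝓡 n) c x
    let F' := fun z => F ((extChartAt (𝓡 n) c).symm z)
    let f' := fun z => f ((extChartAt (𝓡 n) c).symm z)
    divg g (mulDiff g F f) x = ∑ k, (fderiv ℝ F' y (L (stdVec k)) * fderiv ℝ f' y (L (stdVec k))
      + F x * (fderiv ℝ (fun z => fderiv ℝ f' z (L (stdVec k))) y (L (stdVec k))
        - fderiv ℝ f' y (christoffel g c y (L (stdVec k)) (L (stdVec k))))) := by
  intro y F' f'
  have hy : y ∈ (extChartAt (𝓡 n) c).target := (extChartAt (𝓡 n) c).map_source hx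
  have hθ : IsSmooth (mulDiff g F f) := hF.mulDiff g hf
  have hFx : F x = F' y := by simp only [F', y, (extChartAt (𝓡 n) c).left_inv hx]
  rw [divg_eq g hθ hx, localDiv_eq g _ hL, hFx]
  refine Finset.sum_congr rfl fun k _ => ?_
  set w := L (stdVec k)
  rw [cov_localD g hθ hy, cov_localTensor_mulDiff g hf hy]
  have hev : (fun z => cov (localTensor (mulDiff g F f) c z)) =ᶠ[nhds y]
      fun z => F' z • fderiv ℝ f' z := by
    filter_upwards [(isOpen_target c).mem_nhds hy] with z hz
    exact cov_localTensor_mulDiff g hf hz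
  have hF1 : DifferentiableAt ℝ F' y := ContDiffOn.differentiableAt_of_target (hF c) hy
  have hf1 : DifferentiableAt ℝ (fderiv ℝ f') y := ContDiffOn.differentiableAt_of_target
    ((hf c).fderiv_of_isOpen (isOpen_target c) (by simp)) hy
  have h1 := (hasDerivAt_comp_line hF1 w).smul (hasDerivAt_comp_line hf1 w)
  have h2 := hasDerivAt_comp_line (hF1.smul hf1) w
  have h3 := h2.unique h1
  have h4 := (hasDerivAt_comp_line hf1 w).clm_apply (hasDerivAt_const (0 : ℝ) w)
  have h5 := hasDerivAt_comp_line (hf1.clm_apply (differentiableAt_const w)) w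
  have h6 := h5.unique h4
  rw [hev.fderiv_eq]
  have h7 : fderiv ℝ (fun z => F' z • fderiv ℝ f' z) y w =
      fderiv ℝ (F' • fderiv ℝ f') y w := rfl
  rw [h6, h7, h3]
  simp only [zero_smul, add_zero, map_zero, _root_.add_apply, _root_.smul_apply, smul_eq_mul]
  ring

end ScalarFields

/-! ### Pointwise bounds for the divergence of the weighted field. -/

section Pointwise

variable {n a b : ℕ} {M : Type*} [TopologicalSpace M] [ChartedSpace (Model n) M]
  [IsManifold (𝓡 n) ∞ M] (g : Metric n M)

theorem tensorNorm_nonneg (T : TensorField n M a b) (x : M) : 0 ≤ tensorNorm g T x :=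
  Real.sqrt_nonneg _

theorem tensorNorm_sq (T : TensorField n M a b) {c x : M}
    (hx : x ∈ (extChartAt (𝓡 n) c).source) :
    tensorNorm g T x ^ 2 = localSq g T c (extChartAt (𝓡 n) c x) := by
  obtain ⟨L, L', hL⟩ := exists_isFrame_localMetric g ((extChartAt (𝓡 n) c).map_source hx)
  rw [tensorNorm_eq g T hx, Real.sq_sqrt (hL.ipT_self_nonneg _)]
  rfl

theorem tensorNorm_symm_sq (T : TensorField n M a b) {c : M} {y : Model n}
    (hy : y ∈ (extChartAt (𝓡 n) c).target) :
    tensorNorm g T ((extChartAt (𝓡 n) c).symm y) ^ 2 = localSq g T c y := by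
  rw [tensorNorm_sq g T ((extChartAt (𝓡 n) c).map_target hy), (extChartAt (𝓡 n) c).right_inv hy]

theorem IsSmooth.tensorNorm_sq {T : TensorField n M a b} (hT : IsSmooth T) :
    IsSmoothFun n fun x => tensorNorm g T x ^ 2 := fun c =>
  (contDiffOn_localSq g hT c).congr fun _ hy => tensorNorm_symm_sq g T hy

/-- The weight `κ (δ + |T|²)^s + |∇T|²`. -/
def weight (κ δ s : ℝ) (T : TensorField n M a b) (x : M) : ℝ :=
  κ * (δ + tensorNorm g T x ^ 2) ^ s + tensorNorm g (nabla g T) x ^ 2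

variable {κ δ s : ℝ}

theorem weight_pos (hκ : 0 < κ) (hδ : 0 < δ) (T : TensorField n M a b) (x : M) :
    0 < weight g κ δ s T x := by
  unfold weight
  positivity

theorem isSmoothFun_weight (hδ : 0 < δ) {T : TensorField n M a b}
    (hT : IsSmooth T) : IsSmoothFun n (weight g κ δ s T) := fun c => by
  refine ContDiffOn.add (contDiffOn_const.mul (ContDiffOn.rpow_const_of_ne
    (contDiffOn_const.add (hT.tensorNorm_sq g c)) fun y _ => ?_)) ((hT.nabla g).tensorNorm_sq g c)
  positivity

theorem isSmoothFun_weight_rpow (hκ : 0 < κ) (hδ : 0 < δ) {T : TensorField n M a b}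
    (hT : IsSmooth T) (p : ℝ) : IsSmoothFun n fun x => weight g κ δ s T x ^ p := fun c =>
  (isSmoothFun_weight g hδ hT c).rpow_const_of_ne fun _ _ => (weight_pos g hκ hδ T _).ne'

theorem fderiv_rpow_add {E : Type*} [NormedAddCommGroup E] [NormedSpace ℝ E] {f f₁ : E → ℝ}
    {y : E} (hf : DifferentiableAt ℝ f y) (hf₁ : DifferentiableAt ℝ f₁ y) (h0 : δ + f y ≠ 0)
    (h1 : κ * (δ + f y) ^ s + f₁ y ≠ 0) (p : ℝ) (w : E) :
    fderiv ℝ (fun z => (κ * (δ + f z) ^ s + f₁ z) ^ p) y w =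
      p * (κ * (δ + f y) ^ s + f₁ y) ^ (p - 1) *
        (κ * s * (δ + f y) ^ (s - 1) * fderiv ℝ f y w + fderiv ℝ f₁ y w) := by
  have d1 := (hf.hasFDerivAt.const_add δ).rpow_const (p := s) (Or.inl h0)
  have d2 := ((d1.const_mul κ).add hf₁.hasFDerivAt).rpow_const (p := p) (Or.inl h1)
  have d3 : HasFDerivAt (fun z => (κ * (δ + f z) ^ s + f₁ z) ^ p) _ y := d2
  rw [d3.fderiv]
  simp
  ring

theorem fderiv_weight_rpow (hκ : 0 < κ) (hδ : 0 < δ) {T : TensorField n M a b}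
    (hT : IsSmooth T) (p : ℝ) {c : M} {y : Model n}
    (hy : y ∈ (extChartAt (𝓡 n) c).target) (w : Model n) :
    fderiv ℝ (fun z => weight g κ δ s T ((extChartAt (𝓡 n) c).symm z) ^ p) y w =
      p * weight g κ δ s T ((extChartAt (𝓡 n) c).symm y) ^ (p - 1) *
        (κ * s * (δ + tensorNorm g T ((extChartAt (𝓡 n) c).symm y) ^ 2) ^ (s - 1) *
          fderiv ℝ (localSq g T c) y w + fderiv ℝ (localSq g (nabla g T) c) y w) := by
  have h1 : (fun z => weight g κ δ s T ((extChartAt (𝓡 n) c).symm z) ^ p) =ᶠ[nhds y]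
      fun z => (κ * (δ + localSq g T c z) ^ s + localSq g (nabla g T) c z) ^ p := by
    filter_upwards [(isOpen_target c).mem_nhds hy] with z hz
    rw [weight, tensorNorm_symm_sq g _ hz, tensorNorm_symm_sq g _ hz]
  have hsq := tensorNorm_symm_sq g T hy
  have hsq1 := tensorNorm_symm_sq g (nabla g T) hy
  have hA := weight_pos g hκ hδ T ((extChartAt (𝓡 n) c).symm y) (s := s)
  rw [weight, hsq, hsq1] at hA
  rw [h1.fderiv_eq, fderiv_rpow_add
    (ContDiffOn.differentiableAt_of_target (contDiffOn_localSq g hT c) hy)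
    (ContDiffOn.differentiableAt_of_target (contDiffOn_localSq g (hT.nabla g) c) hy)
    (by rw [← hsq]; positivity) hA.ne', weight, hsq, hsq1]

theorem divg_mulDiff_weight_eq (hκ : 0 < κ) (hδ : 0 < δ) {T : TensorField n M a b}
    (hT : IsSmooth T) (p : ℝ) {x : M} {L L' : Model n →L[ℝ] Model n}
    (hL : IsFrame (localMetric g x (extChartAt (𝓡 n) x x)) L L') :
    let y := extChartAt (𝓡 n) x x
    let B := localMetric g x y
    let S := localTensor T x y
    let X := fun k : Fin n => localD g T x y (L (stdVec k))
    let Y := fun k : Fin n => localD2 g T x y (L (stdVec k)) (L (stdVec k))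
    let Z := fun k : Fin n => localD g (nabla g T) x y (L (stdVec k))
    divg g (mulDiff g (fun x => weight g κ δ s T x ^ p) fun x => tensorNorm g T x ^ 2) x =
        ∑ k, (p * weight g κ δ s T x ^ (p - 1) *
          (κ * s * (δ + tensorNorm g T x ^ 2) ^ (s - 1) * (2 * ipT B S (X k)) +
            2 * ipT B (localTensor (nabla g T) x y) (Z k)) * (2 * ipT B S (X k))
        + weight g κ δ s T x ^ p * (2 * (ipT B (X k) (X k) + ipT B S (Y k)))) := by
  intro y B S X Y Z
  have hx := mem_extChartAt_source (I := 𝓡 n) x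
  have hy : y ∈ (extChartAt (𝓡 n) x).target := (extChartAt (𝓡 n) x).map_source hx
  have hyx : (extChartAt (𝓡 n) x).symm y = x := (extChartAt (𝓡 n) x).left_inv hx
  refine (divg_mulDiff g (isSmoothFun_weight_rpow g hκ hδ hT p (s := s))
      (hT.tensorNorm_sq g) hx hL).trans (Finset.sum_congr rfl fun k _ => ?_)
  have hf' : (fun z => tensorNorm g T ((extChartAt (𝓡 n) x).symm z) ^ 2) =ᶠ[nhds y]
      localSq g T x := by
    filter_upwards [(isOpen_target x).mem_nhds hy] with z hz
    exact tensorNorm_symm_sq g T hz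
  have h3 : (fun z => fderiv ℝ (fun z => tensorNorm g T
      ((extChartAt (𝓡 n) x).symm z) ^ 2) z (L (stdVec k))) =ᶠ[nhds y]
      fun z => fderiv ℝ (localSq g T x) z (L (stdVec k)) := by
    filter_upwards [hf'.fderiv (𝕜 := ℝ)] with z hz
    rw [hz]
  rw [fderiv_weight_rpow g hκ hδ hT p hy, h3.fderiv_eq, hf'.fderiv_eq (𝕜 := ℝ),
    hessian_localSq g hT hy, fderiv_localSq g hT hy, fderiv_localSq g (hT.nabla g) hy, hyx]

/-- Here `u`, `v`, `w` stand for `|T|`, `|∇T|`, `|∇²T|`, and `s k`, `z k`, `t k` for the products of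
`T` with `∇_k T`, of `∇T` with `∇_k ∇T`, and of `T` with `∇²_{kk} T`. The factor `Fintype.card ι` is
the only place where the dimension enters the estimate. -/
theorem frame_sum_bounds {ι : Type*} [Fintype ι] {u v w : ℝ} (hu : 0 ≤ u) (hv : 0 ≤ v) (hw : 0 ≤ w)
    {s z t ξ ζ : ι → ℝ} (hξ : ∑ k, ξ k ^ 2 = v ^ 2) (hζ : ∑ k, ζ k ^ 2 = w ^ 2)
    (hs : ∀ k, |s k| ≤ u * ξ k) (hz : ∀ k, |z k| ≤ v * ζ k) (ht : ∀ k, |t k| ≤ u * w) :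
    ∑ k, (2 * s k) ^ 2 ≤ 4 * u ^ 2 * v ^ 2 ∧
      |∑ k, (2 * z k) * (2 * s k)| ≤ 4 * u * v ^ 2 * w ∧
      |∑ k, t k| ≤ Fintype.card ι * (u * w) := by
  refine ⟨?_, ?_, ?_⟩
  · rw [← hξ, Finset.mul_sum]
    refine Finset.sum_le_sum fun k _ => ?_
    have h := pow_le_pow_left₀ (abs_nonneg _) (hs k) 2
    rw [sq_abs] at h
    nlinarith
  · refine (Finset.abs_sum_le_sum_abs _ _).trans ?_
    have h1 : ∀ k, |(2 * z k) * (2 * s k)| ≤ 4 * u * v * (ξ k * ζ k) := by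
      intro k
      rw [abs_mul, abs_mul, abs_mul, abs_two]
      calc 2 * |z k| * (2 * |s k|) = 4 * (|z k| * |s k|) := by ring
        _ ≤ 4 * ((v * ζ k) * (u * ξ k)) := by
            gcongr
            · exact (abs_nonneg _).trans (hz k)
            · exact hz k
            · exact hs k
        _ = _ := by ring
    refine (Finset.sum_le_sum fun k _ => h1 k).trans ?_
    rw [← Finset.mul_sum]
    have h2 : ∑ k, ξ k * ζ k ≤ v * w := by
      refine abs_le_of_sq_le_sq' ?_ (by positivity) |>.2
      refine (Finset.sum_mul_sq_le_sq_mul_sq _ _ _).trans (le_of_eq ?_)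
      rw [mul_pow, hξ, hζ]
    calc 4 * u * v * ∑ k, ξ k * ζ k ≤ 4 * u * v * (v * w) := by gcongr
      _ = _ := by ring
  · refine (Finset.abs_sum_le_sum_abs _ _).trans ((Finset.sum_le_sum fun k _ => ht k).trans ?_)
    simp

theorem tensorNorm_nabla_sq {T : TensorField n M a b} (hT : IsSmooth T) {c x : M}
    (hx : x ∈ (extChartAt (𝓡 n) c).source) {L L' : Model n →L[ℝ] Model n}
    (hL : IsFrame (localMetric g c (extChartAt (𝓡 n) c x)) L L') :
    ∑ k, ipT (localMetric g c (extChartAt (𝓡 n) c x))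
      (localD g T c (extChartAt (𝓡 n) c x) (L (stdVec k)))
      (localD g T c (extChartAt (𝓡 n) c x) (L (stdVec k))) = tensorNorm g (nabla g T) x ^ 2 := by
  rw [tensorNorm_sq g _ hx, localSq,
    localTensor_nabla g hT ((extChartAt (𝓡 n) c).map_source hx), localNabla_eq]
  exact (hL.ipT_uncurryLeft _ _).symm

theorem IsFrame.ipT_curryLeft_le {B : Model n →L[ℝ] Model n →L[ℝ] ℝ}
    {L L' : Model n →L[ℝ] Model n} (hL : IsFrame B L L')
    (Z : TensorSpace (Model n) a (b + 1)) (k : Fin n) :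
    ipT B (Z.curryLeft (L (stdVec k))) (Z.curryLeft (L (stdVec k))) ≤ ipT B Z Z := by
  have h := hL.ipT_uncurryLeft Z.curryLeft Z.curryLeft
  rw [ContinuousMultilinearMap.uncurry_curryLeft] at h
  rw [h]
  exact Finset.single_le_sum (f := fun l => ipT B (Z.curryLeft (L (stdVec l)))
    (Z.curryLeft (L (stdVec l)))) (fun l _ => hL.ipT_self_nonneg _) (Finset.mem_univ k)

/-- The witnesses are `N = |d|T|²|²`, `P = ⟨d|∇T|², d|T|²⟩` and `R = ⟨T, ΔT⟩`. Their bounds involve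
only `n` and pointwise norms, hence neither curvature nor the type of `T`. -/
theorem divg_mulDiff_weight (hκ : 0 < κ) (hδ : 0 < δ) {T : TensorField n M a b}
    (hT : IsSmooth T) (p : ℝ) (x : M) :
    ∃ N P R : ℝ, 0 ≤ N ∧ N ≤ 4 * tensorNorm g T x ^ 2 * tensorNorm g (nabla g T) x ^ 2 ∧
      |P| ≤ 4 * tensorNorm g T x * tensorNorm g (nabla g T) x ^ 2 *
        tensorNorm g (nabla g (nabla g T)) x ∧
      |R| ≤ n * (tensorNorm g T x * tensorNorm g (nabla g (nabla g T)) x) ∧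
      divg g (mulDiff g (fun x => weight g κ δ s T x ^ p) fun x => tensorNorm g T x ^ 2) x =
        p * weight g κ δ s T x ^ (p - 1) *
          (κ * s * (δ + tensorNorm g T x ^ 2) ^ (s - 1) * N + P)
        + 2 * weight g κ δ s T x ^ p * (tensorNorm g (nabla g T) x ^ 2 + R) := by
  have hx := mem_extChartAt_source (I := 𝓡 n) x
  obtain ⟨L, L', hL⟩ := exists_isFrame_localMetric g ((extChartAt (𝓡 n) x).map_source hx)
  have hdiv := divg_mulDiff_weight_eq g hκ hδ hT p hL (s := s)
  have hv2 := tensorNorm_nabla_sq g hT hx hL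
  have hw2 := tensorNorm_nabla_sq g (hT.nabla g) hx hL
  have hu1 := tensorNorm_eq g T hx
  have hv1 := tensorNorm_eq g (nabla g T) hx
  have hw0 := tensorNorm_nonneg g (nabla g (nabla g T)) x
  have hX : ∀ k, 0 ≤ ipT (localMetric g x (extChartAt (𝓡 n) x x))
      (localD g T x (extChartAt (𝓡 n) x x) (L (stdVec k)))
      (localD g T x (extChartAt (𝓡 n) x x) (L (stdVec k))) := fun k => hL.ipT_self_nonneg _
  have hZ : ∀ k, 0 ≤ ipT (localMetric g x (extChartAt (𝓡 n) x x))
      (localD g (nabla g T) x (extChartAt (𝓡 n) x x) (L (stdVec k)))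
      (localD g (nabla g T) x (extChartAt (𝓡 n) x x) (L (stdVec k))) :=
    fun k => hL.ipT_self_nonneg _
  have hYw : ∀ k, √(ipT (localMetric g x (extChartAt (𝓡 n) x x))
      (localD2 g T x (extChartAt (𝓡 n) x x) (L (stdVec k)) (L (stdVec k)))
      (localD2 g T x (extChartAt (𝓡 n) x x) (L (stdVec k)) (L (stdVec k)))) ≤
        tensorNorm g (nabla g (nabla g T)) x := by
    intro k
    refine Real.sqrt_le_iff.2 ⟨hw0, ?_⟩
    rw [← hw2]
    exact (hL.ipT_curryLeft_le _ k).trans (Finset.single_le_sum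
      (f := fun k => ipT (localMetric g x (extChartAt (𝓡 n) x x))
        (localD g (nabla g T) x (extChartAt (𝓡 n) x x) (L (stdVec k)))
        (localD g (nabla g T) x (extChartAt (𝓡 n) x x) (L (stdVec k))))
      (fun l _ => hZ l) (Finset.mem_univ k))
  have hSX := fun k => hL.abs_ipT_le (localTensor T x (extChartAt (𝓡 n) x x))
    (localD g T x (extChartAt (𝓡 n) x x) (L (stdVec k)))
  have hSZ := fun k => hL.abs_ipT_le (localTensor (nabla g T) x (extChartAt (𝓡 n) x x))
    (localD g (nabla g T) x (extChartAt (𝓡 n) x x) (L (stdVec k)))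
  have hSY := fun k => hL.abs_ipT_le (localTensor T x (extChartAt (𝓡 n) x x))
    (localD2 g T x (extChartAt (𝓡 n) x x) (L (stdVec k)) (L (stdVec k)))
  rw [← hu1] at hSX hSY
  rw [← hv1] at hSZ
  have hu0 := tensorNorm_nonneg g T x
  obtain ⟨b1, b2, b3⟩ := frame_sum_bounds hu0 (tensorNorm_nonneg g (nabla g T) x)
    hw0 (by simpa only [Real.sq_sqrt (hX _)] using hv2)
    (by simpa only [Real.sq_sqrt (hZ _)] using hw2) hSX hSZ
    (fun k => (hSY k).trans (mul_le_mul_of_nonneg_left (hYw k) hu0))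
  rw [Fintype.card_fin] at b3
  refine ⟨_, _, _, Finset.sum_nonneg fun k _ => sq_nonneg _, b1, b2, b3, hdiv.trans ?_⟩
  rw [← hv2]
  simp only [Finset.mul_sum, ← Finset.sum_add_distrib]
  refine Finset.sum_congr rfl fun k _ => ?_
  ring

end Pointwise

/-! ### The Riemannian volume measure in charts. -/

section Volume

variable {n a b : ℕ} {M : Type*} [TopologicalSpace M] [ChartedSpace (Model n) M]
  [IsManifold (𝓡 n) ∞ M] [MeasurableSpace M] [BorelSpace M] (g : Metric n M)

omit [IsManifold (𝓡 n) ∞ M] in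
theorem aemeasurable_extChartAt_symm (c : M) :
    AEMeasurable (extChartAt (𝓡 n) c).symm
      ((volume : Measure (Model n)).restrict (extChartAt (𝓡 n) c).target) :=
  (continuousOn_extChartAt_symm c).aemeasurable (isOpen_target c).measurableSet

omit [MeasurableSpace M] [BorelSpace M] in
theorem continuousOn_sqrt_det_gram (c : M) :
    ContinuousOn (fun y => √(gram g c y).det) (extChartAt (𝓡 n) c).target :=
  (contDiffOn_bgram_det g c).continuousOn.sqrt

omit [MeasurableSpace M] [BorelSpace M] in
theorem aemeasurable_density (c : M) :
    AEMeasurable (fun y => ENNReal.ofReal √(gram g c y).det)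
      ((volume : Measure (Model n)).restrict (extChartAt (𝓡 n) c).target) :=
  ((continuousOn_sqrt_det_gram g c).aemeasurable (isOpen_target c).measurableSet).ennreal_ofReal

theorem aemeasurable_extChartAt_symm_withDensity (c : M) :
    AEMeasurable (extChartAt (𝓡 n) c).symm
      (((volume : Measure (Model n)).restrict (extChartAt (𝓡 n) c).target).withDensity
        (fun y => ENNReal.ofReal √(gram g c y).det)) :=
  (aemeasurable_extChartAt_symm c).mono_ac (withDensity_absolutelyContinuous _ _)

omit [IsManifold (𝓡 n) ∞ M] in
theorem measurableSet_chart_preimage (c : M) {A : Set M} (hA : MeasurableSet A) :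
    MeasurableSet ((extChartAt (𝓡 n) c).symm ⁻¹' A ∩ (extChartAt (𝓡 n) c).target) := by
  have h := (continuousOn_iff_continuous_domRestrict.1
    (continuousOn_extChartAt_symm (I := 𝓡 n) c)).measurable hA
  have h2 := (isOpen_target (n := n) c).measurableSet.subtype_image h
  convert h2 using 1
  ext y
  simp [and_comm]

theorem chartVolume_apply (c : M) {A : Set M} (hA : MeasurableSet A) :
    chartVolume g c A = ∫⁻ y in (extChartAt (𝓡 n) c).symm ⁻¹' A ∩ (extChartAt (𝓡 n) c).target,
      ENNReal.ofReal √(gram g c y).det := by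
  rw [chartVolume, Measure.map_apply_of_aemeasurable
    (aemeasurable_extChartAt_symm_withDensity g c) hA, withDensity_apply',
    Measure.restrict_restrict' (isOpen_target c).measurableSet]

theorem chartVolume_inter_source (c : M) {A : Set M} (hA : MeasurableSet A) :
    chartVolume g c (A ∩ (extChartAt (𝓡 n) c).source) = chartVolume g c A := by
  rw [chartVolume_apply g c hA,
    chartVolume_apply g c (hA.inter (isOpen_source c).measurableSet)]
  congr 2
  ext y
  constructor
  · rintro ⟨h1, h2⟩
    exact ⟨h1.1, h2⟩
  · rintro ⟨h1, h2⟩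
    exact ⟨⟨h1, (extChartAt (𝓡 n) c).map_target h2⟩, h2⟩

omit [MeasurableSpace M] [BorelSpace M] in
theorem sqrt_det_gram_coordChange {c c' : M} {y : Model n} (hy : y ∈ overlap c c') :
    √(gram g c y).det = |(fderiv ℝ (coordChange c c') y).det| *
      √(gram g c' (coordChange c c' y)).det := by
  set D := fderiv ℝ (coordChange c c') y with hD
  set Mx : Matrix (Fin n) (Fin n) ℝ := LinearMap.toMatrix
    (EuclideanSpace.basisFun (Fin n) ℝ).toBasis (EuclideanSpace.basisFun (Fin n) ℝ).toBasis
    (D : Model n →ₗ[ℝ] Model n) with hM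
  have hMx : ∀ i j, Mx i j = D (stdVec j) i := fun i j => by
    rw [hM, LinearMap.toMatrix_apply]
    simp [stdVec]
  have h1 : gram g c y = Mx.transpose * gram g c' (coordChange c c' y) * Mx := by
    ext i j
    have h2 : gram g c y i j = localMetric g c' (coordChange c c' y) (D (stdVec i)) (D (stdVec j)) :=
      localMetric_coordChange g hy _ _
    rw [h2, Matrix.mul_apply]
    conv_lhs => rw [← sum_stdVec (D (stdVec i)), ← sum_stdVec (D (stdVec j))]
    simp only [map_sum, map_smul, sum_apply, smul_apply, smul_eq_mul, Matrix.mul_apply,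
      Matrix.transpose_apply, hMx, Finset.sum_mul]
    refine Finset.sum_congr rfl fun k _ => ?_
    simp only [Finset.mul_sum]
    refine Finset.sum_congr rfl fun l _ => ?_
    rw [gram, Matrix.of_apply]
    ring
  have h3 : D.det = Mx.det := by
    rw [hM, LinearMap.det_toMatrix]
  rw [h1, Matrix.det_mul, Matrix.det_mul, Matrix.det_transpose, h3, mul_right_comm,
    Real.sqrt_mul (mul_self_nonneg _), Real.sqrt_mul_self_eq_abs]

/-- Change of variables along `coordChange`: its Jacobian is exactly the ratio of the two densities,
by `sqrt_det_gram_coordChange`. -/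
theorem chartVolume_eq (c c' : M) {A : Set M} (hA : MeasurableSet A)
    (hc : A ⊆ (extChartAt (𝓡 n) c).source) (hc' : A ⊆ (extChartAt (𝓡 n) c').source) :
    chartVolume g c' A = chartVolume g c A := by
  rw [chartVolume_apply g c hA, chartVolume_apply g c' hA]
  set s := (extChartAt (𝓡 n) c).symm ⁻¹' A ∩ (extChartAt (𝓡 n) c).target with hs
  have hov : ∀ y ∈ s, y ∈ overlap c c' := fun y hy => ⟨hy.2, hc' hy.1⟩
  have him : (extChartAt (𝓡 n) c').symm ⁻¹' A ∩ (extChartAt (𝓡 n) c').target =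
      coordChange c c' '' s := by
    ext z
    constructor
    · rintro ⟨h1, h2⟩
      refine ⟨extChartAt (𝓡 n) c ((extChartAt (𝓡 n) c').symm z), ⟨?_, ?_⟩, ?_⟩
      · change (extChartAt (𝓡 n) c).symm _ ∈ A
        rw [(extChartAt (𝓡 n) c).left_inv (hc h1)]
        exact h1
      · exact (extChartAt (𝓡 n) c).map_source (hc h1)
      · rw [coordChange, (extChartAt (𝓡 n) c).left_inv (hc h1), (extChartAt (𝓡 n) c').right_inv h2]
    · rintro ⟨y, hy, rfl⟩
      refine ⟨?_, (extChartAt (𝓡 n) c').map_source (hc' hy.1)⟩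
      change (extChartAt (𝓡 n) c').symm (extChartAt (𝓡 n) c' _) ∈ A
      rw [(extChartAt (𝓡 n) c').left_inv (hc' hy.1)]
      exact hy.1
  have hsm : MeasurableSet s := measurableSet_chart_preimage c hA
  have hinj : Set.InjOn (coordChange c c') s := fun y hy z hz h =>
    (extChartAt (𝓡 n) c).symm.injOn hy.2 hz.2
      ((extChartAt (𝓡 n) c').injOn (hc' hy.1) (hc' hz.1) h)
  rw [him, lintegral_image_eq_lintegral_abs_det_fderiv_mul volume hsm (fun y hy =>
    ((contDiffAt_coordChange (hov y hy)).differentiableAt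
      (by simp)).hasFDerivAt.hasFDerivWithinAt) hinj]
  refine setLIntegral_congr_fun hsm fun y hy => ?_
  rw [← ENNReal.ofReal_mul (abs_nonneg _), ← sqrt_det_gram_coordChange g (hov y hy)]

theorem chartVolume_restrict_le (c c' : M) :
    (chartVolume g c').restrict (extChartAt (𝓡 n) c).source ≤ chartVolume g c := by
  refine Measure.le_iff.2 fun A hA => ?_
  have h1 := hA.inter (isOpen_source (n := n) c).measurableSet
  rw [Measure.restrict_apply hA, ← chartVolume_inter_source g c' h1, chartVolume_eq g c c'
    (h1.inter (isOpen_source c').measurableSet) (fun x hx => hx.1.2) (fun x hx => hx.2)]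
  exact measure_mono fun x hx => hx.1.1

/-- The volume measure is `√(det g_{ij}) dx` in each chart. -/
theorem riemVolume_restrict_source (c : M) :
    (riemVolume g).restrict (extChartAt (𝓡 n) c).source = chartVolume g c := by
  have hs := (isOpen_source (n := n) c).measurableSet
  have h0 : (chartVolume g c).restrict (extChartAt (𝓡 n) c).source = chartVolume g c := by
    ext A hA
    rw [Measure.restrict_apply hA, chartVolume_inter_source g c hA]
  refine le_antisymm ?_ ?_
  -- A supremum of measures is not computed set by set, so it is bounded by one measure:
  -- `chartVolume g c` on the source plus the largest measure `⊤` off the source. Restriction to the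
  -- source kills the second summand.
  · have h1 : riemVolume g ≤
        chartVolume g c + (⊤ : Measure M).restrict (extChartAt (𝓡 n) c).sourceᶜ := by
      refine iSup_le fun c' => ?_
      rw [← Measure.restrict_add_restrict_compl (μ := chartVolume g c') hs]
      exact add_le_add (chartVolume_restrict_le g c c') (Measure.restrict_mono le_rfl le_top)
    refine (Measure.restrict_mono le_rfl h1).trans (le_of_eq ?_)
    rw [Measure.restrict_add, h0, Measure.restrict_restrict hs]
    simp
  · conv_lhs => rw [← h0]
    exact Measure.restrict_mono le_rfl (le_iSup _ c)

/-- Near a point the density is bounded and the coordinates stay in a unit ball. With compactness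
this gives finite volume, hence integrability of all continuous functions. -/
theorem isLocallyFiniteMeasure_riemVolume : IsLocallyFiniteMeasure (riemVolume g) := by
  refine ⟨fun x => ?_⟩
  have hx := mem_extChartAt_source (I := 𝓡 n) x
  have hy := (extChartAt (𝓡 n) x).map_source hx
  have hc := (continuousOn_sqrt_det_gram g x).continuousAt ((isOpen_target x).mem_nhds hy)
  have hb : ∀ᶠ z in nhds (extChartAt (𝓡 n) x x),
      z ∈ Metric.ball (extChartAt (𝓡 n) x x) 1 := Metric.ball_mem_nhds _ one_pos
  have hev := (hc.eventually_lt_const (lt_add_one _)).and hb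
  set m := √(gram g x (extChartAt (𝓡 n) x x)).det + 1
  obtain ⟨V, hV, hVo, hxV⟩ := eventually_nhds_iff.1 hev
  refine ⟨(extChartAt (𝓡 n) x).source ∩ extChartAt (𝓡 n) x ⁻¹' V,
    ((continuousOn_extChartAt x).isOpen_inter_preimage (isOpen_source x) hVo).mem_nhds ⟨hx, hxV⟩, ?_⟩
  have hm := ((continuousOn_extChartAt x).isOpen_inter_preimage
    (isOpen_source (n := n) x) hVo).measurableSet
  have h1 : riemVolume g ((extChartAt (𝓡 n) x).source ∩ extChartAt (𝓡 n) x ⁻¹' V) =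
      chartVolume g x ((extChartAt (𝓡 n) x).source ∩ extChartAt (𝓡 n) x ⁻¹' V) := by
    rw [← riemVolume_restrict_source g x, Measure.restrict_apply hm,
      Set.inter_eq_left.2 Set.inter_subset_left]
  rw [h1, chartVolume_apply g x hm]
  have h2 : (extChartAt (𝓡 n) x).symm ⁻¹' ((extChartAt (𝓡 n) x).source ∩
      extChartAt (𝓡 n) x ⁻¹' V) ∩ (extChartAt (𝓡 n) x).target ⊆ V := by
    rintro z ⟨⟨-, h⟩, hz⟩
    change extChartAt (𝓡 n) x ((extChartAt (𝓡 n) x).symm z) ∈ V at h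
    rwa [(extChartAt (𝓡 n) x).right_inv hz] at h
  calc ∫⁻ y in _, ENNReal.ofReal √(gram g x y).det
      ≤ ∫⁻ y in V, ENNReal.ofReal √(gram g x y).det := lintegral_mono_set h2
    _ ≤ ∫⁻ _ in V, ENNReal.ofReal m := setLIntegral_mono measurable_const
        fun y hy => ENNReal.ofReal_le_ofReal (hV y hy).1.le
    _ = ENNReal.ofReal m * volume V := by rw [setLIntegral_const]
    _ < ⊤ := ENNReal.mul_lt_top ENNReal.ofReal_lt_top
        ((measure_mono fun y hy => (hV y hy).2).trans_lt measure_ball_lt_top)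

theorem isFiniteMeasure_riemVolume [CompactSpace M] : IsFiniteMeasure (riemVolume g) :=
  have := isLocallyFiniteMeasure_riemVolume g
  inferInstance

end Volume

/-! ### Continuity of functions checked in charts. -/

section Continuity

variable {n a b : ℕ} {M : Type*} [TopologicalSpace M] [ChartedSpace (Model n) M]

theorem continuous_of_charts {f : M → ℝ} (h : ∀ c : M,
    ContinuousOn (fun y => f ((extChartAt (𝓡 n) c).symm y)) (extChartAt (𝓡 n) c).target) :
    Continuous f := by
  refine continuous_iff_continuousAt.2 fun x => ?_
  have hx := mem_extChartAt_source (I := 𝓡 n) x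
  have h1 := ((h x).continuousAt ((isOpen_target x).mem_nhds
    ((extChartAt (𝓡 n) x).map_source hx))).comp (continuousAt_extChartAt (I := 𝓡 n) x)
  refine h1.congr ?_
  filter_upwards [(isOpen_source (n := n) x).mem_nhds hx] with z hz
  simp only [Function.comp_apply, (extChartAt (𝓡 n) x).left_inv hz]

theorem IsSmoothFun.continuous {f : M → ℝ} (hf : IsSmoothFun n f) : Continuous f :=
  continuous_of_charts fun c => (hf c).continuousOn

variable [IsManifold (𝓡 n) ∞ M] (g : Metric n M)

theorem continuous_tensorNorm {T : TensorField n M a b} (hT : IsSmooth T) :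
    Continuous (tensorNorm g T) := by
  have h := (hT.tensorNorm_sq g).continuous.sqrt
  simpa only [Real.sqrt_sq (tensorNorm_nonneg g T _)] using h

end Continuity

/-! ### The divergence theorem on a closed manifold. -/

section Green

theorem integral_fderiv_eq_zero {E : Type*} [NormedAddCommGroup E] [NormedSpace ℝ E]
    [FiniteDimensional ℝ E] [MeasurableSpace E] [BorelSpace E] (μ : Measure E)
    [μ.IsAddHaarMeasure] {f : E → ℝ} (hf : ContDiff ℝ 1 f) (hc : HasCompactSupport f) (v : E) :
    Integrable (fun y => fderiv ℝ f y v) μ ∧ ∫ y, fderiv ℝ f y v ∂μ = 0 := by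
  have hi : Integrable (fun y => fderiv ℝ f y v) μ :=
    ((hf.continuous_fderiv one_ne_zero).clm_apply continuous_const).integrable_of_hasCompactSupport
      (hc.fderiv_apply ℝ v)
  refine ⟨hi, ?_⟩
  -- Integration by parts against the constant function `1`.
  have h := integral_mul_fderiv_eq_neg_fderiv_mul_of_integrable (μ := μ) (f := fun _ => (1 : ℝ))
    (g := f) (v := v) (by simp) (by simpa using hi)
    (by simpa using hf.continuous.integrable_of_hasCompactSupport hc)
    (fun _ _ => differentiableAt_const _) (fun _ _ => hf.differentiable one_ne_zero _)
  simpa using h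

/-- The functions met in a chart are meaningful only on its target. Vanishing off a compact `K ⊆ U`
makes the extension by zero smooth on the whole space, which reduces to the compactly supported
case. -/
theorem setIntegral_fderiv_eq_zero {E : Type*} [NormedAddCommGroup E] [NormedSpace ℝ E]
    [FiniteDimensional ℝ E] [MeasurableSpace E] [BorelSpace E] (μ : Measure E)
    [μ.IsAddHaarMeasure] {U K : Set E} (hU : IsOpen U) (hK : IsCompact K) (hKU : K ⊆ U)
    {f : E → ℝ} (hf : ContDiffOn ℝ 1 f U) (h0 : ∀ y ∈ U, y ∉ K → f y = 0) (v : E) :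
    IntegrableOn (fun y => fderiv ℝ f y v) U μ ∧ ∫ y in U, fderiv ℝ f y v ∂μ = 0 := by
  have hF0 : ∀ y ∉ K, U.indicator f y = 0 := by
    intro y hy
    by_cases hyU : y ∈ U
    · rw [Set.indicator_of_mem hyU, h0 y hyU hy]
    · exact Set.indicator_of_notMem hyU f
  have hFe : ∀ y ∉ K, U.indicator f =ᶠ[nhds y] fun _ => 0 := fun y hy => by
    filter_upwards [hK.isClosed.isOpen_compl.mem_nhds hy] with z hz
    exact hF0 z hz
  have hFU : ∀ y ∈ U, U.indicator f =ᶠ[nhds y] f := fun y hy => by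
    filter_upwards [hU.mem_nhds hy] with z hz
    exact Set.indicator_of_mem hz f
  have hF : ContDiff ℝ 1 (U.indicator f) := by
    refine contDiff_iff_contDiffAt.2 fun y => ?_
    by_cases hy : y ∈ U
    · exact (hf.contDiffAt (hU.mem_nhds hy)).congr_of_eventuallyEq (hFU y hy)
    · exact contDiffAt_const.congr_of_eventuallyEq (hFe y fun h => hy (hKU h))
  obtain ⟨h1, h2⟩ := integral_fderiv_eq_zero μ hF (HasCompactSupport.intro hK hF0) v
  have heq : Set.EqOn (fun y => fderiv ℝ (U.indicator f) y v) (fun y => fderiv ℝ f y v) U :=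
    fun y hy => by simp only [(hFU y hy).fderiv_eq]
  refine ⟨h1.integrableOn.congr_fun heq hU.measurableSet, ?_⟩
  rw [← setIntegral_congr_fun hU.measurableSet heq,
    setIntegral_eq_integral_of_forall_compl_eq_zero, h2]
  intro y hy
  rw [(hFe y fun h => hy (hKU h)).fderiv_eq]
  simp

variable {n : ℕ} {M : Type*} [TopologicalSpace M] [ChartedSpace (Model n) M]

theorem IsSmooth.add {a b : ℕ} {S T : TensorField n M a b} (hS : IsSmooth S) (hT : IsSmooth T) :
    IsSmooth fun x => S x + T x := fun c => (hS c).add (hT c)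

theorem IsSmooth.smul {a b : ℕ} {T : TensorField n M a b} {f : M → ℝ} (hf : IsSmoothFun n f)
    (hT : IsSmooth T) : IsSmooth fun x => f x • T x := fun c => (hf c).smul (hT c)

theorem IsSmooth.zero {a b : ℕ} : IsSmooth fun x : M => (0 : TensorSpace (TangentSpace (𝓡 n) x) a b) :=
  fun _ => contDiffOn_const (c := (0 : TensorSpace (Model n) a b))

variable [IsManifold (𝓡 n) ∞ M] (g : Metric n M)

theorem divg_symm {θ : TensorField n M 0 1} (hθ : IsSmooth θ) {c : M} {y : Model n}
    (hy : y ∈ (extChartAt (𝓡 n) c).target) :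
    divg g θ ((extChartAt (𝓡 n) c).symm y) = localDiv g θ c y := by
  rw [divg_eq g hθ ((extChartAt (𝓡 n) c).map_target hy), (extChartAt (𝓡 n) c).right_inv hy]

theorem continuous_divg {θ : TensorField n M 0 1} (hθ : IsSmooth θ) : Continuous (divg g θ) := by
  refine continuous_of_charts fun c => ContinuousOn.congr ?_ fun y hy => divg_symm g hθ hy
  unfold localDiv trB
  refine continuousOn_finsetSum _ fun i _ => continuousOn_finsetSum _ fun j _ => ?_
  refine (contDiffOn_bgram_inv g c i j).continuousOn.mul ?_
  exact (cov.contDiff.comp_contDiffOn ((contDiffOn_localD g hθ c).clm_apply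
    contDiffOn_const)).continuousOn.clm_apply continuousOn_const

theorem divg_add {θ η : TensorField n M 0 1} (hθ : IsSmooth θ) (hη : IsSmooth η) (x : M) :
    divg g (fun x => θ x + η x) x = divg g θ x + divg g η x := by
  have hy := (extChartAt (𝓡 n) x).map_source (mem_extChartAt_source x)
  have h1 : ∀ y, localTensor (fun x => θ x + η x) x y = localTensor θ x y + localTensor η x y :=
    fun y => rfl
  have hd : ∀ {η' : TensorField n M 0 1}, IsSmooth η' → DifferentiableAt ℝ
      (fun z => cov (localTensor η' x z)) (extChartAt (𝓡 n) x x) := fun hη' =>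
    cov.differentiableAt.comp _ (hη'.differentiableAt hy)
  simp only [divg, localDiv, trB, cov_localD g (hθ.add hη) hy, cov_localD g hθ hy,
    cov_localD g hη hy, h1, map_add, _root_.add_apply, fderiv_fun_add (hd hθ) (hd hη)]
  simp only [← Finset.sum_add_distrib]
  refine Finset.sum_congr rfl fun i _ => Finset.sum_congr rfl fun j _ => ?_
  ring

theorem divg_zero (x : M) : divg g (fun x => (0 : TensorSpace (TangentSpace (𝓡 n) x) 0 1)) x = 0 := by
  have h := divg_add g (IsSmooth.zero (M := M) (n := n) (a := 0) (b := 1)) IsSmooth.zero x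
  simpa using h

theorem divg_eq_zero_of_eventually {θ : TensorField n M 0 1} (hθ : IsSmooth θ) {x : M}
    (h : ∀ᶠ z in nhds x, θ z = 0) : divg g θ x = 0 := by
  have hy := (extChartAt (𝓡 n) x).map_source (mem_extChartAt_source x)
  have h1 : localTensor θ x =ᶠ[nhds (extChartAt (𝓡 n) x x)] fun _ => 0 := by
    have hc := (continuousOn_extChartAt_symm (I := 𝓡 n) x).continuousAt
      ((isOpen_target x).mem_nhds hy)
    rw [ContinuousAt, extChartAt_to_inv] at hc
    filter_upwards [hc.eventually h] with z hz
    rw [localTensor]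
    simp only [hz]
    rfl
  have h2 : (fun z => cov (localTensor θ x z)) =ᶠ[nhds (extChartAt (𝓡 n) x x)] fun _ => 0 := by
    filter_upwards [h1] with z hz
    rw [hz, map_zero]
  simp only [divg, localDiv, trB, cov_localD g hθ hy, h2.fderiv_eq, h1.eq_of_nhds]
  simp

variable [MeasurableSpace M] [BorelSpace M]

/-- For a field supported in one chart, `√(det g)` times the divergence is a sum of coordinate
derivatives of compactly supported functions, each of integral zero. -/
theorem integral_divg_of_chart [T2Space M] {θ : TensorField n M 0 1} (hθ : IsSmooth θ) (c : M)
    {K : Set M} (hK : IsCompact K) (hKc : K ⊆ (extChartAt (𝓡 n) c).source)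
    (h0 : ∀ x ∉ K, θ x = 0) : ∫ x, divg g θ x ∂(riemVolume g) = 0 := by
  have hdiv0 : ∀ x ∉ (extChartAt (𝓡 n) c).source, divg g θ x = 0 := fun x hx =>
    divg_eq_zero_of_eventually g hθ (by
      filter_upwards [hK.isClosed.isOpen_compl.mem_nhds fun h => hx (hKc h)] with z hz
      exact h0 z hz)
  have hm := (isOpen_target (n := n) c).measurableSet
  have hK' : IsCompact (extChartAt (𝓡 n) c '' K) :=
    hK.image_of_continuousOn ((continuousOn_extChartAt c).mono hKc)
  have hKt : extChartAt (𝓡 n) c '' K ⊆ (extChartAt (𝓡 n) c).target := by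
    rintro _ ⟨x, hx, rfl⟩
    exact (extChartAt (𝓡 n) c).map_source (hKc hx)
  rw [← setIntegral_eq_integral_of_forall_compl_eq_zero hdiv0, riemVolume_restrict_source,
    chartVolume, integral_map (aemeasurable_extChartAt_symm_withDensity g c)
      (continuous_divg g hθ).measurable.aestronglyMeasurable,
    integral_withDensity_eq_integral_toReal_smul₀ (aemeasurable_density g c)
      (Filter.Eventually.of_forall fun y => ENNReal.ofReal_lt_top)]
  have h1 : Set.EqOn (fun y => (ENNReal.ofReal √(gram g c y).det).toReal •
      divg g θ ((extChartAt (𝓡 n) c).symm y))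
      (fun y => ∑ i, fderiv ℝ (fun z => √(bgram (localMetric g c z)).det *
        ∑ j, (bgram (localMetric g c z))⁻¹ i j * cov (localTensor θ c z) (stdVec j)) y (stdVec i))
      (extChartAt (𝓡 n) c).target := by
    intro y hy
    beta_reduce
    rw [sum_fderiv_eq_localDiv g hθ hy, ENNReal.toReal_ofReal (Real.sqrt_nonneg _),
      divg_symm g hθ hy]
    rfl
  rw [setIntegral_congr_fun hm h1]
  have h2 : ∀ i : Fin n, _ := fun i => setIntegral_fderiv_eq_zero (volume : Measure (Model n))
    (isOpen_target c) hK' hKt (f := fun z => √(bgram (localMetric g c z)).det *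
        ∑ j, (bgram (localMetric g c z))⁻¹ i j * cov (localTensor θ c z) (stdVec j))
    (by
      refine ContDiffOn.of_le (n := ∞) ?_ (by simp)
      refine ContDiffOn.mul ?_ (ContDiffOn.sum fun j _ => ?_)
      · refine (contDiffOn_bgram_det g c).sqrt fun y hy => ?_
        obtain ⟨L, L', hL⟩ := exists_isFrame_localMetric g hy
        exact hL.det_pos.ne'
      · exact (contDiffOn_bgram_inv g c i j).mul
          ((cov.contDiff.comp_contDiffOn (hθ c)).clm_apply contDiffOn_const))
    (by
      intro y hy hyK
      have h3 : localTensor θ c y = 0 := by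
        rw [localTensor, h0 _ fun h => hyK ⟨_, h, (extChartAt (𝓡 n) c).right_inv hy⟩]
        rfl
      simp [h3]) (stdVec i)
  rw [integral_finsetSum _ fun i _ => (h2 i).1]
  exact Finset.sum_eq_zero fun i _ => (h2 i).2

omit [MeasurableSpace M] [BorelSpace M] in
theorem isSmoothFun_of_contMDiff {f : M → ℝ} (hf : ContMDiff (𝓡 n) 𝓘(ℝ) ∞ f) : IsSmoothFun n f :=
  fun c => (hf.comp_contMDiffOn (contMDiffOn_extChartAt_symm (n := ∞) c)).contDiffOn

theorem integral_divg_sum [T2Space M] [CompactSpace M] {ι : Type*} (s : Finset ι)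
    {θ : ι → TensorField n M 0 1} (hθ : ∀ i, IsSmooth (θ i))
    (h0 : ∀ i, ∫ x, divg g (θ i) x ∂(riemVolume g) = 0) :
    IsSmooth (fun x => ∑ i ∈ s, θ i x) ∧
      ∫ x, divg g (fun x => ∑ i ∈ s, θ i x) x ∂(riemVolume g) = 0 := by
  classical
  have := isFiniteMeasure_riemVolume g
  induction s using Finset.induction_on with
  | empty =>
    simp only [Finset.sum_empty, divg_zero]
    exact ⟨IsSmooth.zero, by simp⟩
  | insert i s hi ih =>
    simp only [Finset.sum_insert hi]
    refine ⟨(hθ i).add ih.1, ?_⟩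
    simp only [divg_add g (hθ i) ih.1]
    have hint : ∀ {η' : TensorField n M 0 1}, IsSmooth η' → Integrable (divg g η') (riemVolume g) :=
      fun hη' => (continuous_divg g hη').integrable_of_hasCompactSupport
        (HasCompactSupport.of_compactSpace _)
    rw [integral_add (hint (hθ i)) (hint ih.1), h0, ih.2, add_zero]

/-- The divergence theorem on a closed manifold. -/
theorem integral_divg_eq_zero [T2Space M] [CompactSpace M] {θ : TensorField n M 0 1}
    (hθ : IsSmooth θ) : ∫ x, divg g θ x ∂(riemVolume g) = 0 := by
  -- The partition of unity is indexed by the points of `M`, with `ρ i` supported in the chart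
  -- around `i`. By compactness only finitely many `ρ i` are nonzero, so additivity of the
  -- divergence suffices.
  obtain ⟨ρ, hρ⟩ := SmoothPartitionOfUnity.exists_isSubordinate_chartAt_source (𝓡 n) M
  have hfin := ρ.locallyFinite.finite_nonempty_of_compact
  have hρs : ∀ i, IsSmooth fun x => ρ i x • θ x := fun i =>
    IsSmooth.smul (isSmoothFun_of_contMDiff (ρ i).contMDiff) hθ
  have h := integral_divg_sum g hfin.toFinset (θ := fun i x => ρ i x • θ x) hρs fun i => by
    refine integral_divg_of_chart g (hρs i) i (K := tsupport (ρ i))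
      (isClosed_tsupport _).isCompact ?_ fun x hx => ?_
    · rw [extChartAt_source]
      exact hρ i
    · rw [image_eq_zero_of_notMem_tsupport hx]
      exact zero_smul ℝ (θ x)
  have hsum : (fun x => ∑ i ∈ hfin.toFinset, ρ i x • θ x) = θ := by
    funext x
    rw [← Finset.sum_smul, ← finsum_eq_sum_of_support_subset, ρ.sum_eq_one (Set.mem_univ x),
      one_smul]
    intro i hi
    simp only [Set.Finite.coe_toFinset]
    exact ⟨x, hi⟩
  rw [hsum] at h
  exact h.2

end Green

/-! ### Young-type inequalities and the pointwise estimate. -/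

section RealInequalities

/-- A Young inequality that also covers `ρ < 1`, needed because `ρ = r / 2` can be below `1`; `ψ ≤
A` makes up for the negative exponent. If `ψ ≤ η A` the first term suffices, otherwise `A < ψ / η`
and the second does. -/
theorem mul_rpow_sub_one_le {ψ A ρ η : ℝ} (hψ : 0 < ψ) (hA : ψ ≤ A) (hρ : 0 < ρ) (hη : 0 < η) :
    ψ * A ^ (ρ - 1) ≤ η * A ^ ρ + η ^ (-ρ) * ψ ^ ρ := by
  have hA0 : 0 < A := hψ.trans_le hA
  have h1 : A * A ^ (ρ - 1) = A ^ ρ := by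
    rw [Real.rpow_sub_one hA0.ne']
    field_simp
  have h2 : 0 ≤ A ^ (ρ - 1) := Real.rpow_nonneg hA0.le _
  rcases le_or_gt ψ (η * A) with h | h
  · calc ψ * A ^ (ρ - 1) ≤ η * A * A ^ (ρ - 1) := by gcongr
      _ = η * A ^ ρ := by rw [mul_assoc, h1]
      _ ≤ _ := le_add_of_nonneg_right (by positivity)
  · calc ψ * A ^ (ρ - 1) ≤ A * A ^ (ρ - 1) := by gcongr
      _ = A ^ ρ := h1
      _ ≤ (η⁻¹ * ψ) ^ ρ := by
        refine Real.rpow_le_rpow hA0.le ?_ hρ.le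
        rw [inv_mul_eq_div, le_div_iff₀ hη, mul_comm]
        exact h.le
      _ = η ^ (-ρ) * ψ ^ ρ := by
        rw [Real.mul_rpow (by positivity) hψ.le, Real.inv_rpow hη.le, Real.rpow_neg hη.le]
      _ ≤ _ := le_add_of_nonneg_left (by positivity)

/-- Young's inequality with exponent `q` on `B`, by comparing `B` with `η X^(1/q)`; this form
includes `q = 1`. -/
theorem mul_rpow_one_sub_inv_le {B X q η : ℝ} (hB : 0 ≤ B) (hX : 0 < X) (hq : 1 ≤ q) (hη : 0 < η) :
    B * X ^ (1 - 1 / q) ≤ η * X + η ^ (1 - q) * B ^ q := by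
  have hq0 : 0 < q := one_pos.trans_le hq
  have h2 : 0 ≤ X ^ (1 - 1 / q) := Real.rpow_nonneg hX.le _
  rcases le_or_gt B (η * X ^ (1 / q)) with h | h
  · calc B * X ^ (1 - 1 / q) ≤ η * X ^ (1 / q) * X ^ (1 - 1 / q) := by gcongr
      _ = η * X := by
        rw [mul_assoc, ← Real.rpow_add hX, add_sub_cancel, Real.rpow_one]
      _ ≤ _ := le_add_of_nonneg_right (by positivity)
  · have hB0 : 0 < B := lt_of_le_of_lt (by positivity) h
    have hXB : X ≤ (η⁻¹ * B) ^ q := by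
      have h3 : X ^ (1 / q) ≤ η⁻¹ * B := by
        rw [inv_mul_eq_div, le_div_iff₀ hη, mul_comm]
        exact h.le
      have h4 := Real.rpow_le_rpow (by positivity) h3 hq0.le
      rwa [← Real.rpow_mul hX.le, one_div_mul_cancel hq0.ne', Real.rpow_one] at h4
    have hexp : 0 ≤ 1 - 1 / q := by
      rw [sub_nonneg, div_le_one hq0]
      exact hq
    calc B * X ^ (1 - 1 / q) ≤ B * ((η⁻¹ * B) ^ q) ^ (1 - 1 / q) := by gcongr
      _ = B * (η⁻¹ * B) ^ (q - 1) := by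
        rw [← Real.rpow_mul (by positivity)]
        congr 2
        field_simp
      _ = η ^ (1 - q) * B ^ q := by
        rw [Real.mul_rpow (by positivity) hB, Real.inv_rpow hη.le, ← Real.rpow_neg hη.le, neg_sub,
          Real.rpow_sub_one hB0.ne']
        field_simp
      _ ≤ _ := le_add_of_nonneg_left (by positivity)

/-- The constant in the interpolation inequality between `T`, `∇T` and `∇²T`. -/
def interpConst (n : ℕ) (r s q : ℝ) : ℝ :=
  2 * ((1 + |r - 2| * s) * (4 * (1 + |r - 2| * s)) ^ (r / 2)
    + (|r - 2| + n) * (4 * (|r - 2| + n + 1)) ^ (q - 1))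

theorem interpConst_nonneg (n : ℕ) (r : ℝ) {s : ℝ} (hs : 0 ≤ s) (q : ℝ) :
    0 ≤ interpConst n r s q := by
  unfold interpConst
  positivity

/-- With `X = A^(r/2)` and `B = A^(r/2-1)`, one has `2 B v² = 2 X - 2 ψ B`. All other terms of the
divergence are at least minus a multiple of `ψ B` or of `u w B`. Young's inequality bounds each of
the two totals by `X / 4` plus an error; doubled, they consume one `X`, and the remaining `X`
dominates `v ^ r`. -/
theorem rpow_le_divergence {n : ℕ} {r s q u v w κ δ H A N P R : ℝ} (hr : 0 < r) (hs : 0 ≤ s)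
    (hq : 1 ≤ q) (hu : 0 ≤ u) (hv : 0 ≤ v) (hw : 0 ≤ w) (hκ : 0 < κ) (hδ : 0 < δ) (hH0 : 0 ≤ H)
    (hA : A = κ * (δ + u ^ 2) ^ s + v ^ 2)
    (hH : u * A ^ (r / 2 - 1) ≤ H * (A ^ (r / 2)) ^ (1 - 1 / q))
    (hN0 : 0 ≤ N) (hN : N ≤ 4 * u ^ 2 * v ^ 2) (hP : |P| ≤ 4 * u * v ^ 2 * w)
    (hR : |R| ≤ n * (u * w)) :
    v ^ r ≤ ((r / 2 - 1) * A ^ (r / 2 - 1 - 1) * (κ * s * (δ + u ^ 2) ^ (s - 1) * N + P)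
        + 2 * A ^ (r / 2 - 1) * (v ^ 2 + R))
      + interpConst n r s q * ((κ * (δ + u ^ 2) ^ s) ^ (r / 2) + (H * w) ^ q) := by
  set ψ := κ * (δ + u ^ 2) ^ s with hψ
  have hψ0 : 0 < ψ := by positivity
  have hψA : ψ ≤ A := by rw [hA]; linarith [sq_nonneg v]
  have hvA : v ^ 2 ≤ A := by rw [hA]; linarith
  have hA0 : 0 < A := hψ0.trans_le hψA
  set B := A ^ (r / 2 - 1) with hB
  have hB0 : 0 < B := Real.rpow_pos_of_pos hA0 _
  have hB1 : A ^ (r / 2 - 1 - 1) * A = B := by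
    rw [Real.rpow_sub_one hA0.ne' (r / 2 - 1), div_mul_cancel₀ _ hA0.ne']
  have hX : B * A = A ^ (r / 2) := by
    rw [hB, Real.rpow_sub_one hA0.ne' (r / 2), div_mul_cancel₀ _ hA0.ne']
  set B' := A ^ (r / 2 - 1 - 1) with hB'
  have hB'0 : 0 < B' := Real.rpow_pos_of_pos hA0 _
  have hB'v : B' * v ^ 2 ≤ B := by rw [← hB1]; gcongr
  set t := |r - 2| with ht
  have ht0 : 0 ≤ t := abs_nonneg _
  have hQ : κ * s * (δ + u ^ 2) ^ (s - 1) * N ≤ 4 * s * ψ * v ^ 2 := by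
    have h1 : (δ + u ^ 2) ^ (s - 1) * u ^ 2 ≤ (δ + u ^ 2) ^ s := by
      have hd : 0 < δ + u ^ 2 := by positivity
      calc (δ + u ^ 2) ^ (s - 1) * u ^ 2 ≤ (δ + u ^ 2) ^ (s - 1) * (δ + u ^ 2) := by
            gcongr
            linarith
        _ = _ := by
            rw [Real.rpow_sub_one hd.ne']
            field_simp
    calc κ * s * (δ + u ^ 2) ^ (s - 1) * N
        ≤ κ * s * (δ + u ^ 2) ^ (s - 1) * (4 * u ^ 2 * v ^ 2) := by gcongr
      _ = 4 * κ * s * v ^ 2 * ((δ + u ^ 2) ^ (s - 1) * u ^ 2) := by ring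
      _ ≤ 4 * κ * s * v ^ 2 * (δ + u ^ 2) ^ s := by gcongr
      _ = _ := by rw [hψ]; ring
  have hQ0 : 0 ≤ κ * s * (δ + u ^ 2) ^ (s - 1) * N := by positivity
  set Q := κ * s * (δ + u ^ 2) ^ (s - 1) * N with hQdef
  have h1 : -(2 * t * s * ψ * B) ≤ (r / 2 - 1) * B' * Q := by
    have e1 : -(t / 2) ≤ r / 2 - 1 := by
      have := neg_abs_le (r - 2)
      linarith
    calc -(2 * t * s * ψ * B) ≤ -(2 * t * s * ψ * (B' * v ^ 2)) := by gcongr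
      _ = -(t / 2) * B' * (4 * s * ψ * v ^ 2) := by ring
      _ ≤ -(t / 2) * B' * Q := by
        have : t / 2 * B' * Q ≤ t / 2 * B' * (4 * s * ψ * v ^ 2) := by gcongr
        linarith
      _ ≤ (r / 2 - 1) * B' * Q := by gcongr
  have h2 : -(2 * t * (u * w * B)) ≤ (r / 2 - 1) * B' * P := by
    have e1 : |(r / 2 - 1) * B' * P| ≤ 2 * t * (u * w * B) := by
      have e2 : |r / 2 - 1| = t / 2 := by
        rw [ht, ← abs_two, ← abs_div, abs_two]
        congr 1
        ring
      rw [abs_mul, abs_mul, abs_of_pos hB'0, e2]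
      calc t / 2 * B' * |P| ≤ t / 2 * B' * (4 * u * v ^ 2 * w) := by gcongr
        _ = 2 * t * (u * w * (B' * v ^ 2)) := by ring
        _ ≤ _ := by gcongr
    exact (abs_le.1 e1).1
  have h3 : -(2 * n * (u * w * B)) ≤ 2 * B * R := by
    have e1 := (abs_le.1 hR).1
    calc -(2 * n * (u * w * B)) = 2 * B * (-(n * (u * w))) := by ring
      _ ≤ _ := by gcongr
  set X := A ^ (r / 2) with hXdef
  have hX0 : 0 < X := Real.rpow_pos_of_pos hA0 _
  set c1 := 1 + t * s with hc1
  set c2 := t + n with hc2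
  have hc10 : 0 < c1 := by positivity
  have hc20 : 0 ≤ c2 := by positivity
  -- The parameter `η = 1 / (4 c1)` leaves exactly `X / 4` after multiplication by `c1`. In `y2` the
  -- denominator has `c2 + 1` because `c2` vanishes for `r = 2`, `n = 0`.
  have y1 := mul_rpow_sub_one_le (ρ := r / 2) hψ0 hψA (by positivity)
    (show 0 < (4 * c1)⁻¹ by positivity)
  have y2 := mul_rpow_one_sub_inv_le (B := H * w) (by positivity) hX0 hq
    (show 0 < (4 * (c2 + 1))⁻¹ by positivity)
  rw [Real.inv_rpow (by positivity), ← Real.rpow_neg (by positivity), neg_neg] at y1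
  rw [Real.inv_rpow (by positivity), ← Real.rpow_neg (by positivity), neg_sub] at y2
  have y3 : u * w * B ≤ H * w * X ^ (1 - 1 / q) := by
    calc u * w * B = w * (u * B) := by ring
      _ ≤ w * (H * X ^ (1 - 1 / q)) := by gcongr
      _ = _ := by ring
  have z1 : c1 * (ψ * B) ≤ X / 4 + c1 * (4 * c1) ^ (r / 2) * ψ ^ (r / 2) := by
    calc c1 * (ψ * B) ≤ c1 * ((4 * c1)⁻¹ * X + (4 * c1) ^ (r / 2) * ψ ^ (r / 2)) := by gcongr
      _ = _ := by field_simp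
  have z2 : c2 * (u * w * B) ≤ X / 4 + c2 * (4 * (c2 + 1)) ^ (q - 1) * (H * w) ^ q := by
    have e1 : c2 * (4 * (c2 + 1))⁻¹ ≤ 1 / 4 := by
      rw [← div_eq_mul_inv, div_le_div_iff₀ (by positivity) (by norm_num)]
      linarith
    calc c2 * (u * w * B) ≤ c2 * ((4 * (c2 + 1))⁻¹ * X + (4 * (c2 + 1)) ^ (q - 1) * (H * w) ^ q) := by
          gcongr
          exact y3.trans y2
      _ = c2 * (4 * (c2 + 1))⁻¹ * X + c2 * (4 * (c2 + 1)) ^ (q - 1) * (H * w) ^ q := by ring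
      _ ≤ 1 / 4 * X + c2 * (4 * (c2 + 1)) ^ (q - 1) * (H * w) ^ q := by gcongr
      _ = _ := by ring
  have hvX : v ^ r ≤ X := by
    calc v ^ r = (v ^ 2) ^ (r / 2) := by
          rw [← Real.rpow_natCast, ← Real.rpow_mul hv]
          congr 1
          push_cast
          ring
      _ ≤ X := Real.rpow_le_rpow (by positivity) hvA (by positivity)
  have hBv : B * v ^ 2 = X - ψ * B := by
    rw [← hX, hA]
    ring
  have hw1 : 0 ≤ (4 * c1) ^ (r / 2) := by positivity
  have hw2 : 0 ≤ (4 * (c2 + 1)) ^ (q - 1) := by positivity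
  have hC : interpConst n r s q = 2 * (c1 * (4 * c1) ^ (r / 2) + c2 * (4 * (c2 + 1)) ^ (q - 1)) := rfl
  have hs1 : 0 ≤ c1 * (4 * c1) ^ (r / 2) * (H * w) ^ q := by positivity
  have hs2 : 0 ≤ c2 * (4 * (c2 + 1)) ^ (q - 1) * ψ ^ (r / 2) := by positivity
  rw [hC]
  have z1' : ψ * B + t * s * ψ * B ≤ X / 4 + c1 * (4 * c1) ^ (r / 2) * ψ ^ (r / 2) := by
    refine le_trans (le_of_eq ?_) z1
    rw [hc1]; ring
  have z2' : t * (u * w * B) + n * (u * w * B) ≤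
      X / 4 + c2 * (4 * (c2 + 1)) ^ (q - 1) * (H * w) ^ q := by
    refine le_trans (le_of_eq ?_) z2
    rw [hc2]; ring
  have hmain : (r / 2 - 1) * B' * (Q + P) + 2 * B * (v ^ 2 + R) =
      (r / 2 - 1) * B' * Q + (r / 2 - 1) * B' * P + 2 * (X - ψ * B) + 2 * B * R := by
    rw [← hBv]; ring
  rw [hmain]
  clear_value X c1 c2 B B' Q ψ
  have hlin : 2 * (c1 * (4 * c1) ^ (r / 2) + c2 * (4 * (c2 + 1)) ^ (q - 1)) *
      (ψ ^ (r / 2) + (H * w) ^ q) = 2 * (c1 * (4 * c1) ^ (r / 2) * ψ ^ (r / 2)) +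
      2 * (c1 * (4 * c1) ^ (r / 2) * (H * w) ^ q) +
      2 * (c2 * (4 * (c2 + 1)) ^ (q - 1) * ψ ^ (r / 2)) +
      2 * (c2 * (4 * (c2 + 1)) ^ (q - 1) * (H * w) ^ q) := by ring
  rw [hlin]
  linarith

end RealInequalities

/-! ### Integrated inequalities and the choice of `κ` and `δ`. -/

section Interpolation

theorem le_of_forall_pos_of_continuousAt {f : ℝ → ℝ} {x : ℝ} (hf : ContinuousAt f 0)
    (h : ∀ ε > 0, x ≤ f ε) : x ≤ f 0 := by
  have h1 : Filter.Tendsto f (nhdsWithin 0 (Set.Ioi 0)) (nhds (f 0)) :=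
    hf.tendsto.mono_left nhdsWithin_le_nhds
  refine ge_of_tendsto h1 ?_
  filter_upwards [self_mem_nhdsWithin] with ε hε
  exact h ε hε

theorem add_rpow_le_two_rpow_mul {x y t : ℝ} (hx : 0 ≤ x) (hy : 0 ≤ y) (ht : 0 ≤ t) :
    (x + y) ^ t ≤ 2 ^ t * (x ^ t + y ^ t) := by
  have h1 : (x + y) ^ t ≤ (2 * max x y) ^ t := by
    refine Real.rpow_le_rpow (by positivity) ?_ ht
    linarith [le_max_left x y, le_max_right x y]
  rw [Real.mul_rpow two_pos.le (hx.trans (le_max_left x y))] at h1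
  refine h1.trans ?_
  gcongr
  rcases max_choice x y with h | h <;> rw [h]
  · exact le_add_of_nonneg_right (by positivity)
  · exact le_add_of_nonneg_left (by positivity)

/-- Optimisation of the parameter in the interpolation inequality. -/
theorem le_rpow_mul_rpow_of_forall {V U W C r q α : ℝ} (hr : 0 < r) (hq : 0 < q) (hC : 0 ≤ C)
    (hU : 0 ≤ U) (hW : 0 ≤ W) (hα : 0 < α) (hαr : α + r / (2 * q) = 1)
    (h : ∀ κ > 0, ∀ ε > 0, V ≤ C * (κ ^ (r / 2) * (ε + U) + (κ ^ (-α)) ^ q * W)) :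
    V ≤ 2 * C * U ^ α * W ^ (r / (2 * q)) := by
  have hβ : 0 < r / (2 * q) := by positivity
  have key : ∀ ε > 0, V ≤ 2 * C * (ε + U) ^ α * (ε + W) ^ (r / (2 * q)) := by
    intro ε hε
    have hU' : 0 < ε + U := by positivity
    have hW' : 0 < ε + W := by positivity
    -- This value equalizes the two terms, since `r / 2 + α q = q`. The added `ε` keeps the quotient
    -- positive and finite, and is removed at the end by continuity.
    set κ := ((ε + W) / (ε + U)) ^ (1 / q) with hκ
    have hκ0 : 0 < κ := by positivity
    have e1 : κ ^ (r / 2) * (ε + U) = (ε + U) ^ α * (ε + W) ^ (r / (2 * q)) := by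
      have : α = 1 - r / (2 * q) := by linarith
      rw [hκ, ← Real.rpow_mul (by positivity), this, Real.rpow_sub hU', Real.rpow_one,
        show 1 / q * (r / 2) = r / (2 * q) by field_simp, Real.div_rpow hW'.le hU'.le]
      field_simp
    have e2 : (κ ^ (-α)) ^ q * (ε + W) = (ε + U) ^ α * (ε + W) ^ (r / (2 * q)) := by
      have : r / (2 * q) = 1 - α := by linarith
      rw [hκ, ← Real.rpow_mul (by positivity), ← Real.rpow_mul (by positivity), this,
        Real.rpow_sub hW', Real.rpow_one, show 1 / q * (-α * q) = -α by field_simp,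
        Real.div_rpow hW'.le hU'.le, Real.rpow_neg hW'.le, Real.rpow_neg hU'.le]
      field_simp
    calc V ≤ C * (κ ^ (r / 2) * (ε + U) + (κ ^ (-α)) ^ q * W) := h κ hκ0 ε hε
      _ ≤ C * (κ ^ (r / 2) * (ε + U) + (κ ^ (-α)) ^ q * (ε + W)) := by
        gcongr
        linarith
      _ = _ := by rw [e1, e2]; ring
  have hc : ContinuousAt (fun ε : ℝ => 2 * C * (ε + U) ^ α * (ε + W) ^ (r / (2 * q))) 0 := by
    refine (continuousAt_const.mul ?_).mul ?_
    · exact ContinuousAt.rpow_const (by fun_prop) (Or.inr hα.le)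
    · exact ContinuousAt.rpow_const (by fun_prop) (Or.inr hβ.le)
  simpa using le_of_forall_pos_of_continuousAt hc key

variable {n a b : ℕ} {M : Type*} [TopologicalSpace M] [ChartedSpace (Model n) M]
  [IsManifold (𝓡 n) ∞ M] [T2Space M] [CompactSpace M] [MeasurableSpace M] [BorelSpace M]
  (g : Metric n M)

omit [IsManifold (𝓡 n) ∞ M] [T2Space M] [ChartedSpace (Model n) M] in
theorem integrable_of_continuous (μ : Measure M) [IsFiniteMeasure μ] {f : M → ℝ}
    (hf : Continuous f) : Integrable f μ :=
  hf.integrable_of_hasCompactSupport (HasCompactSupport.of_compactSpace f)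

theorem integral_nabla_rpow_le {T : TensorField n M a b} (hT : IsSmooth T) {r s q κ δ H : ℝ}
    (hr : 0 < r) (hs : 0 ≤ s) (hq : 1 ≤ q) (hκ : 0 < κ) (hδ : 0 < δ) (hH0 : 0 ≤ H)
    (hH : ∀ᵐ x ∂(riemVolume g), tensorNorm g T x * weight g κ δ s T x ^ (r / 2 - 1) ≤
      H * (weight g κ δ s T x ^ (r / 2)) ^ (1 - 1 / q)) :
    ∫ x, tensorNorm g (nabla g T) x ^ r ∂(riemVolume g) ≤ interpConst n r s q *
      (∫ x, (κ * (δ + tensorNorm g T x ^ 2) ^ s) ^ (r / 2) ∂(riemVolume g)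
        + H ^ q * ∫ x, tensorNorm g (nabla g (nabla g T)) x ^ q ∂(riemVolume g)) := by
  have := isFiniteMeasure_riemVolume g
  have hu := continuous_tensorNorm g hT
  have hv := continuous_tensorNorm g (hT.nabla g)
  have hw := continuous_tensorNorm g ((hT.nabla g).nabla g)
  have hq0 : 0 < q := one_pos.trans_le hq
  have hθ : IsSmooth (mulDiff g (fun x => weight g κ δ s T x ^ (r / 2 - 1))
      fun x => tensorNorm g T x ^ 2) :=
    (isSmoothFun_weight_rpow g hκ hδ hT _).mulDiff g (hT.tensorNorm_sq g)
  set D := divg g (mulDiff g (fun x => weight g κ δ s T x ^ (r / 2 - 1))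
      fun x => tensorNorm g T x ^ 2) with hD
  have hDi : Integrable D (riemVolume g) := integrable_of_continuous _ (continuous_divg g hθ)
  have hD0 : ∫ x, D x ∂(riemVolume g) = 0 := integral_divg_eq_zero g hθ
  have hVi : Integrable (fun x => tensorNorm g (nabla g T) x ^ r) (riemVolume g) :=
    integrable_of_continuous _ (hv.rpow_const fun _ => Or.inr hr.le)
  have hWi : Integrable (fun x => (H * tensorNorm g (nabla g (nabla g T)) x) ^ q) (riemVolume g) :=
    integrable_of_continuous _ ((continuous_const.mul hw).rpow_const fun _ => Or.inr hq0.le)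
  have hUi : Integrable (fun x => (κ * (δ + tensorNorm g T x ^ 2) ^ s) ^ (r / 2))
      (riemVolume g) :=
    integrable_of_continuous _ ((continuous_const.mul ((continuous_const.add
      (hu.pow 2)).rpow_const fun _ => Or.inr hs)).rpow_const fun _ => Or.inr (by positivity))
  have hle : ∀ᵐ x ∂(riemVolume g), tensorNorm g (nabla g T) x ^ r ≤ D x + interpConst n r s q *
      ((κ * (δ + tensorNorm g T x ^ 2) ^ s) ^ (r / 2) +
        (H * tensorNorm g (nabla g (nabla g T)) x) ^ q) := by
    filter_upwards [hH] with x hx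
    obtain ⟨N, P, R, h1, h2, h3, h4, h5⟩ := divg_mulDiff_weight g hκ hδ hT (r / 2 - 1) x (s := s)
    rw [hD, h5]
    exact rpow_le_divergence hr hs hq (tensorNorm_nonneg g T x) (tensorNorm_nonneg g _ x)
      (tensorNorm_nonneg g _ x) hκ hδ hH0 rfl hx h1 h2 h3 h4
  have hWUi : Integrable (fun x => interpConst n r s q *
      ((κ * (δ + tensorNorm g T x ^ 2) ^ s) ^ (r / 2) +
        (H * tensorNorm g (nabla g (nabla g T)) x) ^ q)) (riemVolume g) :=
    (hUi.add hWi).const_mul _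
  refine (integral_mono_ae hVi (hDi.add hWUi) hle).trans (le_of_eq ?_)
  rw [integral_add' hDi hWUi, hD0, zero_add, integral_const_mul, integral_add hUi hWi]
  congr 2
  rw [← integral_const_mul]
  congr 1
  funext x
  rw [Real.mul_rpow hH0 (tensorNorm_nonneg g _ x)]

/-- The case `p = ∞`, `r = 2q`. With `s = 0` the weight is `κ + |∇T|²`, so `δ` is irrelevant, and
`hH` holds with `H = K` because `A^(q-1) = (A^q)^(1-1/q)`. The `κ` term is `κ^q` times the finite
volume and disappears as `κ → 0`. -/
theorem integral_nabla_rpow_le_of_ae_le {T : TensorField n M a b} (hT : IsSmooth T) {q K : ℝ}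
    (hq : 1 ≤ q) (hK0 : 0 ≤ K) (hK : ∀ᵐ x ∂(riemVolume g), tensorNorm g T x ≤ K) :
    ∫ x, tensorNorm g (nabla g T) x ^ (2 * q) ∂(riemVolume g) ≤ interpConst n (2 * q) 0 q *
      (K ^ q * ∫ x, tensorNorm g (nabla g (nabla g T)) x ^ q ∂(riemVolume g)) := by
  have := isFiniteMeasure_riemVolume g
  have hq0 : 0 < q := one_pos.trans_le hq
  have key : ∀ κ > 0, ∫ x, tensorNorm g (nabla g T) x ^ (2 * q) ∂(riemVolume g) ≤
      interpConst n (2 * q) 0 q * (κ ^ q * (riemVolume g).real Set.univ +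
      K ^ q * ∫ x, tensorNorm g (nabla g (nabla g T)) x ^ q ∂(riemVolume g)) := by
    intro κ hκ
    refine (integral_nabla_rpow_le g hT (r := 2 * q) (s := 0) (by positivity) le_rfl hq hκ one_pos
      hK0 ?_).trans (le_of_eq ?_)
    · filter_upwards [hK] with x hx
      have hA := weight_pos g hκ one_pos T x (s := 0)
      rw [← Real.rpow_mul hA.le, show 2 * q / 2 * (1 - 1 / q) = 2 * q / 2 - 1 by field_simp]
      gcongr
    · have e : 2 * q / 2 = q := by ring
      simp only [Real.rpow_zero, mul_one, integral_const, smul_eq_mul, e]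
      rw [mul_comm (κ ^ q)]
  have hc : ContinuousAt (fun κ : ℝ => interpConst n (2 * q) 0 q *
      (κ ^ q * (riemVolume g).real Set.univ +
        K ^ q * ∫ x, tensorNorm g (nabla g (nabla g T)) x ^ q ∂(riemVolume g))) 0 := by
    refine continuousAt_const.mul (ContinuousAt.add (ContinuousAt.mul ?_ continuousAt_const)
      continuousAt_const)
    exact ContinuousAt.rpow_const continuousAt_id (Or.inr hq0.le)
  simpa [hq0.ne'] using le_of_forall_pos_of_continuousAt hc key

/-- The choice `s = p / r` serves two purposes: `|T| ≤ κ^(-α) A^α` with `α = r / (2p)`, which gives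
`hH` with `H = κ^(-α)`, and `(κ (δ + |T|²)^s)^(r/2) = κ^(r/2) (δ + |T|²)^(p/2)`, which is comparable
to `|T|^p`. -/
theorem integral_nabla_rpow_le_mul {T : TensorField n M a b} (hT : IsSmooth T) {p q r : ℝ}
    (hp : 0 < p) (hq : 1 ≤ q) (hr : 0 < r) (hpqr : r / (2 * p) + r / (2 * q) = 1) :
    ∫ x, tensorNorm g (nabla g T) x ^ r ∂(riemVolume g) ≤
      2 * (interpConst n r (p / r) q * 2 ^ (p / 2)) *
      (∫ x, tensorNorm g T x ^ p ∂(riemVolume g)) ^ (r / (2 * p)) *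
      (∫ x, tensorNorm g (nabla g (nabla g T)) x ^ q ∂(riemVolume g)) ^ (r / (2 * q)) := by
  have := isFiniteMeasure_riemVolume g
  have hq0 : 0 < q := one_pos.trans_le hq
  have hs : 0 ≤ p / r := by positivity
  have hC := interpConst_nonneg n r hs q
  set α := r / (2 * p) with hα
  have hα0 : 0 < α := by positivity
  have hU0 : 0 ≤ ∫ x, tensorNorm g T x ^ p ∂(riemVolume g) :=
    integral_nonneg fun x => Real.rpow_nonneg (tensorNorm_nonneg g T x) _
  have hW0 : 0 ≤ ∫ x, tensorNorm g (nabla g (nabla g T)) x ^ q ∂(riemVolume g) :=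
    integral_nonneg fun x => Real.rpow_nonneg (tensorNorm_nonneg g _ x) _
  refine le_rpow_mul_rpow_of_forall hr hq0 (by positivity) hU0 hW0 hα0 hpqr fun κ hκ ε hε => ?_
  set m := (riemVolume g).real Set.univ with hm
  have hm0 : 0 ≤ m := measureReal_nonneg
  -- Chosen so that `δ^(p/2)` integrates to at most `ε`; the `+ 1` covers volume zero.
  set δ := (ε / (m + 1)) ^ (2 / p) with hδ
  have hδ0 : 0 < δ := by positivity
  have hδp : δ ^ (p / 2) = ε / (m + 1) := by
    rw [hδ, ← Real.rpow_mul (by positivity), show 2 / p * (p / 2) = 1 by field_simp, Real.rpow_one]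
  have hA : ∀ x, tensorNorm g T x ≤ κ ^ (-α) * weight g κ δ (p / r) T x ^ α := by
    intro x
    have hu := tensorNorm_nonneg g T x
    have h1 : κ * (tensorNorm g T x ^ 2) ^ (p / r) ≤ weight g κ δ (p / r) T x := by
      have h2 : (tensorNorm g T x ^ 2) ^ (p / r) ≤ (δ + tensorNorm g T x ^ 2) ^ (p / r) := by
        gcongr
        linarith
      have h3 := mul_le_mul_of_nonneg_left h2 hκ.le
      unfold weight
      linarith [sq_nonneg (tensorNorm g (nabla g T) x)]
    have h4 := Real.rpow_le_rpow (by positivity) h1 hα0.le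
    rw [Real.mul_rpow hκ.le (by positivity), ← Real.rpow_mul (by positivity),
      show p / r * α = 1 / 2 by rw [hα]; field_simp, ← Real.sqrt_eq_rpow, Real.sqrt_sq hu] at h4
    rw [Real.rpow_neg hκ.le, inv_mul_eq_div, le_div_iff₀ (by positivity), mul_comm]
    exact h4
  have hmain := integral_nabla_rpow_le g hT (r := r) (s := p / r) (q := q) (κ := κ) (δ := δ)
    (H := κ ^ (-α)) hr hs hq hκ hδ0 (by positivity) (Filter.Eventually.of_forall fun x => by
      have hA0 := weight_pos g hκ hδ0 T x (s := p / r)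
      have e : α + (r / 2 - 1) = r / 2 * (1 - 1 / q) := by
        have e1 : r / 2 * (1 - 1 / q) = r / 2 - r / (2 * q) := by field_simp
        rw [e1]
        linarith
      rw [← Real.rpow_mul hA0.le, ← e, Real.rpow_add hA0, ← mul_assoc]
      gcongr
      exact hA x)
  refine hmain.trans ?_
  have hint : ∫ x, (κ * (δ + tensorNorm g T x ^ 2) ^ (p / r)) ^ (r / 2) ∂(riemVolume g) ≤
      κ ^ (r / 2) * (2 ^ (p / 2) * (ε + ∫ x, tensorNorm g T x ^ p ∂(riemVolume g))) := by
    have hu := continuous_tensorNorm g hT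
    have hUi : Integrable (fun x => tensorNorm g T x ^ p) (riemVolume g) :=
      integrable_of_continuous _ (hu.rpow_const fun _ => Or.inr hp.le)
    have hle : ∀ x, (κ * (δ + tensorNorm g T x ^ 2) ^ (p / r)) ^ (r / 2) ≤
        κ ^ (r / 2) * (2 ^ (p / 2) * (ε / (m + 1) + tensorNorm g T x ^ p)) := by
      intro x
      have hux := tensorNorm_nonneg g T x
      rw [Real.mul_rpow hκ.le (by positivity), ← Real.rpow_mul (by positivity),
        show p / r * (r / 2) = p / 2 by field_simp]
      have h1 := add_rpow_le_two_rpow_mul hδ0.le (sq_nonneg (tensorNorm g T x))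
        (show 0 ≤ p / 2 by positivity)
      have h2 : (tensorNorm g T x ^ 2) ^ (p / 2) = tensorNorm g T x ^ p := by
        rw [← Real.rpow_natCast, ← Real.rpow_mul hux]
        congr 1
        push_cast
        ring
      rw [hδp, h2] at h1
      gcongr
    have hi2 : Integrable (fun x => κ ^ (r / 2) * (2 ^ (p / 2) *
        (ε / (m + 1) + tensorNorm g T x ^ p))) (riemVolume g) :=
      (((integrable_const _).add hUi).const_mul _).const_mul _
    refine (integral_mono_of_nonneg (Filter.Eventually.of_forall fun x => ?_) hi2
      (Filter.Eventually.of_forall hle)).trans ?_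
    · have hux := tensorNorm_nonneg g T x
      positivity
    · rw [integral_const_mul, integral_const_mul, integral_add (integrable_const _) hUi,
        integral_const, smul_eq_mul, ← hm]
      gcongr
      rw [mul_div_assoc', div_le_iff₀ (by positivity)]
      nlinarith
  have h2p : (1 : ℝ) ≤ 2 ^ (p / 2) := Real.one_le_rpow one_le_two (by positivity)
  have hWκ : 0 ≤ (κ ^ (-α)) ^ q *
      ∫ x, tensorNorm g (nabla g (nabla g T)) x ^ q ∂(riemVolume g) := by positivity
  rw [mul_assoc]
  refine mul_le_mul_of_nonneg_left ?_ hC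
  rw [mul_add]
  refine add_le_add (hint.trans (le_of_eq (by ring))) ?_
  exact le_mul_of_one_le_left hWκ h2p

end Interpolation

/-! ### From integrals to `L^p` norms. -/

section Norms

variable {n a b : ℕ} {M : Type*} [TopologicalSpace M] [ChartedSpace (Model n) M]
  [IsManifold (𝓡 n) ∞ M] [CompactSpace M] [MeasurableSpace M] [BorelSpace M] (g : Metric n M)

theorem memLp_tensorNorm {T : TensorField n M a b} (hT : IsSmooth T) (p : ℝ≥0∞) :
    MemLp (tensorNorm g T) p (riemVolume g) := by
  have := isFiniteMeasure_riemVolume g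
  have hu := continuous_tensorNorm g hT
  exact hu.memLp_of_hasCompactSupport (HasCompactSupport.of_compactSpace _)

theorem lpNorm_ne_top {T : TensorField n M a b} (hT : IsSmooth T) (p : ℝ≥0∞) :
    lpNorm g p T ≠ ⊤ := (memLp_tensorNorm g hT p).eLpNorm_ne_top

/-- Exponents are written as `(ENNReal.ofReal z)⁻¹` from here on, since the reciprocals are what
interpolates linearly; `z = 0`, excluded here, encodes exponent `∞`. -/
theorem lpNorm_eq_integral {T : TensorField n M a b} (hT : IsSmooth T) {z : ℝ} (hz : 0 < z) :
    lpNorm g (ENNReal.ofReal z)⁻¹ T =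
      ENNReal.ofReal ((∫ x, tensorNorm g T x ^ z⁻¹ ∂(riemVolume g)) ^ z) := by
  rw [← ENNReal.ofReal_inv_of_pos hz, lpNorm,
    (memLp_tensorNorm g hT _).eLpNorm_eq_integral_rpow_norm (by simpa using hz) (by simp),
    ENNReal.toReal_ofReal (by positivity), inv_inv]
  simp only [Real.norm_of_nonneg (tensorNorm_nonneg g T _)]

theorem ae_le_lpNorm_top {T : TensorField n M a b} (hT : IsSmooth T) :
    ∀ᵐ x ∂(riemVolume g), tensorNorm g T x ≤ (lpNorm g ⊤ T).toReal := by
  filter_upwards [ae_le_eLpNormEssSup (f := tensorNorm g T) (μ := riemVolume g)] with x hx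
  rw [← eLpNorm_exponent_top] at hx
  have h := ENNReal.toReal_mono (lpNorm_ne_top g hT ⊤) hx
  rwa [toReal_enorm, Real.norm_of_nonneg (tensorNorm_nonneg g T _)] at h

theorem rpow_sq_le {V C U W x y z : ℝ} (hV : 0 ≤ V) (hC : 0 ≤ C) (hU : 0 ≤ U) (hW : 0 ≤ W)
    (hz : 0 < z) (h : V ≤ C * U ^ (x / (2 * z)) * W ^ (y / (2 * z))) :
    (V ^ z) ^ 2 ≤ C ^ (2 * z) * U ^ x * W ^ y := by
  have h1 := Real.rpow_le_rpow hV h (show 0 ≤ 2 * z by positivity)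
  rw [Real.mul_rpow (by positivity) (by positivity), Real.mul_rpow hC (by positivity),
    ← Real.rpow_mul hU, ← Real.rpow_mul hW, div_mul_cancel₀ _ (by positivity),
    div_mul_cancel₀ _ (by positivity)] at h1
  rwa [← Real.rpow_natCast, ← Real.rpow_mul hV, mul_comm z, Nat.cast_ofNat]

/-- The interpolation inequality `‖∇T‖_r² ≤ C ‖T‖_p ‖∇²T‖_q` where `1/p = x`, `1/q = y`,
`1/r = z`. -/
theorem exists_lpNorm_nabla_sq_le (n : ℕ) {x y z : ℝ} (hx : 0 ≤ x) (hy0 : 0 < y) (hy : y ≤ 1)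
    (hxyz : x + y = 2 * z) :
    ∃ C : ℝ≥0, ∀ (M : Type*) [TopologicalSpace M] [T2Space M] [CompactSpace M]
      [ChartedSpace (Model n) M] [IsManifold (𝓡 n) ∞ M]
      [MeasurableSpace M] [BorelSpace M] (g : Metric n M)
      (a b : ℕ) (T : TensorField n M a b), IsSmooth T →
        lpNorm g (ENNReal.ofReal z)⁻¹ (nabla g T) ^ 2 ≤
          C * lpNorm g (ENNReal.ofReal x)⁻¹ T *
            lpNorm g (ENNReal.ofReal y)⁻¹ (nabla g (nabla g T)) := by
  have hz : 0 < z := by linarith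
  have hq : 1 ≤ y⁻¹ := (one_le_inv₀ hy0).2 hy
  -- `x = 0` means `p = ∞`, where the sup norm takes the place of an integral.
  rcases hx.eq_or_lt with rfl | hx
  · have hyz : y = 2 * z := by linarith
    have hC := interpConst_nonneg n (2 * y⁻¹) le_rfl y⁻¹
    refine ⟨(interpConst n (2 * y⁻¹) 0 y⁻¹ ^ (2 * z)).toNNReal, ?_⟩
    intro M _ _ _ _ _ _ _ g a b T hT
    have hmain := integral_nabla_rpow_le_of_ae_le g hT hq ENNReal.toReal_nonneg
      (ae_le_lpNorm_top g hT)
    have hV0 : 0 ≤ ∫ x, tensorNorm g (nabla g T) x ^ z⁻¹ ∂(riemVolume g) :=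
      integral_nonneg fun x => Real.rpow_nonneg (tensorNorm_nonneg g _ x) _
    have hW0 : 0 ≤ ∫ x, tensorNorm g (nabla g (nabla g T)) x ^ y⁻¹ ∂(riemVolume g) :=
      integral_nonneg fun x => Real.rpow_nonneg (tensorNorm_nonneg g _ x) _
    have e1 : 2 * y⁻¹ = z⁻¹ := by
      rw [hyz]
      field_simp
    rw [lpNorm_eq_integral g (hT.nabla g) hz, lpNorm_eq_integral g ((hT.nabla g).nabla g) hy0,
      ENNReal.ofReal_zero, ENNReal.inv_zero, ← ENNReal.ofReal_toReal (lpNorm_ne_top g hT ⊤),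
      ← ENNReal.ofReal_pow (by positivity), ENNReal.ofNNReal_toNNReal,
      ← ENNReal.ofReal_mul (by positivity), ← ENNReal.ofReal_mul (by positivity)]
    refine ENNReal.ofReal_le_ofReal ?_
    rw [e1, ← mul_assoc] at hmain
    have e2 : y⁻¹ = 1 / (2 * z) := by rw [hyz, one_div]
    have e3 : y / (2 * z) = 1 := by rw [hyz, div_self (by positivity)]
    have h := rpow_sq_le (x := 1) (y := y) hV0 hC (ENNReal.toReal_nonneg (a := lpNorm g ⊤ T))
      hW0 hz (by
        rw [e3, ← e2, Real.rpow_one]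
        simpa only [e1] using hmain)
    rw [Real.rpow_one] at h
    exact h
  · have hC := interpConst_nonneg n z⁻¹ (s := x⁻¹ / z⁻¹) (by positivity) y⁻¹
    refine ⟨((2 * (interpConst n z⁻¹ (x⁻¹ / z⁻¹) y⁻¹ * 2 ^ (x⁻¹ / 2))) ^ (2 * z)).toNNReal, ?_⟩
    intro M _ _ _ _ _ _ _ g a b T hT
    have e1 : z⁻¹ / (2 * x⁻¹) = x / (2 * z) := by field_simp
    have e2 : z⁻¹ / (2 * y⁻¹) = y / (2 * z) := by field_simp
    have hmain := integral_nabla_rpow_le_mul g hT (p := x⁻¹) (q := y⁻¹) (r := z⁻¹)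
      (by positivity) hq (by positivity) (by
        rw [e1, e2, ← add_div, hxyz, div_self (by positivity)])
    rw [e1, e2] at hmain
    have hV0 : 0 ≤ ∫ x, tensorNorm g (nabla g T) x ^ z⁻¹ ∂(riemVolume g) :=
      integral_nonneg fun x => Real.rpow_nonneg (tensorNorm_nonneg g _ x) _
    have hU0 : 0 ≤ ∫ t, tensorNorm g T t ^ x⁻¹ ∂(riemVolume g) :=
      integral_nonneg fun x => Real.rpow_nonneg (tensorNorm_nonneg g _ x) _
    have hW0 : 0 ≤ ∫ x, tensorNorm g (nabla g (nabla g T)) x ^ y⁻¹ ∂(riemVolume g) :=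
      integral_nonneg fun x => Real.rpow_nonneg (tensorNorm_nonneg g _ x) _
    rw [lpNorm_eq_integral g (hT.nabla g) hz, lpNorm_eq_integral g ((hT.nabla g).nabla g) hy0,
      lpNorm_eq_integral g hT hx, ← ENNReal.ofReal_pow (by positivity),
      ENNReal.ofNNReal_toNNReal, ← ENNReal.ofReal_mul (by positivity),
      ← ENNReal.ofReal_mul (by positivity)]
    exact ENNReal.ofReal_le_ofReal (rpow_sq_le hV0 (by positivity) hU0 hW0 hz hmain)

end Norms

/-! ### Discrete logarithmic convexity. -/

section Chain

/-- A finite sequence that is logarithmically convex satisfies the interpolation inequality. -/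
theorem pow_le_of_logConvex {k : ℕ} {β : ℕ → ℝ} (h0 : ∀ j, 0 ≤ β j)
    (h : ∀ j, j + 2 ≤ k → β (j + 1) ^ 2 ≤ β j * β (j + 2)) :
    ∀ m, m + 1 ≤ k → β m ^ (m + 1) ≤ β 0 * β (m + 1) ^ m := by
  intro m
  induction m with
  | zero => intro _; simp
  | succ m ih =>
    intro hm
    have h1 := ih (by omega)
    have h2 := h m (by omega)
    -- The induction step divides by `β (m + 1) ^ m`; when `β (m + 1) = 0` the left side is already
    -- zero.
    rcases (h0 (m + 1)).eq_or_lt with hz | hpos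
    · rw [← hz, zero_pow (by omega)]
      exact mul_nonneg (h0 _) (pow_nonneg (h0 _) _)
    · have h3 : β (m + 1) ^ m * β (m + 1) ^ (m + 2) ≤
          β (m + 1) ^ m * (β 0 * β (m + 2) ^ (m + 1)) := by
        calc β (m + 1) ^ m * β (m + 1) ^ (m + 2) = (β (m + 1) ^ 2) ^ (m + 1) := by ring
          _ ≤ (β m * β (m + 2)) ^ (m + 1) := by gcongr
          _ = β m ^ (m + 1) * β (m + 2) ^ (m + 1) := mul_pow _ _ _
          _ ≤ β 0 * β (m + 1) ^ m * β (m + 2) ^ (m + 1) := by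
            have := h0 (m + 2)
            gcongr
          _ = _ := by ring
      exact le_of_mul_le_mul_left h3 (pow_pos hpos m)

/-- Induction moves the right endpoint from `j + i` to `j + i + 1`, eliminating `β (j + i)` by
`pow_le_of_logConvex`. Comparing `(j + i)`-th powers keeps all exponents integral. -/
theorem pow_le_mul_of_logConvex {k : ℕ} {β : ℕ → ℝ} (h0 : ∀ j, 0 ≤ β j)
    (h : ∀ j, j + 2 ≤ k → β (j + 1) ^ 2 ≤ β j * β (j + 2)) {j : ℕ} (hj : 0 < j) :
    ∀ i, j + i ≤ k → β j ^ (j + i) ≤ β 0 ^ i * β (j + i) ^ j := by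
  intro i
  induction i with
  | zero => intro _; simp
  | succ i ih =>
    intro hi
    have h1 := ih (by omega)
    have h2 := pow_le_of_logConvex h0 h (j + i) (by omega)
    have h3 : (β j ^ (j + (i + 1))) ^ (j + i) ≤ (β 0 ^ (i + 1) * β (j + (i + 1)) ^ j) ^ (j + i) := by
      have := h0 0
      have := h0 (j + i)
      have := h0 j
      calc (β j ^ (j + (i + 1))) ^ (j + i) = (β j ^ (j + i)) ^ (j + i + 1) := by ring
        _ ≤ (β 0 ^ i * β (j + i) ^ j) ^ (j + i + 1) := by gcongr
        _ = (β 0 ^ i) ^ (j + i + 1) * (β (j + i) ^ (j + i + 1)) ^ j := by ring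
        _ ≤ (β 0 ^ i) ^ (j + i + 1) * (β 0 * β (j + i + 1) ^ (j + i)) ^ j := by gcongr
        _ = _ := by rw [← add_assoc]; ring
    have := h0 0
    have := h0 (j + (i + 1))
    exact le_of_pow_le_pow_left₀ (by omega) (by positivity) h3

/-- The factor `C` is removed by passing to `α i * l ^ (i * i)` with `l = √C`: since `i² + (i+2)² =
2 (i+1)² + 2`, the new sequence gains exactly `l² = C` and is logarithmically convex. -/
theorem le_rpow_mul_rpow_of_sq_le {k : ℕ} {α : ℕ → ℝ} {C : ℝ} (hC : 1 ≤ C) (h0 : ∀ j, 0 ≤ α j)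
    (h : ∀ j, j + 2 ≤ k → α (j + 1) ^ 2 ≤ C * (α j * α (j + 2))) {j : ℕ} (hj : 0 < j)
    (hjk : j ≤ k) :
    α j ≤ √C ^ (k * k) * α 0 ^ (1 - (j : ℝ) / k) * α k ^ ((j : ℝ) / k) := by
  have hk : 0 < k := hj.trans_le hjk
  set l := √C with hl
  have hl1 : 1 ≤ l := Real.one_le_sqrt.2 hC
  have hl2 : l ^ 2 = C := Real.sq_sqrt (by linarith)
  have hl0 : 0 < l := by linarith
  have hβ0 : ∀ i, 0 ≤ α i * l ^ (i * i) := fun i => mul_nonneg (h0 i) (by positivity)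
  have h1 := pow_le_mul_of_logConvex (k := k) (β := fun i => α i * l ^ (i * i)) hβ0 (fun i hi => by
    calc (α (i + 1) * l ^ ((i + 1) * (i + 1))) ^ 2
        = α (i + 1) ^ 2 * l ^ (2 * ((i + 1) * (i + 1))) := by ring
      _ ≤ C * (α i * α (i + 2)) * l ^ (2 * ((i + 1) * (i + 1))) := by
          gcongr
          exact h i hi
      _ = _ := by rw [← hl2]; ring) hj (k - j) (by omega)
  simp only [show j + (k - j) = k by omega, mul_zero, pow_zero, mul_one] at h1
  have hak := h0 k
  have ha0 := h0 0
  have h2 : α j ^ k ≤ (l ^ (k * k)) ^ k * α 0 ^ (k - j) * α k ^ j := by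
    calc α j ^ k ≤ (α j * l ^ (j * j)) ^ k := by
          refine pow_le_pow_left₀ (h0 j) (le_mul_of_one_le_right (h0 j) (one_le_pow₀ hl1)) _
      _ ≤ α 0 ^ (k - j) * (α k * l ^ (k * k)) ^ j := h1
      _ = (l ^ (k * k)) ^ j * α 0 ^ (k - j) * α k ^ j := by ring
      _ ≤ _ := by
          gcongr
          exact one_le_pow₀ hl1
  have hk0 : (0 : ℝ) < k := by exact_mod_cast hk
  refine le_of_pow_le_pow_left₀ hk.ne' (by positivity) (h2.trans (le_of_eq ?_))
  rw [mul_pow, mul_pow, ← Real.rpow_natCast (α 0 ^ _), ← Real.rpow_natCast (α k ^ _),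
    ← Real.rpow_mul ha0, ← Real.rpow_mul hak, div_mul_cancel₀ _ hk0.ne', sub_mul, one_mul,
    div_mul_cancel₀ _ hk0.ne', ← Nat.cast_sub hjk, Real.rpow_natCast, Real.rpow_natCast]

end Chain

end RiemTensor

end

/-! ### The interpolation inequality for all intermediate derivatives. -/

theorem mainTheorem12 (n k : ℕ) (hk : 0 < k) (p q : ℝ≥0∞) (hp : 1 ≤ p) (hq : 1 ≤ q)
    (hq' : q ≠ ⊤) :
    ∃ C : ℝ≥0, ∀ (M : Type*) [TopologicalSpace M] [T2Space M] [CompactSpace M]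
      [ChartedSpace (EuclideanSpace ℝ (Fin n)) M] [IsManifold (𝓡 n) ∞ M]
      [MeasurableSpace M] [BorelSpace M] (g : RiemTensor.Metric n M)
      (a b : ℕ) (T : RiemTensor.TensorField n M a b), RiemTensor.IsSmooth T →
      ∀ j : ℕ, j ≤ k → ∀ r : ℝ≥0∞,
        1 / r = ENNReal.ofReal (1 - (j : ℝ) / k) / p + ENNReal.ofReal ((j : ℝ) / k) / q →
        RiemTensor.lpNorm g r (RiemTensor.iterNabla g T j) ≤
          C * RiemTensor.lpNorm g p T ^ (1 - (j : ℝ) / k)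
            * RiemTensor.lpNorm g q (RiemTensor.iterNabla g T k) ^ ((j : ℝ) / k) := by
  have hk0 : (0 : ℝ) < k := by exact_mod_cast hk
  have hpi : p⁻¹ ≤ 1 := ENNReal.inv_le_one.2 hp
  have hqi : q⁻¹ ≤ 1 := ENNReal.inv_le_one.2 hq
  have hpt : p⁻¹ ≠ ⊤ := (hpi.trans_lt ENNReal.one_lt_top).ne
  have hqt : q⁻¹ ≠ ⊤ := (hqi.trans_lt ENNReal.one_lt_top).ne
  set p' := p⁻¹.toReal with hp'
  set q' := q⁻¹.toReal with hqq
  have hp0 : 0 ≤ p' := ENNReal.toReal_nonneg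
  have hq0 : 0 < q' := ENNReal.toReal_pos (by simpa using hq') hqt
  have hp1 : p' ≤ 1 := (ENNReal.toReal_mono ENNReal.one_ne_top hpi).trans_eq ENNReal.toReal_one
  have hq1 : q' ≤ 1 := (ENNReal.toReal_mono ENNReal.one_ne_top hqi).trans_eq ENNReal.toReal_one
  -- `x j` is `1 / r_j`. It is affine in `j`, which is the relation `x + y = 2 z` of the three-term
  -- inequality; `q < ∞` makes it positive for `0 < j ≤ k`, so only `r_0 = p` can be infinite.
  let x : ℕ → ℝ := fun j => (1 - (j : ℝ) / k) * p' + (j : ℝ) / k * q'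
  have hjk1 : ∀ j : ℕ, j ≤ k → (j : ℝ) / k ≤ 1 := fun j hj => by
    rw [div_le_one hk0]
    exact_mod_cast hj
  have hx0 : ∀ j, j ≤ k → 0 ≤ x j := fun j hj => by
    have := hjk1 j hj
    have h1 : 0 ≤ 1 - (j : ℝ) / k := by linarith
    positivity
  have hxpos : ∀ j, 0 < j → j ≤ k → 0 < x j := fun j hj0 hj => by
    have := hjk1 j hj
    have h1 : 0 ≤ 1 - (j : ℝ) / k := by linarith
    have h2 : (0 : ℝ) < j := by exact_mod_cast hj0
    positivity
  have hx1 : ∀ j, j ≤ k → x j ≤ 1 := fun j hj => by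
    have h0 := hjk1 j hj
    have h1 : 0 ≤ 1 - (j : ℝ) / k := by linarith
    have h2 : 0 ≤ (j : ℝ) / k := by positivity
    calc x j ≤ (1 - (j : ℝ) / k) * 1 + (j : ℝ) / k * 1 :=
          add_le_add (mul_le_mul_of_nonneg_left hp1 h1) (mul_le_mul_of_nonneg_left hq1 h2)
      _ = 1 := by ring
  have hxmid : ∀ j, x j + x (j + 2) = 2 * x (j + 1) := fun j => by
    simp only [x]
    push_cast
    field_simp
    ring
  have hxp : (ENNReal.ofReal (x 0))⁻¹ = p := by
    simp only [x, Nat.cast_zero, zero_div, sub_zero, one_mul, zero_mul, add_zero]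
    rw [ENNReal.ofReal_toReal hpt, inv_inv]
  have hxq : (ENNReal.ofReal (x k))⁻¹ = q := by
    simp only [x, div_self hk0.ne', sub_self, one_mul, zero_mul, zero_add]
    rw [ENNReal.ofReal_toReal hqt, inv_inv]
  have hxr : ∀ j, j ≤ k → ∀ r : ℝ≥0∞,
      1 / r = ENNReal.ofReal (1 - (j : ℝ) / k) / p + ENNReal.ofReal ((j : ℝ) / k) / q →
      r = (ENNReal.ofReal (x j))⁻¹ := fun j hj r hr => by
    have h0 := hjk1 j hj
    have h1 : 0 ≤ 1 - (j : ℝ) / k := by linarith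
    have h2 : 0 ≤ (j : ℝ) / k := by positivity
    rw [← inv_inv r, ← one_div r, hr]
    congr 1
    rw [ENNReal.ofReal_add (by positivity) (by positivity), ENNReal.ofReal_mul h1,
      ENNReal.ofReal_mul h2, ENNReal.ofReal_toReal hpt, ENNReal.ofReal_toReal hqt,
      div_eq_mul_inv _ p, div_eq_mul_inv _ q]
  have hex : ∀ j, ∃ C : ℝ≥0, j + 2 ≤ k → _ := fun j => by
    by_cases hj : j + 2 ≤ k
    · obtain ⟨C, hC⟩ := RiemTensor.exists_lpNorm_nabla_sq_le n (hx0 j (by omega))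
        (hxpos (j + 2) (by omega) hj) (hx1 (j + 2) hj) (hxmid j)
      exact ⟨C, fun _ => hC⟩
    · exact ⟨0, fun h => absurd h hj⟩
  choose c hc using hex
  -- `D` is fixed before the manifold; it dominates every constant used in the chain, and the `1`
  -- gives `1 ≤ D`. The exponent `k * k` below makes the final constant independent of `j`.
  set D : ℝ≥0 := 1 + ∑ i ∈ Finset.range k, c i with hD
  refine ⟨(√D ^ (k * k)).toNNReal, ?_⟩
  intro M _ _ _ _ _ _ _ g a b T hT j hj r hr
  obtain rfl := hxr j hj r hr
  have hS : ∀ i, RiemTensor.IsSmooth (RiemTensor.iterNabla g T i) := fun i => hT.iterNabla g i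
  have hfin : ∀ i, RiemTensor.lpNorm g (ENNReal.ofReal (x i))⁻¹ (RiemTensor.iterNabla g T i) ≠ ⊤ :=
    fun i => RiemTensor.lpNorm_ne_top g (hS i) _
  have hD1 : (1 : ℝ) ≤ D := by
    rw [hD]
    exact_mod_cast le_add_of_nonneg_right (zero_le (a := ∑ i ∈ Finset.range k, c i))
  rw [← hxp, ← hxq]
  have hT0 : RiemTensor.lpNorm g (ENNReal.ofReal (x 0))⁻¹ T =
    RiemTensor.lpNorm g (ENNReal.ofReal (x 0))⁻¹ (RiemTensor.iterNabla g T 0) := rfl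
  rw [hT0]
  set α : ℕ → ℝ := fun i =>
    (RiemTensor.lpNorm g (ENNReal.ofReal (x i))⁻¹ (RiemTensor.iterNabla g T i)).toReal with hα
  have hα0 : ∀ i, 0 ≤ α i := fun i => ENNReal.toReal_nonneg
  have hstep : ∀ i, i + 2 ≤ k → α (i + 1) ^ 2 ≤ D * (α i * α (i + 2)) := fun i hi => by
    -- The three-term inequality is applied to `∇^i T`, of type `(a, b + i)`, with a constant that
    -- does not depend on the type.
    have h1 : RiemTensor.lpNorm g (ENNReal.ofReal (x (i + 1)))⁻¹ (RiemTensor.iterNabla g T (i + 1))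
        ^ 2 ≤ c i * RiemTensor.lpNorm g (ENNReal.ofReal (x i))⁻¹ (RiemTensor.iterNabla g T i) *
        RiemTensor.lpNorm g (ENNReal.ofReal (x (i + 2)))⁻¹ (RiemTensor.iterNabla g T (i + 2)) :=
      hc i hi M g a (b + i) (RiemTensor.iterNabla g T i) (hS i)
    have h2 := ENNReal.toReal_mono (ENNReal.mul_ne_top (ENNReal.mul_ne_top ENNReal.coe_ne_top
      (hfin i)) (hfin (i + 2))) h1
    rw [ENNReal.toReal_pow, ENNReal.toReal_mul, ENNReal.toReal_mul, ENNReal.coe_toReal,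
      mul_assoc] at h2
    refine h2.trans (mul_le_mul_of_nonneg_right ?_ (mul_nonneg (hα0 _) (hα0 _)))
    have h3 : c i ≤ D := by
      rw [hD]
      exact (Finset.single_le_sum (fun _ _ => zero_le) (Finset.mem_range.2 (by omega))).trans
        (le_add_of_nonneg_left zero_le)
    exact_mod_cast h3
  have hmain : α j ≤ √D ^ (k * k) * α 0 ^ (1 - (j : ℝ) / k) * α k ^ ((j : ℝ) / k) := by
    rcases Nat.eq_zero_or_pos j with rfl | hj0
    · simp only [Nat.cast_zero, zero_div, sub_zero, Real.rpow_one, Real.rpow_zero, mul_one]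
      exact le_mul_of_one_le_left (hα0 0) (one_le_pow₀ (Real.one_le_sqrt.2 hD1))
    · exact RiemTensor.le_rpow_mul_rpow_of_sq_le hD1 hα0 hstep hj0 hj
  have hj1 : 0 ≤ 1 - (j : ℝ) / k := by linarith [hjk1 j hj]
  have hj2 : 0 ≤ (j : ℝ) / k := by positivity
  have hfinal := ENNReal.ofReal_le_ofReal hmain
  rw [ENNReal.ofReal_mul (by positivity), ENNReal.ofReal_mul (by positivity),
    ← ENNReal.ofReal_rpow_of_nonneg (hα0 0) hj1, ← ENNReal.ofReal_rpow_of_nonneg (hα0 k) hj2,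
    ENNReal.ofReal_toReal (hfin j), ENNReal.ofReal_toReal (hfin 0),
    ENNReal.ofReal_toReal (hfin k)] at hfinal
  exact hfinal
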